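/- **Proposition (fundamental solution of ${}^{m+n}\mathcal H$ for $m$ odd).** Let $m\ge 1$ be an odd integer, let $e_1,\dots,e_m$ generate the Clifford algebra $\mathbb R_{0,m}$ (with $e_ie_j+e_je_i=-2\delta_{ij}$), complexified, and put $\underline\partial=\sum_i e_i\partial_{x_i}$, $r=|\underline x|$, $\underline\omega=\underline x/r$. For $\lambda\in\mathbb C$ let $T_\lambda=\mathrm{Fp}\,r^\lambda$ and $U_\lambda=\mathrm{Fp}\,r^{\lambda}\underline\omega$ be the Hadamard finite part distributions on $\mathbb R^m$, and set $$T^*_\lambda=\frac{\pi^{\frac{\lambda+m}2}}{\Gamma(\frac{\lambda+m}2)}T_\lambda\ \ (\lambda\ne -m-2l),\qquad T^*_{-m-2l}=\frac{\pi^{\frac m2-l}}{2^{2l}\Gamma(\frac m2+l)}(-\Delta_m)^l\delta,$$ $$U^*_\lambda=\frac{\pi^{\frac{\lambda+m+1}2}}{\Gamma(\frac{\lambda+m+1}2)}U_\lambda\ \ (\lambda\ne -m-2l-1),\qquad U^*_{-m-2l-1}=-\frac{\pi^{\frac m2-l}}{2^{2l+1}\Gamma(\frac m2+l+1)}\underline\partial^{2l+1}\delta,$$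 with $l=0,1,2,\dots$. For $\mu\in\mathbb C\setminus\{-m,-m-1,-m-2,\dots\}$ let ${}^\mu\mathcal H[F]=\underline\partial^\mu H*F$ be the convolution operator with kernel $$\underline\partial^\mu H=\frac{1-e^{i\pi\mu}}2\,\frac{2^\mu\Gamma(\frac{m+\mu}2)}{\pi^{\frac{m-\mu}2}}\,T^*_{-m-\mu}-\frac{1+e^{i\pi\mu}}2\,\frac{2^\mu\Gamma(\frac{m+\mu+1}2)}{\pi^{\frac{m-\mu+1}2}}\,U^*_{-m-\mu},$$ where the convolution $S*S'$ of tempered distributions is given by $\langle S*S',\varphi\rangle=\lim_k\langle S\otimes S',\eta_k(x,y)\varphi(x+y)\rangle$ whenever, for every Schwartz function $\varphi$, this limit exists for all sequences $(\eta_k)$ of test functions on $\mathbb R^m\times\mathbb R^m$ converging to $1$ (eventually equal to $1$ on each compact set, every derivative bounded uniformly in $k$) and does not depend on the sequence. Define real constants $p_n,q_n$ by $p_0=-\frac1{2^{m-1}\pi^m}$, $q_0=0$ and, for $j=0,1,2,\dots$, $$p_{2j+1}=-\tfrac1{2\pi}p_{2j},\quad q_{2j+1}=-\tfrac1{2\pi}\Big(q_{2j}-\tfrac1{m+2j}p_{2j}\Big),\quad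 p_{2j+2}=\tfrac1{2j+2}p_{2j+1},\quad q_{2j+2}=\tfrac1{2j+2}\Big(q_{2j+1}-\tfrac1{2j+2}p_{2j+1}\Big).$$ Then, for $j=0,1,2,\dots$, $$F_{m+2j}=(p_{2j}\ln r+q_{2j})\,T^*_{2j},\qquad F_{m+2j+1}=(p_{2j+1}\ln r+q_{2j+1})\,U^*_{2j+1}$$ are tempered distributions and fundamental solutions of ${}^{m+2j}\mathcal H$ and ${}^{m+2j+1}\mathcal H$ respectively: the convolutions exist and $${}^{m+2j}\mathcal H[F_{m+2j}]=\delta,\qquad {}^{m+2j+1}\mathcal H[F_{m+2j+1}]=\delta .$$ -/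

import Mathlib

open scoped SchwartzMap ContDiff
open MeasureTheory Filter Topology

noncomputable section

namespace CliffordDist

/-- Euclidean space `ℝ^m`. -/
abbrev E (m : ℕ) : Type := EuclideanSpace ℝ (Fin m)

/-- The quadratic form `z ↦ -(z_1^2 + ... + z_m^2)` on `ℂ^m`. -/
abbrev negSq (m : ℕ) : QuadraticForm ℂ (Fin m → ℂ) :=
  QuadraticMap.weightedSumSquares ℂ (fun _ : Fin m => (-1 : ℂ))

/-- The complexification of the real Clifford algebra `ℝ_{0,m}`: it is generated by
`e_1, ..., e_m` with `e_i e_j + e_j e_i = -2 δ_{ij}`. Complex scalars are needed because the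
families below are indexed by a complex parameter. -/
abbrev Cl (m : ℕ) : Type := CliffordAlgebra (negSq m)

/-- The basis vector `e_i`. -/
def e (m : ℕ) (i : Fin m) : Cl m := CliffordAlgebra.ι (negSq m) (Pi.single i 1)

/-- The canonical vector space topology of the (finite-dimensional) complex algebra `Cl m`. -/
instance instTopologicalSpaceCl (m : ℕ) : TopologicalSpace (Cl m) := moduleTopology ℂ (Cl m)

instance instIsModuleTopologyCl (m : ℕ) : IsModuleTopology ℂ (Cl m) := ⟨rfl⟩

/-- A `Cl m`-valued functional. It is given by a formula that makes sense for every function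
`φ : ℝ^m → ℂ`; what matters are its values on Schwartz functions. -/
abbrev Functional (m : ℕ) : Type := (E m → ℂ) → Cl m

/-- The restriction of `S` to the Schwartz space is a (`Cl m`-valued) tempered distribution. -/
def IsTempered {m : ℕ} (S : Functional m) : Prop :=
  ∃ S' : 𝓢'(E m, Cl m), ∀ φ : 𝓢(E m, ℂ), S φ = S' φ

/-- The delta distribution. -/
def delta (m : ℕ) : Functional m := fun φ => algebraMap ℂ (Cl m) (φ 0)

/-- The Dirac operator `∑ e_i ∂_i` acting from the left on a distribution. -/
def dirac {m : ℕ} (S : Functional m) : Functional m := fun φ =>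
  - ∑ i : Fin m, e m i * S (fun x => fderiv ℝ φ x (EuclideanSpace.single i 1))

/-- The operator `-Δ_m` acting on a distribution. -/
def negLaplace {m : ℕ} (S : Functional m) : Functional m := fun φ =>
  - S (fun x => ∑ i : Fin m, fderiv ℝ
    (fun y => fderiv ℝ φ y (EuclideanSpace.single i 1)) x (EuclideanSpace.single i 1))

/-- The area `σ_m = 2 π^{m/2} / Γ(m/2)` of the unit sphere of `ℝ^m`. -/
def sphereArea (m : ℕ) : ℝ := 2 * Real.pi ^ ((m : ℝ) / 2) / Real.Gamma ((m : ℝ) / 2)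

/-- The surface measure on the unit sphere of `ℝ^m`. -/
def surf (m : ℕ) : Measure (Metric.sphere (0 : E m) 1) := (volume : Measure (E m)).toSphere

/-- The scalar spherical mean `Σ^{(0)}[φ]`, a function of `r ∈ ℝ`. -/
def mean0 {m : ℕ} (φ : E m → ℂ) (r : ℝ) : ℂ :=
  (1 / (sphereArea m : ℂ)) * ∫ w, φ (r • (w : E m)) ∂(surf m)

/-- The `e_i`-component of the vector valued spherical mean `Σ^{(1)}[φ]`. -/
def mean1 {m : ℕ} (i : Fin m) (φ : E m → ℂ) (r : ℝ) : ℂ :=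
  (1 / (sphereArea m : ℂ)) *
    ∫ w, (((w : E m) i : ℝ) : ℂ) * φ (r • (w : E m)) ∂(surf m)

/-- Hadamard's finite part distribution `Fp r_+^μ` applied to `g`, that is, the finite part as
`ε → 0+` of `∫_ε^∞ r^μ g(r) dr`, the powers `ε^{μ+k+1}` and `ln ε` being discarded. The number
`⌊-Re μ⌋₊` of Taylor terms which are subtracted on `(0,1)` is the least `N` with
`Re μ + N > -1`; it is zero if `Re μ > -1`, and then the value is `∫_0^∞ r^μ g(r) dr`. -/
def finitePart (μ : ℂ) (g : ℝ → ℂ) : ℂ :=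
  (∫ r in Set.Ioc (0 : ℝ) 1, (r : ℂ) ^ μ *
      (g r - ∑ k ∈ Finset.range ⌊-μ.re⌋₊,
        iteratedDeriv k g 0 / (k.factorial : ℂ) * (r : ℂ) ^ k))
  + (∫ r in Set.Ioi (1 : ℝ), (r : ℂ) ^ μ * g r)
  + ∑ k ∈ Finset.range ⌊-μ.re⌋₊,
      if μ + k + 1 = 0 then 0
      else iteratedDeriv k g 0 / (k.factorial : ℂ) / (μ + k + 1)

/-- `T_l = Fp r^l`. -/
def T (m : ℕ) (l : ℂ) : Functional m := fun φ =>
  algebraMap ℂ (Cl m) (sphereArea m * finitePart (l + m - 1) (mean0 φ))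

/-- `U_l = Fp r^l ω`. -/
def U (m : ℕ) (l : ℂ) : Functional m := fun φ =>
  ∑ i : Fin m, ((sphereArea m : ℂ) * finitePart (l + m - 1) (mean1 i φ)) • e m i

/-- The normalized distribution `T*_l`. -/
def TStar (m : ℕ) (l : ℂ) : Functional m :=
  open Classical in
  if h : ∃ k : ℕ, l = -m - 2 * k then
    ((Real.pi : ℂ) ^ ((m : ℂ) / 2 - h.choose) /
      (2 ^ (2 * h.choose) * Complex.Gamma ((m : ℂ) / 2 + h.choose))) •
        (negLaplace^[h.choose] (delta m))
  else ((Real.pi : ℂ) ^ ((l + m) / 2) / Complex.Gamma ((l + m) / 2)) • T m l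

/-- The normalized distribution `U*_l`. -/
def UStar (m : ℕ) (l : ℂ) : Functional m :=
  open Classical in
  if h : ∃ k : ℕ, l = -m - 2 * k - 1 then
    (-((Real.pi : ℂ) ^ ((m : ℂ) / 2 - h.choose) /
      (2 ^ (2 * h.choose + 1) * Complex.Gamma ((m : ℂ) / 2 + h.choose + 1)))) •
        (dirac^[2 * h.choose + 1] (delta m))
  else ((Real.pi : ℂ) ^ ((l + m + 1) / 2) / Complex.Gamma ((l + m + 1) / 2)) • U m l

/-- The convolution kernel `∂^μ H`. If `m` is odd, it is meaningful for
`μ ≠ -m, -m-1, -m-2, ...`, the poles of the Gamma factors. -/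
def kernelH (m : ℕ) (μ : ℂ) : Functional m :=
  ((1 - Complex.exp (Complex.I * Real.pi * μ)) / 2 *
      (2 ^ μ * Complex.Gamma ((m + μ) / 2) / (Real.pi : ℂ) ^ ((m - μ) / 2))) •
        TStar m (-m - μ)
  - ((1 + Complex.exp (Complex.I * Real.pi * μ)) / 2 *
      (2 ^ μ * Complex.Gamma ((m + μ + 1) / 2) / (Real.pi : ℂ) ^ ((m - μ + 1) / 2))) •
        UStar m (-m - μ)

/-- The tensor product `(x, y) ↦ f(x) g(y)` of two Schwartz functions. -/
def tensor {m : ℕ} (f g : 𝓢(E m, ℂ)) : 𝓢(E m × E m, ℂ) where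
  toFun z := f z.1 * g z.2
  smooth' := ((f.smooth ⊤).comp contDiff_fst).mul ((g.smooth ⊤).comp contDiff_snd)
  decay' := by
    intro k n
    have hf : ∀ (i : ℕ) (z : E m × E m),
        ‖iteratedFDeriv ℝ i (fun z : E m × E m => f z.1) z‖ ≤ ‖iteratedFDeriv ℝ i f z.1‖ := by
      intro i z
      have h := (ContinuousLinearMap.fst ℝ (E m) (E m)).iteratedFDeriv_comp_right
        (f.smooth ⊤) z (i := i) (by exact_mod_cast le_top)
      have h2 : (fun z : E m × E m => f z.1) = f ∘ (ContinuousLinearMap.fst ℝ (E m) (E m)) := rfl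
      rw [h2, h]
      refine (ContinuousMultilinearMap.norm_compContinuousLinearMap_le _ _).trans ?_
      refine mul_le_of_le_one_right (norm_nonneg _) ?_
      exact Finset.prod_le_one (fun _ _ => norm_nonneg _)
        (fun _ _ => ContinuousLinearMap.norm_fst_le ℝ (E m) (E m))
    have hg : ∀ (i : ℕ) (z : E m × E m),
        ‖iteratedFDeriv ℝ i (fun z : E m × E m => g z.2) z‖ ≤ ‖iteratedFDeriv ℝ i g z.2‖ := by
      intro i z
      have h := (ContinuousLinearMap.snd ℝ (E m) (E m)).iteratedFDeriv_comp_right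
        (g.smooth ⊤) z (i := i) (by exact_mod_cast le_top)
      have h2 : (fun z : E m × E m => g z.2) = g ∘ (ContinuousLinearMap.snd ℝ (E m) (E m)) := rfl
      rw [h2, h]
      refine (ContinuousMultilinearMap.norm_compContinuousLinearMap_le _ _).trans ?_
      refine mul_le_of_le_one_right (norm_nonneg _) ?_
      exact Finset.prod_le_one (fun _ _ => norm_nonneg _)
        (fun _ _ => ContinuousLinearMap.norm_snd_le ℝ (E m) (E m))
    choose A hA using f.decay'
    choose B hB using g.decay'
    refine ⟨∑ i ∈ Finset.range (n + 1), (n.choose i : ℝ) *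
      (A k i * B 0 (n - i) + A 0 i * B k (n - i)), fun z => ?_⟩
    have hle := norm_iteratedFDeriv_mul_le (𝕜 := ℝ) (N := ∞)
      (f := fun z : E m × E m => f z.1) (g := fun z : E m × E m => g z.2)
      ((f.smooth ⊤).comp contDiff_fst) ((g.smooth ⊤).comp contDiff_snd) z (n := n)
      (by exact_mod_cast le_top)
    refine (mul_le_mul_of_nonneg_left hle (by positivity)).trans ?_
    rw [Finset.mul_sum]
    refine Finset.sum_le_sum fun i _ => ?_
    have hz : ‖z‖ ^ k ≤ ‖z.1‖ ^ k + ‖z.2‖ ^ k := by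
      rcases le_total ‖z.1‖ ‖z.2‖ with h | h
      · rw [Prod.norm_def, max_eq_right h]; exact le_add_of_nonneg_left (by positivity)
      · rw [Prod.norm_def, max_eq_left h]; exact le_add_of_nonneg_right (by positivity)
    set a := ‖iteratedFDeriv ℝ i f z.1‖
    set b := ‖iteratedFDeriv ℝ (n - i) g z.2‖
    have ha : 0 ≤ a := norm_nonneg _
    have hb : 0 ≤ b := norm_nonneg _
    have h1 : ‖z.1‖ ^ k * a ≤ A k i := hA k i z.1
    have h2 : ‖z.2‖ ^ k * b ≤ B k (n - i) := hB k (n - i) z.2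
    have h3 : a ≤ A 0 i := by
      have := hA 0 i z.1
      rw [pow_zero, one_mul] at this
      exact this
    have h4 : b ≤ B 0 (n - i) := by
      have := hB 0 (n - i) z.2
      rw [pow_zero, one_mul] at this
      exact this
    have hA0 : 0 ≤ A 0 i := ha.trans h3
    have hAk : 0 ≤ A k i := (by positivity : 0 ≤ ‖z.1‖ ^ k * a).trans h1
    have hab := mul_le_mul (hf i z) (hg (n - i) z) (norm_nonneg _) ha
    calc _ = (n.choose i : ℝ) * (‖z‖ ^ k *
          (‖iteratedFDeriv ℝ i (fun z : E m × E m => f z.1) z‖ *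
            ‖iteratedFDeriv ℝ (n - i) (fun z : E m × E m => g z.2) z‖)) := by ring
      _ ≤ (n.choose i : ℝ) * ((‖z.1‖ ^ k + ‖z.2‖ ^ k) * (a * b)) := by gcongr
      _ = (n.choose i : ℝ) * ((‖z.1‖ ^ k * a) * b + a * (‖z.2‖ ^ k * b)) := by ring
      _ ≤ _ := by gcongr

/-- `W` is the tensor product `S ⊗ S'` of two `Cl m`-valued tempered distributions: it is the
`Cl m`-valued tempered distribution on `ℝ^m × ℝ^m` with
`⟨W, f ⊗ g⟩ = ⟨S, f⟩ ⟨S', g⟩` (product in the Clifford algebra). -/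
def IsTensor {m : ℕ} (S S' : Functional m) (W : 𝓢'(E m × E m, Cl m)) : Prop :=
  ∀ f g : 𝓢(E m, ℂ), W (tensor f g) = S f * S' g

/-- A sequence of test functions on `ℝ^m × ℝ^m` converging to `1`: on each compact set it is
eventually equal to `1`, and each derivative is bounded uniformly along the sequence. -/
structure IsUnitApprox {m : ℕ} (η : ℕ → E m × E m → ℂ) : Prop where
  smooth : ∀ k, ContDiff ℝ ∞ (η k)
  compact : ∀ k, HasCompactSupport (η k)
  eventually_one : ∀ C : Set (E m × E m), IsCompact C → ∀ᶠ k in atTop, ∀ z ∈ C, η k z = 1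
  bounded : ∀ i : ℕ, ∃ B : ℝ, ∀ k z, ‖iteratedFDeriv ℝ i (η k) z‖ ≤ B

/-- The test function `(x, y) ↦ η_k(x, y) φ(x + y)`. -/
def cutoff {m : ℕ} {η : ℕ → E m × E m → ℂ} (hη : IsUnitApprox η) (φ : 𝓢(E m, ℂ)) (k : ℕ) :
    𝓢(E m × E m, ℂ) :=
  HasCompactSupport.toSchwartzMap (f := fun z => η k z * φ (z.1 + z.2))
    ((hη.compact k).mul_right)
    ((hη.smooth k).mul ((φ.smooth ⊤).comp (contDiff_fst.add contDiff_snd)))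

/-- The convolution `S ∗ S'` of the tempered distributions `S` and `S'` exists and equals `R`:
`⟨R, φ⟩ = lim_k ⟨S ⊗ S', η_k(x, y) φ(x + y)⟩` for every sequence `η_k` of test functions
converging to `1`. -/
def IsConvolution {m : ℕ} (S S' R : Functional m) : Prop :=
  IsTempered S ∧ IsTempered S' ∧ IsTempered R ∧
    ∃ W : 𝓢'(E m × E m, Cl m), IsTensor S S' W ∧
      ∀ (η : ℕ → E m × E m → ℂ) (hη : IsUnitApprox η) (φ : 𝓢(E m, ℂ)),
        Tendsto (fun k => W (cutoff hη φ k)) atTop (𝓝 (R φ))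

/-- `^μH[F] = G`, where `^μH` is convolution with the kernel `∂^μ H`. -/
def OperatorH {m : ℕ} (μ : ℂ) (F G : Functional m) : Prop :=
  IsConvolution (kernelH m μ) F G

/-- `F` is a fundamental solution of the operator `^μH`. -/
def IsFundamentalSolution {m : ℕ} (μ : ℂ) (F : Functional m) : Prop :=
  OperatorH μ F (delta m)

/-- The constants `(p_n, q_n)`, given by `p_0 = -1 / (2^{m-1} π^m)`, `q_0 = 0` and a recursion
which depends on the parity of the index (here `m ≥ 1`). -/
def pq (m : ℕ) : ℕ → ℝ × ℝ
  | 0 => (-(1 / (2 ^ (m - 1) * Real.pi ^ m)), 0)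
  | n + 1 =>
    if Even n then
      (-(1 / (2 * Real.pi)) * (pq m n).1,
        -(1 / (2 * Real.pi)) * ((pq m n).2 - 1 / ((m : ℝ) + n) * (pq m n).1))
    else
      (1 / ((n : ℝ) + 1) * (pq m n).1,
        1 / ((n : ℝ) + 1) * ((pq m n).2 - 1 / ((n : ℝ) + 1) * (pq m n).1))

/-- The product `(p ln r + q) S`, for a distribution `S` which is given by integration against a
locally integrable function; `⟨a S, φ⟩ = ⟨S, a φ⟩`. -/
def logMul {m : ℕ} (p q : ℝ) (S : Functional m) : Functional m := fun φ =>
  S (fun x => ((p * Real.log ‖x‖ + q : ℝ) : ℂ) * φ x)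

end CliffordDist

end

noncomputable section

namespace CliffordDist

/-! ### Derivatives along lines -/

lemma iteratedDeriv_line {V : Type*} [NormedAddCommGroup V] [NormedSpace ℝ V] {f : V → ℂ}
    (hf : ContDiff ℝ ∞ f) (x v : V) (k : ℕ) (s : ℝ) :
    iteratedDeriv k (fun t : ℝ => f (x + t • v)) s
      = iteratedFDeriv ℝ k f (x + s • v) (fun _ => v) := by
  have h1 : (fun t : ℝ => f (x + t • v))
      = (fun z => f (x + z)) ∘ (ContinuousLinearMap.toSpanSingleton ℝ v) := by
    ext t; simp
  have h2 : ContDiff ℝ ∞ (fun z => f (x + z)) := hf.comp (contDiff_const.add contDiff_id)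
  rw [iteratedDeriv_eq_iteratedFDeriv, h1,
    ContinuousLinearMap.iteratedFDeriv_comp_right _ h2 s (i := k) (by exact_mod_cast le_top)]
  simp [iteratedFDeriv_comp_add_left]

lemma iteratedDeriv_line_zero {V : Type*} [NormedAddCommGroup V] [NormedSpace ℝ V] {f : V → ℂ}
    (hf : ContDiff ℝ ∞ f) (x v : V) (k : ℕ) :
    iteratedFDeriv ℝ k f x (fun _ => v) = iteratedDeriv k (fun t : ℝ => f (x + t • v)) 0 := by
  rw [iteratedDeriv_line hf]; simp

lemma iteratedFDeriv_diag_tensor {m : ℕ} (f g : 𝓢(E m, ℂ)) (x v y : E m) (k : ℕ) :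
    iteratedFDeriv ℝ k (tensor f g) (x, y) (fun _ => (v, 0))
      = iteratedFDeriv ℝ k f x (fun _ => v) * g y := by
  rw [iteratedDeriv_line_zero ((tensor f g).smooth ⊤), iteratedDeriv_line_zero (f.smooth ⊤)]
  have : (fun t : ℝ => tensor f g ((x, y) + t • (v, 0)))
      = fun t : ℝ => g y * f (x + t • v) := by
    ext t
    show f (x + t • v) * g (y + t • 0) = _
    rw [smul_zero, add_zero, mul_comm]
  rw [this, iteratedDeriv_const_mul_field, mul_comm]

lemma iteratedFDeriv_diag_comp_add {m : ℕ} {f : E m → ℂ} (hf : ContDiff ℝ ∞ f) (x v y : E m)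
    (k : ℕ) :
    iteratedFDeriv ℝ k (fun z : E m × E m => f (z.1 + z.2)) (x, y) (fun _ => (v, 0))
      = iteratedFDeriv ℝ k f (x + y) (fun _ => v) := by
  have hf2 : ContDiff ℝ ∞ (fun z : E m × E m => f (z.1 + z.2)) :=
    hf.comp (contDiff_fst.add contDiff_snd)
  rw [iteratedDeriv_line_zero hf2, iteratedDeriv_line_zero hf]
  congr 1
  ext t
  show f (x + t • v + (y + t • 0)) = f (x + y + t • v)
  congr 1
  rw [smul_zero]; abel

lemma norm_iteratedFDeriv_diag_le {V : Type*} [NormedAddCommGroup V] [NormedSpace ℝ V]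
    (f : V → ℂ) (x v : V) (hv : ‖v‖ ≤ 1) (k : ℕ) :
    ‖iteratedFDeriv ℝ k f x (fun _ => v)‖ ≤ ‖iteratedFDeriv ℝ k f x‖ := by
  refine (ContinuousMultilinearMap.le_opNorm _ _).trans ?_
  refine mul_le_of_le_one_right (norm_nonneg _) ?_
  exact Finset.prod_le_one (fun _ _ => norm_nonneg _) (fun _ _ => hv)

lemma norm_iteratedFDeriv_comp_add_le {m : ℕ} {f : E m → ℂ} (hf : ContDiff ℝ ∞ f)
    (z : E m × E m) (k : ℕ) :
    ‖iteratedFDeriv ℝ k (fun z : E m × E m => f (z.1 + z.2)) z‖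
      ≤ 2 ^ k * ‖iteratedFDeriv ℝ k f (z.1 + z.2)‖ := by
  set A : E m × E m →L[ℝ] E m :=
    ContinuousLinearMap.fst ℝ (E m) (E m) + ContinuousLinearMap.snd ℝ (E m) (E m)
  have hA : ‖A‖ ≤ 2 := (norm_add_le _ _).trans (by
    have h1 := ContinuousLinearMap.norm_fst_le ℝ (E m) (E m)
    have h2 := ContinuousLinearMap.norm_snd_le ℝ (E m) (E m)
    linarith)
  have h : (fun z : E m × E m => f (z.1 + z.2)) = f ∘ A := rfl
  rw [h, A.iteratedFDeriv_comp_right hf z (i := k) (by exact_mod_cast le_top)]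
  refine (ContinuousMultilinearMap.norm_compContinuousLinearMap_le _ _).trans ?_
  rw [Finset.prod_const, Finset.card_univ, Fintype.card_fin, mul_comm]
  have : A z = z.1 + z.2 := rfl
  rw [this]
  gcongr

lemma continuous_iteratedFDeriv_diag {V : Type*} [NormedAddCommGroup V] [NormedSpace ℝ V]
    {f : V → ℂ} (hf : ContDiff ℝ ∞ f) (k : ℕ) :
    Continuous fun p : V × V => iteratedFDeriv ℝ k f p.1 (fun _ => p.2) := by
  have h1 : Continuous fun p : V × V => iteratedFDeriv ℝ k f p.1 :=
    (hf.continuous_iteratedFDeriv (m := k) (by exact_mod_cast le_top)).comp continuous_fst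
  have h2 : Continuous fun p : V × V => (fun _ : Fin k => p.2) :=
    continuous_pi fun _ => continuous_snd
  exact h1.eval h2

/-! ### Decay of Schwartz functions -/

lemma schwartz_decay {V : Type*} [NormedAddCommGroup V] [NormedSpace ℝ V] (f : 𝓢(V, ℂ))
    (k n : ℕ) (z : V) :
    ‖iteratedFDeriv ℝ n f z‖ ≤ 2 ^ k *
      ((Finset.Iic (k, n)).sup (schwartzSeminormFamily ℂ V ℂ)) f * ((1 + ‖z‖) ^ k)⁻¹ := by
  have h := SchwartzMap.one_add_le_sup_seminorm_apply (𝕜 := ℂ) (m := (k, n)) le_rfl le_rfl f z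
  have hp : 0 < (1 + ‖z‖) ^ k := by positivity
  rw [← div_eq_mul_inv, le_div_iff₀ hp, mul_comm]
  exact h

lemma schwartz_decay' {V : Type*} [NormedAddCommGroup V] [NormedSpace ℝ V] (f : 𝓢(V, ℂ))
    (k n : ℕ) : ∃ C : ℝ, 0 ≤ C ∧
      ∀ z : V, ‖iteratedFDeriv ℝ n f z‖ ≤ C * ((1 + ‖z‖) ^ k)⁻¹ :=
  ⟨_, by positivity, schwartz_decay f k n⟩

/-! ### Functions of moderate growth with an integrable local singularity -/

/-- `F` is bounded by the sum of an integrable function and a multiple of `(1 + |y|)^a`. -/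
structure Moderate {m : ℕ} (a : ℝ) (F : E m → ℂ) : Prop where
  meas : AEStronglyMeasurable F volume
  bound : ∃ (s : E m → ℝ) (C : ℝ), Integrable s ∧ 0 ≤ C ∧
    ∀ y, ‖F y‖ ≤ s y + C * (1 + ‖y‖) ^ a

/-- The data of the functional `g ↦ ∫ c(o) (D^k g)(x(o))[v(o), ..., v(o)] dν(o)`. -/
structure PieceData {m : ℕ} (a : ℝ) {Ω : Type} [MeasurableSpace Ω] (ν : Measure Ω)
    (c : Ω → ℂ) (x v : Ω → E m) : Prop where
  measc : Measurable c
  measx : Measurable x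
  measv : Measurable v
  normv : ∀ o, ‖v o‖ ≤ 1
  integ : Integrable (fun o => ‖c o‖ * (1 + ‖x o‖) ^ a) ν

lemma integrable_moderate_mul {m : ℕ} {a : ℝ} {F : E m → ℂ} (hF : Moderate a F)
    {L : ℕ} (hL : a + m < L) : Integrable (fun y => ‖F y‖ * ((1 + ‖y‖) ^ L)⁻¹) := by
  obtain ⟨s, C, hs, hC, hb⟩ := hF.bound
  have h1 : Integrable (fun y : E m => C * (1 + ‖y‖) ^ (-((L : ℝ) - a))) :=
    (integrable_one_add_norm (by simp; linarith)).const_mul C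
  refine (hs.norm.add h1).mono' ?_ ?_
  · refine hF.meas.norm.mul (Continuous.aestronglyMeasurable ?_)
    exact Continuous.inv₀ (by fun_prop) (fun y => by positivity)
  · filter_upwards with y
    have hy : 1 ≤ (1 + ‖y‖) ^ L := one_le_pow₀ (by linarith [norm_nonneg y])
    have hinv : ((1 + ‖y‖) ^ L)⁻¹ ≤ 1 := inv_le_one_of_one_le₀ hy
    have hinv0 : 0 ≤ ((1 + ‖y‖) ^ L)⁻¹ := by positivity
    rw [norm_mul, norm_norm, Real.norm_of_nonneg hinv0]
    have e1 : (1 + ‖y‖) ^ (-((L : ℝ) - a)) = (1 + ‖y‖) ^ a * ((1 + ‖y‖) ^ L)⁻¹ := by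
      rw [neg_sub, Real.rpow_sub (by positivity), Real.rpow_natCast, div_eq_mul_inv]
    calc ‖F y‖ * ((1 + ‖y‖) ^ L)⁻¹ ≤ (s y + C * (1 + ‖y‖) ^ a) * ((1 + ‖y‖) ^ L)⁻¹ := by
          gcongr; exact hb y
      _ = s y * ((1 + ‖y‖) ^ L)⁻¹ + C * ((1 + ‖y‖) ^ a * ((1 + ‖y‖) ^ L)⁻¹) := by ring
      _ ≤ ‖s y‖ * 1 + C * ((1 + ‖y‖) ^ a * ((1 + ‖y‖) ^ L)⁻¹) := by
          gcongr; exact Real.le_norm_self _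
      _ = _ := by simp only [Pi.add_apply, e1, mul_one]

section Piece

variable {m : ℕ} {a : ℝ} {Ω : Type} [MeasurableSpace Ω] {ν : Measure Ω}
  {c : Ω → ℂ} {x v : Ω → E m} {F : E m → ℂ}

lemma PieceData.integrable_norm (h : PieceData a ν c x v) (ha : 0 ≤ a) :
    Integrable (fun o => ‖c o‖) ν := by
  refine h.integ.mono' h.measc.norm.aestronglyMeasurable ?_
  filter_upwards with o
  rw [norm_norm]
  exact le_mul_of_one_le_right (norm_nonneg _)
    (Real.one_le_rpow (by linarith [norm_nonneg (x o)]) ha)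

lemma aestronglyMeasurable_moderate_snd (hF : Moderate a F) :
    AEStronglyMeasurable (fun p : Ω × E m => F p.2) (ν.prod volume) :=
  hF.meas.comp_snd

lemma PieceData.integrable_shift (h : PieceData a ν c x v) (ha : 0 ≤ a) (hF : Moderate a F)
    {L : ℕ} (hL : a + m < L) :
    Integrable (fun p : Ω × E m => ‖F p.2‖ * ‖c p.1‖ * ((1 + ‖x p.1 + p.2‖) ^ L)⁻¹)
      (ν.prod volume) := by
  obtain ⟨s, C, hs, hC, hb⟩ := hF.bound
  have hx1 : Measurable fun p : Ω × E m => x p.1 := h.measx.comp measurable_fst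
  have hc1 : Measurable fun p : Ω × E m => c p.1 := h.measc.comp measurable_fst
  have h1 : Integrable (fun p : Ω × E m => ‖c p.1‖ * ‖s p.2‖) (ν.prod volume) :=
    (h.integrable_norm ha).mul_prod hs.norm
  have h2 : Integrable (fun p : Ω × E m => C * (‖c p.1‖ * (1 + ‖x p.1‖) ^ a *
      (1 + ‖x p.1 + p.2‖) ^ (-((L : ℝ) - a)))) (ν.prod volume) := by
    refine Integrable.const_mul ?_ C
    have hmeas : Measurable fun p : Ω × E m => ‖c p.1‖ * (1 + ‖x p.1‖) ^ a *
      (1 + ‖x p.1 + p.2‖) ^ (-((L : ℝ) - a)) := by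
      have hs2 : Measurable fun p : Ω × E m => p.2 := measurable_snd
      exact (hc1.norm.mul ((measurable_const.add hx1.norm).pow_const a)).mul
        ((measurable_const.add (hx1.add hs2).norm).pow_const _)
    have hint : Integrable (fun y : E m => (1 + ‖y‖) ^ (-((L : ℝ) - a))) :=
      integrable_one_add_norm (by simp; linarith)
    rw [integrable_prod_iff hmeas.aestronglyMeasurable]
    constructor
    · filter_upwards with o
      exact (hint.comp_add_left (x o)).const_mul _
    · have : (fun o => ∫ y : E m, ‖‖c o‖ * (1 + ‖x o‖) ^ a *
          (1 + ‖x o + y‖) ^ (-((L : ℝ) - a))‖) = fun o => ‖c o‖ * (1 + ‖x o‖) ^ a *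
            ∫ y : E m, (1 + ‖y‖) ^ (-((L : ℝ) - a)) := by
        ext o
        rw [← integral_add_left_eq_self (μ := volume)
          (fun y : E m => (1 + ‖y‖) ^ (-((L : ℝ) - a))) (x o), ← integral_const_mul]
        refine integral_congr_ae (Eventually.of_forall fun y => ?_)
        exact Real.norm_of_nonneg (by positivity)
      simp only [this]
      exact h.integ.mul_const _
  refine (h1.add h2).mono' ?_ ?_
  · refine ((aestronglyMeasurable_moderate_snd hF).norm.mul
      hc1.norm.aestronglyMeasurable).mul (Measurable.aestronglyMeasurable ?_)
    have hs2 : Measurable fun p : Ω × E m => p.2 := measurable_snd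
    exact ((measurable_const.add (hx1.add hs2).norm).pow_const L).inv
  · filter_upwards with p
    set X := x p.1
    set y := p.2
    have hy : 1 ≤ (1 + ‖X + y‖) ^ L := one_le_pow₀ (by linarith [norm_nonneg (X + y)])
    have hinv : ((1 + ‖X + y‖) ^ L)⁻¹ ≤ 1 := inv_le_one_of_one_le₀ hy
    have hinv0 : 0 ≤ ((1 + ‖X + y‖) ^ L)⁻¹ := by positivity
    have e1 : (1 + ‖X + y‖) ^ (-((L : ℝ) - a)) = (1 + ‖X + y‖) ^ a * ((1 + ‖X + y‖) ^ L)⁻¹ := by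
      rw [neg_sub, Real.rpow_sub (by positivity), Real.rpow_natCast, div_eq_mul_inv]
    have e2 : (1 + ‖y‖) ^ a ≤ (1 + ‖X‖) ^ a * (1 + ‖X + y‖) ^ a := by
      rw [← Real.mul_rpow (by positivity) (by positivity)]
      refine Real.rpow_le_rpow (by positivity) ?_ ha
      have : ‖y‖ ≤ ‖X + y‖ + ‖X‖ := by
        have := norm_sub_le (X + y) X
        simpa using this
      nlinarith [norm_nonneg X, norm_nonneg (X + y)]
    rw [Real.norm_of_nonneg (by positivity)]
    calc ‖F y‖ * ‖c p.1‖ * ((1 + ‖X + y‖) ^ L)⁻¹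
        ≤ (s y + C * (1 + ‖y‖) ^ a) * ‖c p.1‖ * ((1 + ‖X + y‖) ^ L)⁻¹ := by
          gcongr; exact hb y
      _ = s y * ‖c p.1‖ * ((1 + ‖X + y‖) ^ L)⁻¹
          + C * (1 + ‖y‖) ^ a * ‖c p.1‖ * ((1 + ‖X + y‖) ^ L)⁻¹ := by ring
      _ ≤ ‖s y‖ * ‖c p.1‖ * 1
          + C * ((1 + ‖X‖) ^ a * (1 + ‖X + y‖) ^ a) * ‖c p.1‖ * ((1 + ‖X + y‖) ^ L)⁻¹ := by
          gcongr; exact Real.le_norm_self _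
      _ = ‖c p.1‖ * ‖s y‖ + C * (‖c p.1‖ * (1 + ‖X‖) ^ a * (1 + ‖X + y‖) ^ (-((L : ℝ) - a))) := by
          rw [e1]; ring

end Piece

/-- The functional `g ↦ ∫ c(o) (D^k g)(x(o))[v(o), ..., v(o)] dν(o)`. -/
def piece {m : ℕ} {Ω : Type} [MeasurableSpace Ω] (ν : Measure Ω) (c : Ω → ℂ) (x v : Ω → E m)
    (k : ℕ) (g : E m → ℂ) : ℂ :=
  ∫ o, c o * iteratedFDeriv ℝ k g (x o) (fun _ => v o) ∂ν

/-- The functional `κ` on test functions is a tempered distribution which is convolvable with every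
function of moderate growth of order `a`. -/
structure Convolvable {m : ℕ} (a : ℝ) (κ : (E m → ℂ) → ℂ) : Prop where
  tempered : ∃ S : 𝓢(E m, ℂ) →L[ℂ] ℂ, ∀ φ : 𝓢(E m, ℂ), S φ = κ φ
  integrable : ∀ F : E m → ℂ, Moderate a F → ∀ φ : 𝓢(E m, ℂ),
    Integrable fun y => F y * κ (fun x => φ (x + y))
  conv : ∀ F : E m → ℂ, Moderate a F → ∃ W : 𝓢(E m × E m, ℂ) →L[ℂ] ℂ,
    (∀ f g : 𝓢(E m, ℂ), W (tensor f g) = κ f * ∫ y, F y * g y) ∧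
    ∀ (η : ℕ → E m × E m → ℂ) (hη : IsUnitApprox η) (φ : 𝓢(E m, ℂ)),
      Tendsto (fun k => W (cutoff hη φ k)) atTop (𝓝 (∫ y, F y * κ (fun x => φ (x + y))))

section Piece

variable {m : ℕ} {a : ℝ} {Ω : Type} [MeasurableSpace Ω] {ν : Measure Ω}
  {c : Ω → ℂ} {x v : Ω → E m} {F : E m → ℂ}

lemma PieceData.measurable_diag (h : PieceData a ν c x v) {f : E m → ℂ} (hf : ContDiff ℝ ∞ f)
    (k : ℕ) : Measurable fun o => iteratedFDeriv ℝ k f (x o) (fun _ => v o) :=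
  (continuous_iteratedFDeriv_diag hf k).measurable.comp (h.measx.prodMk h.measv)

lemma PieceData.integrable_diag (h : PieceData a ν c x v) (ha : 0 ≤ a) (f : 𝓢(E m, ℂ)) (k : ℕ) :
    Integrable (fun o => c o * iteratedFDeriv ℝ k f (x o) (fun _ => v o)) ν := by
  obtain ⟨C, hC, hb⟩ := schwartz_decay' f 0 k
  refine ((h.integrable_norm ha).mul_const C).mono'
    (h.measc.mul (h.measurable_diag (f.smooth ⊤) k)).aestronglyMeasurable ?_
  filter_upwards with o
  rw [norm_mul]
  gcongr
  refine (norm_iteratedFDeriv_diag_le _ _ _ (h.normv o) k).trans ?_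
  simpa using hb (x o)

lemma PieceData.exists_clm (h : PieceData a ν c x v) (ha : 0 ≤ a) (k : ℕ) :
    ∃ S : 𝓢(E m, ℂ) →L[ℂ] ℂ, ∀ φ : 𝓢(E m, ℂ), S φ = piece ν c x v k φ := by
  refine ⟨SchwartzMap.mkCLMtoNormedSpace (σ := RingHom.id ℂ) (fun φ => piece ν c x v k φ)
    ?_ ?_ ?_, fun φ => rfl⟩
  · intro f g
    simp only [piece]
    rw [← integral_add (h.integrable_diag ha f k) (h.integrable_diag ha g k)]
    congr 1
    ext o
    have : (⇑(f + g) : E m → ℂ) = ⇑f + ⇑g := rfl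
    rw [this, iteratedFDeriv_add_apply ((f.smooth k).contDiffAt) ((g.smooth k).contDiffAt)]
    simp [mul_add]
  · intro z f
    simp only [piece]
    rw [RingHom.id_apply, smul_eq_mul, ← integral_const_mul]
    congr 1
    ext o
    have : (⇑(z • f) : E m → ℂ) = z • ⇑f := rfl
    rw [this, iteratedFDeriv_const_smul_apply ((f.smooth k).contDiffAt)]
    simp [mul_left_comm]
  · refine ⟨Finset.Iic (0, k), ∫ o, ‖c o‖ ∂ν, integral_nonneg fun _ => norm_nonneg _, fun f => ?_⟩
    rw [← integral_mul_const]
    refine norm_integral_le_of_norm_le ((h.integrable_norm ha).mul_const _) ?_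
    filter_upwards with o
    rw [norm_mul]
    gcongr
    refine (norm_iteratedFDeriv_diag_le _ _ _ (h.normv o) k).trans ?_
    simpa using schwartz_decay f 0 k (x o)

/-- The integrand of the tensor product of a piece with a function. -/
def tensorIntegrand (c : Ω → ℂ) (x v : Ω → E m) (F : E m → ℂ) (k : ℕ) (Φ : E m × E m → ℂ)
    (p : Ω × E m) : ℂ :=
  F p.2 * (c p.1 * iteratedFDeriv ℝ k Φ (x p.1, p.2) (fun _ => (v p.1, 0)))

lemma PieceData.aestronglyMeasurable_tensorIntegrand (h : PieceData a ν c x v)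
    (hF : Moderate a F) {Φ : E m × E m → ℂ} (hΦ : ContDiff ℝ ∞ Φ) (k : ℕ) :
    AEStronglyMeasurable (tensorIntegrand c x v F k Φ) (ν.prod volume) := by
  refine (aestronglyMeasurable_moderate_snd hF).mul (Measurable.aestronglyMeasurable ?_)
  refine (h.measc.comp measurable_fst).mul ?_
  exact (continuous_iteratedFDeriv_diag hΦ k).measurable.comp
    (((h.measx.comp measurable_fst).prodMk measurable_snd).prodMk
      ((h.measv.comp measurable_fst).prodMk measurable_const))

lemma PieceData.norm_tensorIntegrand_le (h : PieceData a ν c x v) (k : ℕ) (Φ : E m × E m → ℂ)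
    (p : Ω × E m) : ‖tensorIntegrand c x v F k Φ p‖
      ≤ ‖F p.2‖ * ‖c p.1‖ * ‖iteratedFDeriv ℝ k Φ (x p.1, p.2)‖ := by
  rw [tensorIntegrand, norm_mul, norm_mul, mul_assoc]
  gcongr
  refine norm_iteratedFDeriv_diag_le _ _ _ ?_ k
  rw [Prod.norm_def]
  simpa using h.normv p.1

lemma PieceData.norm_tensorIntegrand_le_schwartz (h : PieceData a ν c x v) (k L : ℕ)
    (Φ : 𝓢(E m × E m, ℂ)) (p : Ω × E m) : ‖tensorIntegrand c x v F k Φ p‖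
      ≤ (‖c p.1‖ * (‖F p.2‖ * ((1 + ‖p.2‖) ^ L)⁻¹)) *
        (2 ^ L * ((Finset.Iic (L, k)).sup (schwartzSeminormFamily ℂ (E m × E m) ℂ)) Φ) := by
  refine (h.norm_tensorIntegrand_le k Φ p).trans ?_
  have h1 := schwartz_decay Φ L k (x p.1, p.2)
  have h2 : ((1 + ‖(x p.1, p.2)‖) ^ L)⁻¹ ≤ ((1 + ‖p.2‖) ^ L)⁻¹ := by
    gcongr
    rw [Prod.norm_def]
    exact le_max_right _ _
  calc ‖F p.2‖ * ‖c p.1‖ * ‖iteratedFDeriv ℝ k Φ (x p.1, p.2)‖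
      ≤ ‖F p.2‖ * ‖c p.1‖ * (2 ^ L *
        ((Finset.Iic (L, k)).sup (schwartzSeminormFamily ℂ (E m × E m) ℂ)) Φ *
          ((1 + ‖p.2‖) ^ L)⁻¹) := by
        gcongr
        refine h1.trans ?_
        gcongr
    _ = _ := by ring

variable [SFinite ν]

lemma exists_nat_gt_growth (a : ℝ) (m : ℕ) : ∃ L : ℕ, a + m < L := exists_nat_gt _

lemma PieceData.integrable_tensorIntegrand (h : PieceData a ν c x v) (ha : 0 ≤ a)
    (hF : Moderate a F) (k : ℕ) (Φ : 𝓢(E m × E m, ℂ)) :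
    Integrable (tensorIntegrand c x v F k Φ) (ν.prod volume) := by
  obtain ⟨L, hL⟩ := exists_nat_gt_growth a m
  refine (((h.integrable_norm ha).mul_prod (integrable_moderate_mul hF hL)).mul_const
    (2 ^ L * ((Finset.Iic (L, k)).sup (schwartzSeminormFamily ℂ (E m × E m) ℂ)) Φ)).mono'
    (h.aestronglyMeasurable_tensorIntegrand hF (Φ.smooth ⊤) k) ?_
  filter_upwards with p
  exact h.norm_tensorIntegrand_le_schwartz k L Φ p

lemma PieceData.exists_tensor_clm (h : PieceData a ν c x v) (ha : 0 ≤ a)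
    (hF : Moderate a F) (k : ℕ) : ∃ W : 𝓢(E m × E m, ℂ) →L[ℂ] ℂ, ∀ Φ : 𝓢(E m × E m, ℂ),
      W Φ = ∫ p, tensorIntegrand c x v F k Φ p ∂(ν.prod volume) := by
  refine ⟨SchwartzMap.mkCLMtoNormedSpace (σ := RingHom.id ℂ)
    (fun Φ => ∫ p, tensorIntegrand c x v F k Φ p ∂(ν.prod volume)) ?_ ?_ ?_, fun φ => rfl⟩
  · intro f g
    rw [← integral_add (h.integrable_tensorIntegrand ha hF k f)
      (h.integrable_tensorIntegrand ha hF k g)]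
    congr 1
    ext o
    have : (⇑(f + g) : E m × E m → ℂ) = ⇑f + ⇑g := rfl
    rw [tensorIntegrand, this,
      iteratedFDeriv_add_apply ((f.smooth k).contDiffAt) ((g.smooth k).contDiffAt)]
    simp [mul_add, tensorIntegrand]
  · intro z f
    rw [RingHom.id_apply, smul_eq_mul, ← integral_const_mul]
    congr 1
    ext o
    have : (⇑(z • f) : E m × E m → ℂ) = z • ⇑f := rfl
    rw [tensorIntegrand, this, iteratedFDeriv_const_smul_apply ((f.smooth k).contDiffAt)]
    simp [tensorIntegrand]
    ring
  · obtain ⟨L, hL⟩ := exists_nat_gt_growth a m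
    have hint := (h.integrable_norm ha).mul_prod (integrable_moderate_mul hF hL)
    refine ⟨Finset.Iic (L, k), (∫ p : Ω × E m, (‖c p.1‖ * (‖F p.2‖ * ((1 + ‖p.2‖) ^ L)⁻¹))
      ∂(ν.prod volume)) * 2 ^ L, ?_, fun Φ => ?_⟩
    · refine mul_nonneg (integral_nonneg fun p => ?_) (by positivity)
      exact mul_nonneg (norm_nonneg _) (by positivity)
    · rw [mul_assoc, ← integral_mul_const]
      refine norm_integral_le_of_norm_le (hint.mul_const _) ?_
      filter_upwards with p
      exact h.norm_tensorIntegrand_le_schwartz k L Φ p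

lemma PieceData.tensorIntegrand_tensor (k : ℕ) (f g : 𝓢(E m, ℂ)) :
    ∫ p, tensorIntegrand c x v F k (tensor f g) p ∂(ν.prod volume)
      = piece ν c x v k f * ∫ y, F y * g y := by
  rw [piece, ← integral_prod_mul]
  congr 1
  ext p
  rw [tensorIntegrand, iteratedFDeriv_diag_tensor]
  ring

lemma PieceData.integrable_conv (h : PieceData a ν c x v) (ha : 0 ≤ a)
    (hF : Moderate a F) (k : ℕ) (φ : 𝓢(E m, ℂ)) :
    Integrable (tensorIntegrand c x v F k (fun z => φ (z.1 + z.2))) (ν.prod volume) := by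
  obtain ⟨L, hL⟩ := exists_nat_gt_growth a m
  obtain ⟨C, hC, hb⟩ := schwartz_decay' φ L k
  refine ((h.integrable_shift ha hF hL).mul_const (2 ^ k * C)).mono'
    (h.aestronglyMeasurable_tensorIntegrand hF
      ((φ.smooth ⊤).comp (contDiff_fst.add contDiff_snd)) k) ?_
  filter_upwards with p
  refine (h.norm_tensorIntegrand_le k _ p).trans ?_
  have h1 := norm_iteratedFDeriv_comp_add_le (φ.smooth ⊤) (x p.1, p.2) k
  have h2 := hb (x p.1 + p.2)
  calc _ ≤ ‖F p.2‖ * ‖c p.1‖ * (2 ^ k * (C * ((1 + ‖x p.1 + p.2‖) ^ L)⁻¹)) := by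
        gcongr
        refine h1.trans ?_
        gcongr
    _ = _ := by ring

lemma tensorIntegrand_comp_add (k : ℕ) (φ : 𝓢(E m, ℂ)) (p : Ω × E m) :
    tensorIntegrand c x v F k (fun z => φ (z.1 + z.2)) p
      = F p.2 * (c p.1 * iteratedFDeriv ℝ k (fun z => φ (z + p.2)) (x p.1) (fun _ => v p.1)) := by
  rw [tensorIntegrand, iteratedFDeriv_diag_comp_add (φ.smooth ⊤), iteratedFDeriv_comp_add_right]

lemma PieceData.integrable_mul_piece (h : PieceData a ν c x v) (ha : 0 ≤ a)
    (hF : Moderate a F) (k : ℕ) (φ : 𝓢(E m, ℂ)) :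
    Integrable fun y => F y * piece ν c x v k (fun z => φ (z + y)) := by
  have := (h.integrable_conv ha hF k φ).integral_prod_right
  refine this.congr (Eventually.of_forall fun y => ?_)
  simp only [tensorIntegrand_comp_add, piece]
  rw [integral_const_mul]

lemma PieceData.integral_conv (h : PieceData a ν c x v) (ha : 0 ≤ a)
    (hF : Moderate a F) (k : ℕ) (φ : 𝓢(E m, ℂ)) :
    ∫ p, tensorIntegrand c x v F k (fun z => φ (z.1 + z.2)) p ∂(ν.prod volume)
      = ∫ y, F y * piece ν c x v k (fun z => φ (z + y)) := by
  rw [integral_prod_symm _ (h.integrable_conv ha hF k φ)]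
  congr 1
  ext y
  simp only [tensorIntegrand_comp_add, piece]
  rw [integral_const_mul]

lemma PieceData.tendsto_cutoff (h : PieceData a ν c x v) (ha : 0 ≤ a)
    (hF : Moderate a F) (k : ℕ) {η : ℕ → E m × E m → ℂ} (hη : IsUnitApprox η) (φ : 𝓢(E m, ℂ)) :
    Tendsto (fun n => ∫ p, tensorIntegrand c x v F k (cutoff hη φ n) p ∂(ν.prod volume)) atTop
      (𝓝 (∫ y, F y * piece ν c x v k (fun z => φ (z + y)))) := by
  rw [← h.integral_conv ha hF k φ]
  obtain ⟨L, hL⟩ := exists_nat_gt_growth a m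
  choose C hC hb using schwartz_decay' φ L
  choose B hB using hη.bounded
  have hφ2 : ContDiff ℝ ∞ (fun z : E m × E m => φ (z.1 + z.2)) :=
    (φ.smooth ⊤).comp (contDiff_fst.add contDiff_snd)
  set M := ∑ i ∈ Finset.range (k + 1), (k.choose i : ℝ) * B i * (2 ^ (k - i) * C (k - i))
  refine tendsto_integral_of_dominated_convergence
    (fun p => (‖F p.2‖ * ‖c p.1‖ * ((1 + ‖x p.1 + p.2‖) ^ L)⁻¹) * M) (fun n => ?_)
    ((h.integrable_shift ha hF hL).mul_const M) (fun n => ?_) ?_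
  · exact h.aestronglyMeasurable_tensorIntegrand hF ((cutoff hη φ n).smooth ⊤) k
  · filter_upwards with p
    refine (h.norm_tensorIntegrand_le k _ p).trans ?_
    rw [mul_assoc (‖F p.2‖ * ‖c p.1‖)]
    refine mul_le_mul_of_nonneg_left ?_ (by positivity)
    have h1 := norm_iteratedFDeriv_mul_le (hη.smooth n) hφ2 (x p.1, p.2) (n := k)
      (by exact_mod_cast le_top)
    refine h1.trans ?_
    rw [Finset.mul_sum]
    refine Finset.sum_le_sum fun i _ => ?_
    have hBi : 0 ≤ B i := (norm_nonneg _).trans (hB i n (x p.1, p.2))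
    have h2 := norm_iteratedFDeriv_comp_add_le (φ.smooth ⊤) (x p.1, p.2) (k - i)
    have h3 := hb (k - i) (x p.1 + p.2)
    calc _ ≤ (k.choose i : ℝ) * B i * (2 ^ (k - i) * (C (k - i) *
            ((1 + ‖x p.1 + p.2‖) ^ L)⁻¹)) := by
          gcongr
          · exact hB i n _
          · refine h2.trans ?_
            gcongr
      _ = _ := by ring
  · filter_upwards with p
    refine tendsto_const_nhds.congr' ?_
    set z : E m × E m := (x p.1, p.2)
    filter_upwards [hη.eventually_one _ (isCompact_closedBall z 1)] with n hn
    have hev : (cutoff hη φ n : E m × E m → ℂ) =ᶠ[𝓝 z] (fun z => φ (z.1 + z.2)) := by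
      filter_upwards [Metric.closedBall_mem_nhds z one_pos] with w hw
      show η n w * φ (w.1 + w.2) = _
      rw [hn w hw, one_mul]
    have := (hev.iteratedFDeriv ℝ k).self_of_nhds
    simp only [tensorIntegrand]
    rw [this]

theorem PieceData.convolvable (h : PieceData a ν c x v) (ha : 0 ≤ a) (k : ℕ) :
    Convolvable a (piece ν c x v k) where
  tempered := h.exists_clm ha k
  integrable F hF φ := h.integrable_mul_piece ha hF k φ
  conv F hF := by
    obtain ⟨W, hW⟩ := h.exists_tensor_clm ha hF k
    refine ⟨W, fun f g => ?_, fun η hη φ => ?_⟩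
    · rw [hW, PieceData.tensorIntegrand_tensor]
    · simp only [hW]
      exact h.tendsto_cutoff ha hF k hη φ

end Piece

lemma Convolvable.add {m : ℕ} {a : ℝ} {κ κ' : (E m → ℂ) → ℂ} (h : Convolvable a κ)
    (h' : Convolvable a κ') : Convolvable a (fun g => κ g + κ' g) where
  tempered := by
    obtain ⟨S, hS⟩ := h.tempered
    obtain ⟨S', hS'⟩ := h'.tempered
    exact ⟨S + S', fun φ => by simp [hS, hS']⟩
  integrable F hF φ := by
    simp only [mul_add]
    exact (h.integrable F hF φ).add (h'.integrable F hF φ)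
  conv F hF := by
    obtain ⟨W, hW1, hW2⟩ := h.conv F hF
    obtain ⟨W', hW1', hW2'⟩ := h'.conv F hF
    refine ⟨W + W', fun f g => ?_, fun η hη φ => ?_⟩
    · simp [hW1, hW1', add_mul]
    · simp only [mul_add]
      rw [integral_add (h.integrable F hF φ) (h'.integrable F hF φ)]
      exact (hW2 η hη φ).add (hW2' η hη φ)

lemma Convolvable.const_mul {m : ℕ} {a : ℝ} {κ : (E m → ℂ) → ℂ} (h : Convolvable a κ)
    (z : ℂ) : Convolvable a (fun g => z * κ g) where
  tempered := by
    obtain ⟨S, hS⟩ := h.tempered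
    exact ⟨z • S, fun φ => by simp [hS]⟩
  integrable F hF φ := by
    simpa only [mul_left_comm] using (h.integrable F hF φ).const_mul z
  conv F hF := by
    obtain ⟨W, hW1, hW2⟩ := h.conv F hF
    refine ⟨z • W, fun f g => ?_, fun η hη φ => ?_⟩
    · simp [hW1, mul_assoc]
    · simp only [mul_left_comm _ z]
      rw [integral_const_mul]
      exact (hW2 η hη φ).const_mul z

lemma Convolvable.zero {m : ℕ} {a : ℝ} : Convolvable a (fun _ : E m → ℂ => (0 : ℂ)) where
  tempered := ⟨0, fun φ => rfl⟩
  integrable F hF φ := by simp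
  conv F hF := ⟨0, fun f g => by simp, fun η hη φ => by simp⟩

lemma Convolvable.sum {m : ℕ} {a : ℝ} {ι : Type*} (s : Finset ι) {κ : ι → (E m → ℂ) → ℂ}
    (h : ∀ i ∈ s, Convolvable a (κ i)) : Convolvable a (fun g => ∑ i ∈ s, κ i g) := by
  classical
  induction s using Finset.induction_on with
  | empty => simpa using Convolvable.zero
  | insert i s hi ih =>
    simp only [Finset.sum_insert hi]
    exact (h i (by simp)).add (ih fun k hk => h k (by simp [hk]))

/-- Only the values on the translates of Schwartz functions matter. -/
lemma Convolvable.congr {m : ℕ} {a : ℝ} {κ κ' : (E m → ℂ) → ℂ} (h : Convolvable a κ)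
    (hκ : ∀ (φ : 𝓢(E m, ℂ)) (y : E m), κ' (fun x => φ (x + y)) = κ (fun x => φ (x + y))) :
    Convolvable a κ' := by
  have h0 : ∀ φ : 𝓢(E m, ℂ), κ' φ = κ φ := fun φ => by simpa using hκ φ 0
  refine ⟨?_, fun F hF φ => ?_, fun F hF => ?_⟩
  · obtain ⟨S, hS⟩ := h.tempered
    exact ⟨S, fun φ => by rw [hS, h0]⟩
  · simpa only [hκ] using h.integrable F hF φ
  · obtain ⟨W, hW1, hW2⟩ := h.conv F hF
    refine ⟨W, fun f g => by rw [hW1, h0], fun η hη φ => ?_⟩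
    simp only [hκ]
    exact hW2 η hη φ

/-! ### Smooth functions with bounded derivatives -/

/-- `g` is smooth and all its derivatives are bounded. -/
structure BddSmooth {V : Type*} [NormedAddCommGroup V] [NormedSpace ℝ V] (g : V → ℂ) : Prop where
  smooth : ContDiff ℝ ∞ g
  bdd : ∀ k : ℕ, ∃ C : ℝ, ∀ x, ‖iteratedFDeriv ℝ k g x‖ ≤ C

lemma bddSmooth_translate {m : ℕ} (φ : 𝓢(E m, ℂ)) (y : E m) :
    BddSmooth (fun x => φ (x + y)) where
  smooth := (φ.smooth ⊤).comp (contDiff_id.add contDiff_const)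
  bdd k := by
    obtain ⟨C, -, hC⟩ := schwartz_decay' φ 0 k
    refine ⟨C, fun x => ?_⟩
    rw [iteratedFDeriv_comp_add_right]
    simpa using hC (x + y)

/-- Taylor's formula with the remainder in the scaled integral form. -/
lemma taylor_remainder_scaled {h : ℝ → ℂ} (hh : ContDiff ℝ ∞ h) (n : ℕ) {r : ℝ} (hr : 0 < r) :
    h r - ∑ k ∈ Finset.range (n + 1), iteratedDeriv k h 0 / (k.factorial : ℂ) * (r : ℂ) ^ k
      = (r : ℂ) ^ (n + 1) * ∫ t in Set.Ioc (0 : ℝ) 1,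
          (((1 - t) ^ n / n.factorial : ℝ) : ℂ) * iteratedDeriv (n + 1) h (r * t) := by
  have hu : UniqueDiffOn ℝ (Set.uIcc 0 r) := uniqueDiffOn_uIcc hr.ne
  have heq : ∀ k : ℕ, ∀ t ∈ Set.uIcc 0 r,
      iteratedDerivWithin k h (Set.uIcc 0 r) t = iteratedDeriv k h t := fun k t ht =>
    iteratedDerivWithin_eq_iteratedDeriv hu
      ((hh.of_le (by exact_mod_cast le_top)).contDiffAt) ht
  have h1 := taylor_integral_remainder (f := h) (x₀ := 0) (x := r) (n := n)
    ((hh.of_le (by exact_mod_cast le_top)).contDiffOn)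
  have h2 : taylorWithinEval h n (Set.uIcc 0 r) 0 r
      = ∑ k ∈ Finset.range (n + 1), iteratedDeriv k h 0 / (k.factorial : ℂ) * (r : ℂ) ^ k := by
    rw [taylor_within_apply]
    refine Finset.sum_congr rfl fun k _ => ?_
    rw [heq k 0 Set.left_mem_uIcc, Complex.real_smul]
    push_cast
    rw [sub_zero]
    ring
  rw [← h2, h1]
  have h3 : ∫ t in (0 : ℝ)..r, ((r - t) ^ n / n.factorial) •
      iteratedDerivWithin (n + 1) h (Set.uIcc 0 r) t
      = ∫ t in (0 : ℝ)..r, ((r - t) ^ n / n.factorial) • iteratedDeriv (n + 1) h t :=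
    intervalIntegral.integral_congr fun t ht => by simp only [heq (n + 1) t ht]
  rw [h3, ← intervalIntegral.integral_of_le zero_le_one]
  have h4 := intervalIntegral.smul_integral_comp_mul_left (E := ℂ) (a := 0) (b := 1)
    (fun t : ℝ => ((r - t) ^ n / n.factorial) • iteratedDeriv (n + 1) h t) r
  rw [mul_zero, mul_one] at h4
  rw [← h4, Complex.real_smul, pow_succ', mul_assoc]
  congr 1
  rw [← intervalIntegral.integral_const_mul]
  refine intervalIntegral.integral_congr (E := ℂ) fun t _ => ?_
  simp only [Complex.real_smul]
  push_cast
  have : (r : ℂ) - r * t = r * (1 - t) := by ring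
  rw [this, mul_pow]
  ring

/-! ### Weighted spherical means -/

section Sphere

variable {m : ℕ}

/-- The integral over the unit sphere of `u(w) g(r w)`. -/
def sphInt (u : Metric.sphere (0 : E m) 1 → ℂ) (g : E m → ℂ) (r : ℝ) : ℂ :=
  ∫ w, u w * g (r • (w : E m)) ∂(surf m)

/-- The spherical integral of the `k`-th radial derivative. -/
def sphDeriv (u : Metric.sphere (0 : E m) 1 → ℂ) (g : E m → ℂ) (k : ℕ) (r : ℝ) : ℂ :=
  ∫ w, u w * iteratedFDeriv ℝ k g (r • (w : E m)) (fun _ => (w : E m)) ∂(surf m)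

instance : IsFiniteMeasure (surf m) := inferInstanceAs (IsFiniteMeasure (Measure.toSphere _))

lemma norm_sphere (w : Metric.sphere (0 : E m) 1) : ‖(w : E m)‖ = 1 := by
  simp

/-- A measurable weight on the sphere which is bounded by `1`. -/
structure Weight (u : Metric.sphere (0 : E m) 1 → ℂ) : Prop where
  meas : Measurable u
  norm_le : ∀ w, ‖u w‖ ≤ 1

variable {u : Metric.sphere (0 : E m) 1 → ℂ} {g : E m → ℂ}

lemma hasDerivAt_radial (hg : ContDiff ℝ ∞ g) (w : E m) (k : ℕ) (r : ℝ) :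
    HasDerivAt (fun r : ℝ => iteratedFDeriv ℝ k g (r • w) (fun _ => w))
      (iteratedFDeriv ℝ (k + 1) g (r • w) (fun _ => w)) r := by
  have h1 : ∀ k : ℕ, ∀ r : ℝ, iteratedFDeriv ℝ k g (r • w) (fun _ => w)
      = iteratedDeriv k (fun t : ℝ => g (0 + t • w)) r := fun k r => by
    rw [iteratedDeriv_line hg, zero_add]
  have h2 : ContDiff ℝ ∞ (fun t : ℝ => g (0 + t • w)) :=
    hg.comp (contDiff_const.add (contDiff_id.smul contDiff_const))
  simp only [h1]
  rw [iteratedDeriv_succ]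
  exact ((h2.differentiable_iteratedDeriv k (by exact_mod_cast WithTop.coe_lt_top _)) r).hasDerivAt

lemma measurable_sphDeriv_integrand (hu : Weight u) (hg : ContDiff ℝ ∞ g) (k : ℕ) :
    Measurable fun p : ℝ × Metric.sphere (0 : E m) 1 =>
      u p.2 * iteratedFDeriv ℝ k g (p.1 • (p.2 : E m)) (fun _ => (p.2 : E m)) := by
  refine (hu.meas.comp measurable_snd).mul ?_
  have hc : Continuous fun p : ℝ × Metric.sphere (0 : E m) 1 =>
      (p.1 • (p.2 : E m), (p.2 : E m)) := by fun_prop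
  exact ((continuous_iteratedFDeriv_diag hg k).comp hc).measurable

lemma norm_sphDeriv_integrand_le (hu : Weight u) {k : ℕ} {C : ℝ}
    (hC : ∀ x, ‖iteratedFDeriv ℝ k g x‖ ≤ C) (r : ℝ) (w : Metric.sphere (0 : E m) 1) :
    ‖u w * iteratedFDeriv ℝ k g (r • (w : E m)) (fun _ => (w : E m))‖ ≤ C := by
  rw [norm_mul]
  refine (mul_le_of_le_one_left (norm_nonneg _) (hu.norm_le w)).trans ?_
  exact (norm_iteratedFDeriv_diag_le _ _ _ (norm_sphere w).le k).trans (hC _)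

lemma hasDerivAt_sphDeriv (hu : Weight u) (hg : BddSmooth g) (k : ℕ) (r : ℝ) :
    HasDerivAt (sphDeriv u g k) (sphDeriv u g (k + 1) r) r := by
  obtain ⟨C, hC⟩ := hg.bdd k
  obtain ⟨C', hC'⟩ := hg.bdd (k + 1)
  have hm : ∀ k : ℕ, ∀ r : ℝ, AEStronglyMeasurable (fun w : Metric.sphere (0 : E m) 1 =>
      u w * iteratedFDeriv ℝ k g (r • (w : E m)) (fun _ => (w : E m))) (surf m) := fun k r =>
    ((measurable_sphDeriv_integrand hu hg.smooth k).comp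
      (measurable_const.prodMk measurable_id)).aestronglyMeasurable
  refine (hasDerivAt_integral_of_dominated_loc_of_deriv_le (s := Set.univ) (bound := fun _ => C')
    (F := fun r w => u w * iteratedFDeriv ℝ k g (r • (w : E m)) (fun _ => (w : E m)))
    (F' := fun r w => u w * iteratedFDeriv ℝ (k + 1) g (r • (w : E m)) (fun _ => (w : E m)))
    univ_mem (Eventually.of_forall fun r => hm k r) ?_ (hm (k + 1) r) ?_
    (integrable_const _) ?_).2
  · exact (integrable_const C).mono' (hm k r)
      (Eventually.of_forall fun w => norm_sphDeriv_integrand_le hu hC r w)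
  · exact Eventually.of_forall fun w r _ => norm_sphDeriv_integrand_le hu hC' r w
  · exact Eventually.of_forall fun w r _ => (hasDerivAt_radial hg.smooth w k r).const_mul _

lemma iteratedDeriv_sphInt (hu : Weight u) (hg : BddSmooth g) (k : ℕ) :
    iteratedDeriv k (sphInt u g) = sphDeriv u g k := by
  induction k with
  | zero =>
    ext r
    simp [sphInt, sphDeriv]
  | succ k ih =>
    ext r
    rw [iteratedDeriv_succ, ih]
    exact (hasDerivAt_sphDeriv hu hg k r).deriv

lemma bddSmooth_sphInt (hu : Weight u) (hg : BddSmooth g) : BddSmooth (sphInt u g) where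
  smooth := by
    refine contDiff_of_differentiable_iteratedDeriv fun k _ => ?_
    rw [iteratedDeriv_sphInt hu hg]
    exact fun r => (hasDerivAt_sphDeriv hu hg k r).differentiableAt
  bdd k := by
    obtain ⟨C, hC⟩ := hg.bdd k
    refine ⟨C * (surf m).real Set.univ, fun r => ?_⟩
    rw [norm_iteratedFDeriv_eq_norm_iteratedDeriv, iteratedDeriv_sphInt hu hg]
    exact norm_integral_le_of_norm_le_const
      (Eventually.of_forall fun w => norm_sphDeriv_integrand_le hu hC r w)

/-! ### The finite part functional -/

/-- The finite part of `r^{-N}` applied to the weighted spherical integrals. -/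
def fpKer (N : ℕ) (u : Metric.sphere (0 : E m) 1 → ℂ) (g : E m → ℂ) : ℂ :=
  finitePart (-(N : ℂ)) (sphInt u g)

lemma finitePart_neg_nat (N : ℕ) (h : ℝ → ℂ) :
    finitePart (-(N : ℂ)) h =
      (∫ r in Set.Ioc (0 : ℝ) 1, ((r : ℂ) ^ N)⁻¹ * (h r - ∑ k ∈ Finset.range N,
        iteratedDeriv k h 0 / (k.factorial : ℂ) * (r : ℂ) ^ k))
      + (∫ r in Set.Ioi (1 : ℝ), ((r : ℂ) ^ N)⁻¹ * h r)
      + ∑ k ∈ Finset.range N, (if (-(N : ℂ)) + k + 1 = 0 then 0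
          else iteratedDeriv k h 0 / (k.factorial : ℂ) / (-(N : ℂ) + k + 1)) := by
  have hf : ⌊-(-(N : ℂ)).re⌋₊ = N := by simp
  simp only [finitePart, hf, Complex.cpow_neg, Complex.cpow_natCast]

abbrev Sph (m : ℕ) : Type := Metric.sphere (0 : E m) 1

lemma pieceData_inner {a : ℝ} (hu : Weight u) (n : ℕ) :
    PieceData a (((volume.restrict (Set.Ioc (0 : ℝ) 1)).prod
        (volume.restrict (Set.Ioc (0 : ℝ) 1))).prod (surf m))
      (fun p : (ℝ × ℝ) × Sph m => (((1 - p.1.2) ^ n / n.factorial : ℝ) : ℂ) * u p.2)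
      (fun p => (p.1.1 * p.1.2) • (p.2 : E m)) (fun p => (p.2 : E m)) where
  measc := by
    refine Measurable.mul (Continuous.measurable (by fun_prop)) (hu.meas.comp measurable_snd)
  measx := Continuous.measurable (by fun_prop)
  measv := Continuous.measurable (by fun_prop)
  normv p := (norm_sphere p.2).le
  integ := by
    have hbox : ∀ᵐ p ∂(((volume.restrict (Set.Ioc (0 : ℝ) 1)).prod
        (volume.restrict (Set.Ioc (0 : ℝ) 1))).prod (surf m)),
        p.1 ∈ Set.Ioc (0 : ℝ) 1 ×ˢ Set.Ioc (0 : ℝ) 1 := by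
      refine Measure.quasiMeasurePreserving_fst.ae (p := fun q => q ∈ _) ?_
      rw [Measure.prod_restrict]
      exact ae_restrict_mem (measurableSet_Ioc.prod measurableSet_Ioc)
    refine (integrable_const ((2 : ℝ) ^ |a|)).mono' (Measurable.aestronglyMeasurable ?_) ?_
    · refine Measurable.mul ?_ ?_
      · exact (Measurable.mul (Continuous.measurable (by fun_prop))
          (hu.meas.comp measurable_snd)).norm
      · refine Measurable.pow_const (Continuous.measurable (by fun_prop)) a
    · filter_upwards [hbox] with p hp
      obtain ⟨⟨h1, h2⟩, h3, h4⟩ := hp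
      rw [Real.norm_of_nonneg (by positivity), norm_mul, norm_smul, norm_sphere, mul_one]
      have hc : ‖(((1 - p.1.2) ^ n / n.factorial : ℝ) : ℂ)‖ ≤ 1 := by
        rw [Complex.norm_real, Real.norm_of_nonneg (by
          have : 0 ≤ 1 - p.1.2 := by linarith
          positivity)]
        rw [div_le_one (by positivity)]
        refine (pow_le_one₀ (by linarith) (by linarith)).trans ?_
        exact_mod_cast Nat.succ_le_of_lt n.factorial_pos
      have hx : ‖p.1.1 * p.1.2‖ ≤ 1 := by
        rw [Real.norm_of_nonneg (by positivity)]
        nlinarith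
      have hpw : (1 + ‖p.1.1 * p.1.2‖) ^ a ≤ (2 : ℝ) ^ |a| := by
        calc (1 + ‖p.1.1 * p.1.2‖) ^ a ≤ (1 + ‖p.1.1 * p.1.2‖) ^ |a| :=
              Real.rpow_le_rpow_of_exponent_le (by linarith [norm_nonneg (p.1.1 * p.1.2)])
                (le_abs_self a)
          _ ≤ _ := Real.rpow_le_rpow (by positivity) (by linarith) (abs_nonneg a)
      calc _ ≤ (1 * 1) * (2 : ℝ) ^ |a| := by
            gcongr
            exact hu.norm_le _
        _ = _ := by ring

lemma pieceData_outer {a : ℝ} {N : ℕ} (hu : Weight u) (ha : 0 ≤ a) (hN : a + 1 < N) :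
    PieceData a ((volume.restrict (Set.Ioi (1 : ℝ))).prod (surf m))
      (fun p : ℝ × Sph m => ((p.1 : ℂ) ^ N)⁻¹ * u p.2)
      (fun p => p.1 • (p.2 : E m)) (fun p => (p.2 : E m)) where
  measc := Measurable.mul (Measurable.inv (Continuous.measurable (by fun_prop)))
    (hu.meas.comp measurable_snd)
  measx := Continuous.measurable (by fun_prop)
  measv := Continuous.measurable (by fun_prop)
  normv p := (norm_sphere p.2).le
  integ := by
    have hbox : ∀ᵐ p ∂((volume.restrict (Set.Ioi (1 : ℝ))).prod (surf m)),
        p.1 ∈ Set.Ioi (1 : ℝ) :=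
      Measure.quasiMeasurePreserving_fst.ae (p := fun q => q ∈ _) (ae_restrict_mem measurableSet_Ioi)
    have hint : Integrable (fun r : ℝ => r ^ (a - N)) (volume.restrict (Set.Ioi (1 : ℝ))) :=
      integrableOn_Ioi_rpow_of_lt (by linarith) one_pos
    refine ((hint.mul_prod (integrable_const (1 : ℝ))).const_mul ((2 : ℝ) ^ a)).mono'
      (Measurable.aestronglyMeasurable ?_) ?_
    · refine Measurable.mul ?_ ?_
      · exact (Measurable.mul (Measurable.inv (Continuous.measurable (by fun_prop)))
          (hu.meas.comp measurable_snd)).norm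
      · refine Measurable.pow_const (Continuous.measurable (by fun_prop)) a
    · filter_upwards [hbox] with p hp
      have hp0 : (0 : ℝ) < p.1 := lt_trans one_pos hp
      have hp1 : (1 : ℝ) < p.1 := hp
      rw [Real.norm_of_nonneg (by positivity), norm_mul, norm_smul, norm_sphere, mul_one,
        norm_inv, norm_pow, Complex.norm_real, Real.norm_of_nonneg hp0.le]
      calc (p.1 ^ N)⁻¹ * ‖u p.2‖ * (1 + p.1) ^ a ≤ (p.1 ^ N)⁻¹ * 1 * (2 * p.1) ^ a := by
            gcongr
            · exact hu.norm_le _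
            · linarith
        _ = _ := by
            rw [Real.mul_rpow (by norm_num) hp0.le, Real.rpow_sub hp0, Real.rpow_natCast]
            ring

lemma pieceData_origin {a : ℝ} (hu : Weight u) :
    PieceData a (surf m) u (fun _ : Sph m => (0 : E m)) (fun w => (w : E m)) where
  measc := hu.meas
  measx := measurable_const
  measv := Continuous.measurable (by fun_prop)
  normv p := (norm_sphere p).le
  integ := by
    simp only [norm_zero, add_zero, Real.one_rpow, mul_one]
    exact (integrable_const (1 : ℝ)).mono' hu.meas.norm.aestronglyMeasurable
      (Eventually.of_forall fun w => by simpa using hu.norm_le w)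

/-- Integrability of the integrand of a piece against a function with bounded derivatives. -/
lemma PieceData.integrable_of_bddSmooth {a : ℝ} {Ω : Type} [MeasurableSpace Ω] {ν : Measure Ω}
    {c : Ω → ℂ} {x v : Ω → E m} (h : PieceData a ν c x v) (ha : 0 ≤ a) (hg : BddSmooth g)
    (k : ℕ) : Integrable (fun o => c o * iteratedFDeriv ℝ k g (x o) (fun _ => v o)) ν := by
  obtain ⟨C, hb⟩ := hg.bdd k
  refine ((h.integrable_norm ha).mul_const C).mono'
    (h.measc.mul (h.measurable_diag hg.smooth k)).aestronglyMeasurable ?_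
  filter_upwards with o
  rw [norm_mul]
  gcongr
  exact (norm_iteratedFDeriv_diag_le _ _ _ (h.normv o) k).trans (hb (x o))

lemma fpKer_eq_pieces {n : ℕ} (hn : 0 < n) (hu : Weight u) (hg : BddSmooth g) :
    fpKer (n + 1) u g =
      piece (((volume.restrict (Set.Ioc (0 : ℝ) 1)).prod
        (volume.restrict (Set.Ioc (0 : ℝ) 1))).prod (surf m))
        (fun p : (ℝ × ℝ) × Sph m => (((1 - p.1.2) ^ n / n.factorial : ℝ) : ℂ) * u p.2)
        (fun p => (p.1.1 * p.1.2) • (p.2 : E m)) (fun p => (p.2 : E m)) (n + 1) g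
      + piece ((volume.restrict (Set.Ioi (1 : ℝ))).prod (surf m))
        (fun p : ℝ × Sph m => ((p.1 : ℂ) ^ (n + 1))⁻¹ * u p.2)
        (fun p => p.1 • (p.2 : E m)) (fun p => (p.2 : E m)) 0 g
      + ∑ k ∈ Finset.range (n + 1),
        (if (-((n + 1 : ℕ) : ℂ)) + k + 1 = 0 then 0
          else ((k.factorial : ℂ))⁻¹ / (-((n + 1 : ℕ) : ℂ) + k + 1)) *
        piece (surf m) u (fun _ : Sph m => (0 : E m)) (fun w => (w : E m)) k g := by
  rw [fpKer, finitePart_neg_nat]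
  have hs := (bddSmooth_sphInt hu hg).smooth
  congr 1
  · congr 1
    · have hi := (pieceData_inner (a := 0) hu n).integrable_of_bddSmooth le_rfl hg (n + 1)
      rw [piece, integral_prod _ hi, integral_prod _ hi.integral_prod_left]
      refine setIntegral_congr_fun measurableSet_Ioc fun r hr => ?_
      rw [taylor_remainder_scaled hs n hr.1, inv_mul_cancel_left₀]
      · refine setIntegral_congr_fun measurableSet_Ioc fun t ht => ?_
        rw [iteratedDeriv_sphInt hu hg, sphDeriv, ← integral_const_mul]
        simp only [mul_assoc]
      · exact pow_ne_zero _ (Complex.ofReal_ne_zero.mpr hr.1.ne')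
    · have hi := (pieceData_outer (a := 0) (N := n + 1) hu le_rfl
        (by push_cast; have : (0 : ℝ) < n := by exact_mod_cast hn
            linarith)).integrable_of_bddSmooth le_rfl hg 0
      rw [piece, integral_prod _ hi]
      refine setIntegral_congr_fun measurableSet_Ioi fun r hr => ?_
      simp only [sphInt]
      rw [← integral_const_mul]
      simp only [mul_assoc, iteratedFDeriv_zero_apply]
  · refine Finset.sum_congr rfl fun k _ => ?_
    rw [iteratedDeriv_sphInt hu hg]
    split_ifs with hk
    · simp
    · simp only [sphDeriv, piece, zero_smul]
      ring

theorem fpKer_convolvable {a : ℝ} {N : ℕ} (ha : 0 ≤ a) (hN : a + 1 < N) (hu : Weight u) :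
    Convolvable a (fpKer N u) := by
  obtain ⟨n, rfl⟩ : ∃ n, N = n + 1 := by
    refine ⟨N - 1, (Nat.succ_pred_eq_of_pos ?_).symm⟩
    rcases Nat.eq_zero_or_pos N with h | h
    · subst h; norm_num at hN; linarith
    · exact h
  have hn : 0 < n := by
    have : (0 : ℝ) < n := by push_cast at hN; linarith
    exact_mod_cast this
  have h := (((pieceData_inner (a := a) hu n).convolvable ha (n + 1)).add
    ((pieceData_outer hu ha hN).convolvable ha 0)).add
    (Convolvable.sum (Finset.range (n + 1)) fun k _ =>
      ((pieceData_origin (a := a) hu).convolvable ha k).const_mul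
        (if (-((n + 1 : ℕ) : ℂ)) + k + 1 = 0 then 0
          else ((k.factorial : ℂ))⁻¹ / (-((n + 1 : ℕ) : ℂ) + k + 1)))
  exact h.congr fun φ y => fpKer_eq_pieces hn hu (bddSmooth_translate φ y)

end Sphere

/-! ### Taylor remainders of the exponential function -/

/-- `exp(-x)` minus its Taylor polynomial of degree `n - 1`. -/
def expRem (n : ℕ) (x : ℝ) : ℝ :=
  Real.exp (-x) - ∑ l ∈ Finset.range n, (-x) ^ l / l.factorial

lemma expRem_zero (x : ℝ) : expRem 0 x = Real.exp (-x) := by simp [expRem]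

lemma expRem_succ (n : ℕ) (x : ℝ) : expRem (n + 1) x = expRem n x - (-x) ^ n / n.factorial := by
  simp only [expRem, Finset.sum_range_succ]; ring

lemma expRem_succ_at_zero (n : ℕ) : expRem (n + 1) 0 = 0 := by
  induction n with
  | zero => simp [expRem]
  | succ n ih => rw [expRem_succ, ih]; simp

lemma continuous_expRem (n : ℕ) : Continuous (expRem n) := by
  unfold expRem; fun_prop

lemma hasDerivAt_expRem (n : ℕ) (x : ℝ) : HasDerivAt (expRem (n + 1)) (-expRem n x) x := by
  induction n with
  | zero =>
    have : expRem (0 + 1) = fun x => Real.exp (-x) - 1 := by ext x; simp [expRem]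
    rw [this, expRem_zero]
    simpa using ((hasDerivAt_neg x).exp).sub_const 1
  | succ n ih =>
    have : expRem (n + 1 + 1) = fun x => expRem (n + 1) x - (-x) ^ (n + 1) / (n + 1).factorial := by
      ext x; exact expRem_succ _ _
    rw [this]
    have h2 : HasDerivAt (fun x : ℝ => (-x) ^ (n + 1) / ((n + 1).factorial : ℝ))
        (((n + 1 : ℕ) * (-x) ^ n * (-1)) / ((n + 1).factorial : ℝ)) x := by
      simpa using (((hasDerivAt_neg x).pow (n + 1)).div_const ((n + 1).factorial : ℝ))
    refine (ih.sub h2).congr_deriv ?_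
    rw [expRem_succ, Nat.factorial_succ]
    have h3 : (n.factorial : ℝ) ≠ 0 := by positivity
    push_cast
    field_simp
    ring

lemma expRem_alternating (n : ℕ) : ∀ x : ℝ, 0 ≤ x → 0 ≤ (-1) ^ n * expRem n x := by
  induction n with
  | zero => intro x _; simp only [pow_zero, one_mul, expRem_zero]; positivity
  | succ n ih =>
    intro x hx
    have hd : ∀ y, HasDerivAt (fun y => (-1) ^ (n + 1) * expRem (n + 1) y)
        ((-1) ^ (n + 1) * (-expRem n y)) y := fun y => (hasDerivAt_expRem n y).const_mul _
    have hmono : MonotoneOn (fun y => (-1) ^ (n + 1) * expRem (n + 1) y) (Set.Ici 0) := by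
      refine monotoneOn_of_deriv_nonneg (convex_Ici 0)
        (fun y _ => (hd y).continuousAt.continuousWithinAt)
        (fun y _ => (hd y).differentiableAt.differentiableWithinAt) fun y hy => ?_
      rw [(hd y).deriv, pow_succ]
      rw [interior_Ici] at hy
      have := ih y (le_of_lt hy)
      linarith
    have := hmono Set.self_mem_Ici hx hx
    simpa [expRem_succ_at_zero] using this

lemma abs_expRem_le (n : ℕ) {x : ℝ} (hx : 0 ≤ x) : |expRem n x| ≤ x ^ n / n.factorial := by
  have h1 := expRem_alternating n x hx
  have h2 := expRem_alternating (n + 1) x hx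
  have h3 : |expRem n x| = (-1) ^ n * expRem n x := by
    rw [← abs_of_nonneg h1, abs_mul, abs_pow, abs_neg, abs_one, one_pow, one_mul]
  rw [expRem_succ, neg_pow x, pow_succ] at h2
  have h4 : ((-1 : ℝ) ^ n) * ((-1) ^ n * x ^ n / n.factorial) = x ^ n / n.factorial := by
    have : ((-1 : ℝ) ^ n) * (-1) ^ n = 1 := by rw [← mul_pow]; simp
    rw [mul_div_assoc, ← mul_assoc, this, one_mul]
  rw [h3]
  nlinarith

lemma abs_expRem_succ_le (n : ℕ) {x : ℝ} (hx : 0 ≤ x) : |expRem (n + 1) x| ≤ 2 * x ^ n := by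
  have h1 := abs_expRem_le n hx
  have h2 : x ^ n / n.factorial ≤ x ^ n :=
    div_le_self (by positivity) (by exact_mod_cast Nat.succ_le_of_lt n.factorial_pos)
  rw [expRem_succ]
  refine (abs_sub _ _).trans ?_
  rw [abs_div, abs_pow, abs_neg, abs_of_nonneg hx, Nat.abs_cast]
  linarith

lemma abs_expRem_le' (n : ℕ) {x : ℝ} (hx : 0 ≤ x) : |expRem n x| ≤ x ^ n :=
  (abs_expRem_le n hx).trans
    (div_le_self (by positivity) (by exact_mod_cast Nat.succ_le_of_lt n.factorial_pos))

/-- The range of exponents `β` with `∫_0^∞ v^{β-1} expRem n v dv` convergent. -/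
def GammaStrip (n : ℕ) (β : ℝ) : Prop := -(n : ℝ) < β ∧ (n = 0 ∨ β < 1 - n)

lemma integrableOn_Ioc_rpow {p : ℝ} (hp : -1 < p) :
    IntegrableOn (fun v : ℝ => v ^ p) (Set.Ioc 0 1) :=
  (intervalIntegrable_iff_integrableOn_Ioc_of_le zero_le_one).1
    (intervalIntegral.intervalIntegrable_rpow' hp)

lemma measurable_rpow_mul_expRem (n : ℕ) (p : ℝ) : Measurable fun v : ℝ => v ^ p * expRem n v :=
  (measurable_id.pow_const p).mul (continuous_expRem n).measurable

lemma integrableOn_expRem {n : ℕ} {β : ℝ} (h : GammaStrip n β) :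
    IntegrableOn (fun v => v ^ (β - 1) * expRem n v) (Set.Ioi 0) := by
  obtain ⟨h1, h2⟩ := h
  cases n with
  | zero =>
    simp only [expRem_zero]
    simpa only [mul_comm] using Real.GammaIntegral_convergent (s := β) (by simpa using h1)
  | succ n =>
    have h2 : β < 1 - ((n + 1 : ℕ) : ℝ) := by simpa using h2
    push_cast at h1 h2
    rw [← Set.Ioc_union_Ioi_eq_Ioi zero_le_one]
    refine IntegrableOn.union ?_ ?_
    · refine Integrable.mono' (integrableOn_Ioc_rpow (p := β - 1 + (n + 1)) (by linarith))
        (measurable_rpow_mul_expRem _ _).aestronglyMeasurable ?_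
      filter_upwards [ae_restrict_mem measurableSet_Ioc] with v hv
      rw [norm_mul, Real.norm_of_nonneg (Real.rpow_nonneg hv.1.le _),
        Real.rpow_add hv.1 (β - 1)]
      refine mul_le_mul_of_nonneg_left ?_ (Real.rpow_nonneg hv.1.le _)
      refine (abs_expRem_le' (n + 1) hv.1.le).trans (le_of_eq ?_)
      rw [← Real.rpow_natCast]; push_cast; rfl
    · refine Integrable.mono' ((integrableOn_Ioi_rpow_of_lt (a := β - 1 + n) (by linarith)
        one_pos).const_mul 2) (measurable_rpow_mul_expRem _ _).aestronglyMeasurable ?_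
      filter_upwards [ae_restrict_mem measurableSet_Ioi] with v hv
      have hv0 : (0 : ℝ) < v := lt_trans one_pos hv
      rw [norm_mul, Real.norm_of_nonneg (Real.rpow_nonneg hv0.le _), Real.rpow_add hv0,
        mul_left_comm, Real.rpow_natCast]
      gcongr
      exact abs_expRem_succ_le n hv0.le

lemma integral_expRem : ∀ (n : ℕ) {β : ℝ} (_ : GammaStrip n β),
    ∫ v in Set.Ioi (0 : ℝ), v ^ (β - 1) * expRem n v = Real.Gamma β := by
  intro n
  induction n with
  | zero =>
    intro β h
    have hβ : 0 < β := by simpa using h.1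
    rw [Real.Gamma_eq_integral hβ]
    simp only [expRem_zero, mul_comm]
  | succ n ih =>
    intro β h
    have hint := integrableOn_expRem h
    obtain ⟨h1, h2⟩ := h
    have h2 : β < 1 - ((n + 1 : ℕ) : ℝ) := by simpa using h2
    push_cast at h1 h2
    have hβ : β < 0 := by have : (0 : ℝ) ≤ n := n.cast_nonneg; linarith
    have hstrip : GammaStrip n (β + 1) := by
      refine ⟨by linarith, ?_⟩
      right; linarith
    have hint' := integrableOn_expRem hstrip
    rw [add_sub_cancel_right] at hint'
    have hparts := integral_Ioi_mul_deriv_eq_deriv_mul (a := (0 : ℝ)) (a' := (0 : ℝ))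
      (b' := (0 : ℝ)) (u := expRem (n + 1)) (u' := fun x => -expRem n x)
      (v := fun x : ℝ => x ^ β / β) (v' := fun x : ℝ => x ^ (β - 1))
      (fun x _ => hasDerivAt_expRem n x) (fun x hx => ?_) ?_ ?_ ?_ ?_
    · have e1 : ∫ v in Set.Ioi (0 : ℝ), v ^ (β - 1) * expRem (n + 1) v
          = ∫ v in Set.Ioi (0 : ℝ), expRem (n + 1) v * v ^ (β - 1) := by simp only [mul_comm]
      have e2 : ∫ x in Set.Ioi (0 : ℝ), -expRem n x * (x ^ β / β)
          = -(1 / β) * ∫ v in Set.Ioi (0 : ℝ), v ^ (β + 1 - 1) * expRem n v := by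
        rw [← integral_const_mul, add_sub_cancel_right]
        congr 1
        ext v
        ring
      rw [e1, hparts, e2, ih hstrip, Real.Gamma_add_one hβ.ne]
      have hβ0 := hβ.ne
      field_simp
      ring
    · have := (Real.hasDerivAt_rpow_const (p := β) (Or.inl (ne_of_gt hx))).div_const β
      convert this using 1
      rw [mul_div_assoc, mul_div_cancel₀ _ hβ.ne]
    · refine hint.congr_fun (fun x _ => ?_) measurableSet_Ioi
      simp [mul_comm]
    · refine (hint'.const_mul (-(1 / β))).congr (Eventually.of_forall fun x => ?_)
      simp only [Pi.mul_apply]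
      ring
    · have ht : Tendsto (fun x : ℝ => x ^ (β + (n + 1)) * (1 / |β|)) (𝓝[>] 0) (𝓝 0) := by
        have : Tendsto (fun x : ℝ => x ^ (β + (n + 1))) (𝓝[>] 0) (𝓝 (0 ^ (β + (n + 1)))) :=
          ((Real.continuousAt_rpow_const 0 _ (Or.inr (by linarith))).tendsto).mono_left
            nhdsWithin_le_nhds
        rw [Real.zero_rpow (by linarith)] at this
        simpa using this.mul_const (1 / |β|)
      refine squeeze_zero_norm' ?_ ht
      filter_upwards [self_mem_nhdsWithin] with x hx
      have hx : (0 : ℝ) < x := hx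
      rw [Pi.mul_apply, norm_mul, norm_div, Real.norm_of_nonneg (Real.rpow_nonneg hx.le _),
        Real.rpow_add hx]
      have := abs_expRem_le' (n + 1) hx.le
      have e : x ^ ((n : ℝ) + 1) = x ^ (n + 1) := by rw [← Real.rpow_natCast]; push_cast; rfl
      rw [e]
      calc ‖expRem (n + 1) x‖ * (x ^ β / ‖β‖) ≤ x ^ (n + 1) * (x ^ β / ‖β‖) := by
            gcongr; exact this
        _ = _ := by rw [Real.norm_eq_abs]; ring
    · have ht : Tendsto (fun x : ℝ => x ^ (-(-(β + n))) * (2 * (1 / |β|))) atTop (𝓝 0) := by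
        simpa using (tendsto_rpow_neg_atTop (y := -(β + n)) (by linarith)).mul_const (2 * (1 / |β|))
      refine squeeze_zero_norm' ?_ ht
      filter_upwards [eventually_gt_atTop 0] with x hx
      rw [Pi.mul_apply, norm_mul, norm_div, Real.norm_of_nonneg (Real.rpow_nonneg hx.le _),
        neg_neg, Real.rpow_add hx, Real.rpow_natCast]
      have := abs_expRem_succ_le n hx.le
      calc ‖expRem (n + 1) x‖ * (x ^ β / ‖β‖) ≤ (2 * x ^ n) * (x ^ β / ‖β‖) := by
            gcongr; exact this
        _ = _ := by rw [Real.norm_eq_abs]; ring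

/-- Substitution `t = x / v`. -/
lemma comp_div_integrableOn_iff {f : ℝ → ℝ} {β x : ℝ} (hx : 0 < x) :
    (IntegrableOn (fun t => t ^ (-β - 1) * f (x / t)) (Set.Ioi 0) ↔
      IntegrableOn (fun v => v ^ (β - 1) * f v) (Set.Ioi 0)) ∧
    ∫ t in Set.Ioi (0 : ℝ), t ^ (-β - 1) * f (x / t)
      = x ^ (-β) * ∫ v in Set.Ioi (0 : ℝ), v ^ (β - 1) * f v := by
  have hpt : Set.EqOn (fun t : ℝ => t ^ (-β - 1) * f (x / t))
      (fun t : ℝ => (|(-1 : ℝ)| * t ^ ((-1 : ℝ) - 1)) •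
        ((fun s : ℝ => s ^ (β - 1) * f (x * s)) (t ^ (-1 : ℝ)))) (Set.Ioi 0) := by
    intro t ht
    have ht : (0 : ℝ) < t := ht
    simp only [abs_neg, abs_one, one_mul, smul_eq_mul]
    rw [← Real.rpow_mul ht.le, ← mul_assoc, ← Real.rpow_add ht, Real.rpow_neg_one, div_eq_mul_inv]
    congr 2
    ring
  have hpt2 : Set.EqOn (fun s : ℝ => s ^ (β - 1) * f (x * s))
      (fun s : ℝ => x ^ (-(β - 1)) * ((fun v : ℝ => v ^ (β - 1) * f v) (x * s))) (Set.Ioi 0) := by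
    intro s hs
    have hs : (0 : ℝ) < s := hs
    simp only
    rw [Real.mul_rpow hx.le hs.le, ← mul_assoc, ← mul_assoc, ← Real.rpow_add hx]
    simp
  constructor
  · rw [integrableOn_congr_fun hpt measurableSet_Ioi, integrableOn_Ioi_comp_rpow_iff (fun s : ℝ => s ^ (β - 1) * f (x * s)) (p := -1) (by norm_num),
      integrableOn_congr_fun hpt2 measurableSet_Ioi]
    rw [show IntegrableOn (fun s : ℝ => x ^ (-(β - 1)) * ((fun v : ℝ => v ^ (β - 1) * f v) (x * s)))
      (Set.Ioi 0) volume ↔ IntegrableOn (fun s : ℝ => (fun v : ℝ => v ^ (β - 1) * f v) (x * s))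
        (Set.Ioi 0) volume from
      integrable_const_mul_iff (μ := volume.restrict (Set.Ioi 0))
        (Real.rpow_pos_of_pos hx (-(β - 1))).ne'.isUnit
        (fun s : ℝ => (fun v : ℝ => v ^ (β - 1) * f v) (x * s))]
    rw [integrableOn_Ioi_comp_mul_left_iff (fun v : ℝ => v ^ (β - 1) * f v) _ hx, mul_zero]
  · rw [setIntegral_congr_fun measurableSet_Ioi hpt, integral_comp_rpow_Ioi (fun s : ℝ => s ^ (β - 1) * f (x * s)) (p := -1) (by norm_num),
      setIntegral_congr_fun measurableSet_Ioi hpt2, integral_const_mul,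
      integral_comp_mul_left_Ioi (fun v : ℝ => v ^ (β - 1) * f v) 0 hx, mul_zero, smul_eq_mul, ← mul_assoc]
    congr 1
    rw [← Real.rpow_neg_one, ← Real.rpow_add hx]
    congr 1
    ring

lemma integrableOn_expRem_div {n : ℕ} {β x : ℝ} (h : GammaStrip n β) (hx : 0 < x) :
    IntegrableOn (fun t => t ^ (-β - 1) * expRem n (x / t)) (Set.Ioi 0) :=
  (comp_div_integrableOn_iff hx).1.2 (integrableOn_expRem h)

lemma integral_expRem_div {n : ℕ} {β x : ℝ} (h : GammaStrip n β) (hx : 0 < x) :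
    ∫ t in Set.Ioi (0 : ℝ), t ^ (-β - 1) * expRem n (x / t) = x ^ (-β) * Real.Gamma β := by
  rw [(comp_div_integrableOn_iff hx).2, integral_expRem n h]

lemma integral_abs_expRem_div {n : ℕ} {β x : ℝ} (hx : 0 < x) :
    ∫ t in Set.Ioi (0 : ℝ), t ^ (-β - 1) * |expRem n (x / t)|
      = x ^ (-β) * ∫ v in Set.Ioi (0 : ℝ), v ^ (β - 1) * |expRem n v| :=
  (comp_div_integrableOn_iff (f := fun v => |expRem n v|) hx).2

/-! ### The Frullani integral with Taylor subtraction -/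

/-- `exp(-u)` minus its Taylor polynomial, where the last term is subtracted for `t < 1` only. -/
def frullani (j : ℕ) (t c : ℝ) : ℝ :=
  expRem j (c * t) - if t < 1 then (-(c * t)) ^ j / j.factorial else 0

lemma measurable_frullani (j : ℕ) : Measurable fun p : ℝ × ℝ => frullani j p.1 p.2 := by
  unfold frullani
  refine Measurable.sub ?_ (Measurable.ite ?_ ?_ measurable_const)
  · exact ((continuous_expRem j).comp (by fun_prop)).measurable
  · exact measurableSet_lt measurable_fst measurable_const
  · exact Continuous.measurable (by fun_prop)

lemma integrableOn_frullani_one (j : ℕ) :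
    IntegrableOn (fun t : ℝ => (t ^ (j + 1))⁻¹ * frullani j t 1) (Set.Ioi 0) := by
  have hmeas : AEStronglyMeasurable (fun t : ℝ => (t ^ (j + 1))⁻¹ * frullani j t 1) volume :=
    ((measurable_id.pow_const _).inv.mul
      ((measurable_frullani j).comp (measurable_id.prodMk measurable_const))).aestronglyMeasurable
  rw [← Set.Ioc_union_Ioi_eq_Ioi zero_le_one]
  refine IntegrableOn.union ?_ ?_
  · rw [integrableOn_Ioc_iff_integrableOn_Ioo]
    refine Integrable.mono' (g := fun _ => (1 : ℝ)) (by simp) hmeas.restrict ?_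
    filter_upwards [ae_restrict_mem measurableSet_Ioo] with t ht
    have := abs_expRem_le' (j + 1) ht.1.le
    rw [frullani, if_pos ht.2, one_mul, ← expRem_succ, norm_mul, norm_inv, norm_pow,
      Real.norm_of_nonneg ht.1.le, inv_mul_le_iff₀ (pow_pos ht.1 _), mul_one]
    exact this
  · refine Integrable.mono' (g := fun t : ℝ => 2 * t ^ (-2 : ℝ))
      ((integrableOn_Ioi_rpow_of_lt (by norm_num) one_pos).const_mul 2) hmeas.restrict ?_
    filter_upwards [ae_restrict_mem measurableSet_Ioi] with t ht
    have ht1 : (1 : ℝ) < t := ht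
    have ht0 : (0 : ℝ) < t := lt_trans one_pos ht1
    rw [frullani, if_neg ht1.le.not_gt, one_mul, sub_zero, norm_mul, norm_inv, norm_pow,
      Real.norm_of_nonneg ht0.le, inv_mul_le_iff₀ (pow_pos ht0 _)]
    have e : t ^ (j + 1) * (2 * t ^ (-2 : ℝ)) = 2 * (t ^ j * t⁻¹) := by
      rw [Real.rpow_neg ht0.le, Real.rpow_two]
      field_simp
      ring
    rw [e]
    cases j with
    | zero =>
      rw [expRem_zero, Real.norm_of_nonneg (Real.exp_pos _).le, Real.exp_neg, pow_zero, one_mul]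
      have h1 : (Real.exp t)⁻¹ ≤ t⁻¹ := by
        gcongr
        linarith [Real.add_one_le_exp t]
      have h2 : 0 < t⁻¹ := by positivity
      linarith
    | succ j =>
      refine (abs_expRem_succ_le j ht0.le).trans (le_of_eq ?_)
      rw [pow_succ]
      field_simp

/-- The difference of two indicator functions which appears on rescaling. -/
def logWindow (c u : ℝ) : ℝ := (if u < c then 1 else 0) - (if u < 1 then 1 else 0)

lemma logWindow_integral {c : ℝ} (hc : 0 < c) :
    IntegrableOn (fun u : ℝ => u⁻¹ * logWindow c u) (Set.Ioi 0) ∧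
    ∫ u in Set.Ioi (0 : ℝ), u⁻¹ * logWindow c u = Real.log c ∧
    ∫ u in Set.Ioi (0 : ℝ), u⁻¹ * |logWindow c u| = |Real.log c| := by
  have hcont : ∀ a b : ℝ, 0 < a → a ≤ b → IntegrableOn (fun u : ℝ => u⁻¹) (Set.Ico a b) ∧
      ∫ u in Set.Ico a b, u⁻¹ = Real.log (b / a) := by
    intro a b ha hab
    have hb := lt_of_lt_of_le ha hab
    constructor
    · have : IntegrableOn (fun u : ℝ => u⁻¹) (Set.Icc a b) :=
        (ContinuousOn.inv₀ continuousOn_id fun u hu => (lt_of_lt_of_le ha hu.1).ne').integrableOn_Icc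
      exact this.mono_set Set.Ico_subset_Icc_self
    · rw [integral_Ico_eq_integral_Ioc, ← intervalIntegral.integral_of_le hab,
        integral_inv_of_pos ha hb]
  rcases le_total 1 c with h | h
  · obtain ⟨h1, h2⟩ := hcont 1 c one_pos h
    have e : ∀ u, logWindow c u = (Set.Ico 1 c).indicator (fun _ => (1 : ℝ)) u := by
      intro u
      simp only [logWindow, Set.indicator, Set.mem_Ico]
      split_ifs <;> first | rfl | (exfalso; grind) | norm_num
    have e2 : ∀ u, u⁻¹ * logWindow c u = (Set.Ico 1 c).indicator (fun u => u⁻¹) u := by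
      intro u
      rw [e]; simp only [Set.indicator]; split_ifs <;> simp
    have e3 : ∀ u, |logWindow c u| = logWindow c u := by
      intro u
      rw [e]; simp only [Set.indicator]; split_ifs <;> simp
    have hsub : Set.Ico 1 c ⊆ Set.Ioi (0 : ℝ) := fun u hu => lt_of_lt_of_le one_pos hu.1
    have hval : ∫ u in Set.Ioi (0 : ℝ), u⁻¹ * logWindow c u = Real.log c := by
      simp only [e2]
      rw [setIntegral_indicator measurableSet_Ico, Set.inter_eq_right.2 hsub, h2, div_one]
    refine ⟨?_, hval, ?_⟩
    · simp only [e2]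
      exact ((integrable_indicator_iff measurableSet_Ico).2 h1).integrableOn
    · simp only [e3]
      rw [hval, abs_of_nonneg (Real.log_nonneg h)]
  · obtain ⟨h1, h2⟩ := hcont c 1 hc h
    have e : ∀ u, logWindow c u = (Set.Ico c 1).indicator (fun _ => (-1 : ℝ)) u := by
      intro u
      simp only [logWindow, Set.indicator, Set.mem_Ico]
      split_ifs <;> first | rfl | (exfalso; grind) | norm_num
    have e2 : ∀ u, u⁻¹ * logWindow c u = (Set.Ico c 1).indicator (fun u => -u⁻¹) u := by
      intro u
      rw [e]; simp only [Set.indicator]; split_ifs <;> simp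
    have e3 : ∀ u, u⁻¹ * |logWindow c u| = -(u⁻¹ * logWindow c u) := by
      intro u
      rw [e]; simp only [Set.indicator]; split_ifs <;> simp
    have hsub : Set.Ico c 1 ⊆ Set.Ioi (0 : ℝ) := fun u hu => lt_of_lt_of_le hc hu.1
    have hval : ∫ u in Set.Ioi (0 : ℝ), u⁻¹ * logWindow c u = Real.log c := by
      simp only [e2]
      rw [setIntegral_indicator measurableSet_Ico, Set.inter_eq_right.2 hsub, integral_neg, h2,
        one_div, Real.log_inv, neg_neg]
    refine ⟨?_, hval, ?_⟩
    · simp only [e2]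
      exact ((integrable_indicator_iff measurableSet_Ico).2 h1.neg).integrableOn
    · simp only [e3]
      rw [integral_neg, hval, abs_of_nonpos (Real.log_nonpos hc.le h)]

lemma frullani_rescale (j : ℕ) {c : ℝ} (hc : 0 < c) {t : ℝ} (ht : 0 < t) :
    (t ^ (j + 1))⁻¹ * frullani j t c
      = c ^ (j + 1) * ((fun u : ℝ => (u ^ (j + 1))⁻¹ * frullani j u 1
          - (-1) ^ j / j.factorial * (u⁻¹ * logWindow c u)) (c * t)) := by
  have h1 : c * t < c ↔ t < 1 := by rw [mul_lt_iff_lt_one_right hc]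
  simp only [frullani, logWindow, h1, one_mul]
  rw [mul_pow c t (j + 1), mul_inv, neg_pow (c * t)]
  have hct : 0 < c * t := by positivity
  have e : (c * t)⁻¹ = (c ^ (j + 1))⁻¹ * (t ^ (j + 1))⁻¹ * (c * t) ^ j := by
    rw [mul_pow]; field_simp; ring
  rw [e]
  have hcj : c ^ (j + 1) ≠ 0 := by positivity
  by_cases ht1 : t < 1 <;> by_cases hct1 : c * t < 1 <;> simp only [ht1, hct1, if_true, if_false] <;>
    field_simp <;> ring

/-- The value of the subtracted Frullani integral at `c = 1`. -/
def frullaniConst (j : ℕ) : ℝ := ∫ t in Set.Ioi (0 : ℝ), (t ^ (j + 1))⁻¹ * frullani j t 1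

/-- The absolute value of the subtracted Frullani integral at `c = 1`. -/
def frullaniBound (j : ℕ) : ℝ := ∫ t in Set.Ioi (0 : ℝ), |(t ^ (j + 1))⁻¹ * frullani j t 1|

lemma frullani_integral (j : ℕ) {c : ℝ} (hc : 0 < c) :
    IntegrableOn (fun t : ℝ => (t ^ (j + 1))⁻¹ * frullani j t c) (Set.Ioi 0) ∧
    ∫ t in Set.Ioi (0 : ℝ), (t ^ (j + 1))⁻¹ * frullani j t c
      = c ^ j * (frullaniConst j - (-1) ^ j / j.factorial * Real.log c) ∧
    ∫ t in Set.Ioi (0 : ℝ), |(t ^ (j + 1))⁻¹ * frullani j t c|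
      ≤ c ^ j * (frullaniBound j + |Real.log c|) := by
  obtain ⟨w1, w2, w3⟩ := logWindow_integral hc
  set f : ℝ → ℝ := fun u => (u ^ (j + 1))⁻¹ * frullani j u 1
          - (-1) ^ j / j.factorial * (u⁻¹ * logWindow c u)
  have hf : IntegrableOn f (Set.Ioi 0) :=
    (integrableOn_frullani_one j).sub (w1.const_mul _)
  have heq : Set.EqOn (fun t : ℝ => (t ^ (j + 1))⁻¹ * frullani j t c)
      (fun t => c ^ (j + 1) * f (c * t)) (Set.Ioi 0) := fun t ht => frullani_rescale j hc ht
  have hfc : IntegrableOn (fun t => f (c * t)) (Set.Ioi 0) := by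
    rw [integrableOn_Ioi_comp_mul_left_iff _ _ hc, mul_zero]; exact hf
  have hcc : c ^ (j + 1) * c⁻¹ = c ^ j := by rw [pow_succ]; field_simp
  refine ⟨?_, ?_, ?_⟩
  · rw [integrableOn_congr_fun heq measurableSet_Ioi]
    exact hfc.const_mul _
  · rw [setIntegral_congr_fun measurableSet_Ioi heq, integral_const_mul,
      integral_comp_mul_left_Ioi _ _ hc, mul_zero, smul_eq_mul, ← mul_assoc, hcc,
      integral_sub (integrableOn_frullani_one j) (w1.const_mul _), integral_const_mul, w2]
    rfl
  · have heq2 : Set.EqOn (fun t : ℝ => |(t ^ (j + 1))⁻¹ * frullani j t c|)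
        (fun t => c ^ (j + 1) * (fun u => |f u|) (c * t)) (Set.Ioi 0) := by
      intro t ht
      have := heq ht
      simp only at this ⊢
      rw [this, abs_mul, abs_of_pos (pow_pos hc _)]
    rw [setIntegral_congr_fun measurableSet_Ioi heq2, integral_const_mul,
      integral_comp_mul_left_Ioi (fun u => |f u|) 0 hc, mul_zero, smul_eq_mul, ← mul_assoc, hcc]
    refine mul_le_mul_of_nonneg_left ?_ (by positivity)
    rw [← w3, frullaniBound]
    have w4 : IntegrableOn (fun u : ℝ => u⁻¹ * |logWindow c u|) (Set.Ioi 0) := by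
      refine IntegrableOn.congr_fun (f := fun u => |u⁻¹ * logWindow c u|) w1.abs (fun u hu => ?_)
        measurableSet_Ioi
      simp only [abs_mul, abs_of_pos (inv_pos.2 (show (0 : ℝ) < u from hu))]
    rw [← integral_add (integrableOn_frullani_one j).abs w4]
    refine setIntegral_mono_on hf.abs ((integrableOn_frullani_one j).abs.add w4)
      measurableSet_Ioi fun u hu => ?_
    have hu0 : (0 : ℝ) < u := hu
    simp only [f]
    refine (abs_sub _ _).trans ?_
    gcongr
    rw [abs_mul, abs_div, abs_pow, abs_neg, abs_one, one_pow, Nat.abs_cast, abs_mul,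
      abs_of_pos (inv_pos.2 hu0)]
    refine mul_le_of_le_one_left (by positivity) ?_
    rw [div_le_one (by positivity)]
    exact_mod_cast Nat.succ_le_of_lt j.factorial_pos

lemma rpow_mul_exp_neg_le {p x : ℝ} (hp : 0 < p) (hx : 0 ≤ x) :
    x ^ p * Real.exp (-x) ≤ p ^ p := by
  have h1 : x / p ≤ Real.exp (x / p) := by linarith [Real.add_one_le_exp (x / p)]
  have h2 : (x / p) ^ p ≤ Real.exp (x / p) ^ p := Real.rpow_le_rpow (by positivity) h1 hp.le
  rw [← Real.exp_mul, div_mul_cancel₀ _ hp.ne', Real.div_rpow hx hp.le,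
    div_le_iff₀ (Real.rpow_pos_of_pos hp p)] at h2
  rw [Real.exp_neg, mul_inv_le_iff₀ (Real.exp_pos x)]
  linarith

section LogMoment

variable {Y Z : Type*} [MeasurableSpace Y] [MeasurableSpace Z] {μ : Measure Y} {ν : Measure Z}
  {ρ : Y → ℝ} {σ : Z → ℝ} {χ : Y → ℂ} {B : Z → ℂ} {j : ℕ} {s : ℝ}

lemma integrable_expRem_smul {i : ℕ} (hρ : Measurable ρ) (hρ0 : ∀ᵐ y ∂μ, 0 < ρ y)
    (hχ0 : Integrable (fun y => (ρ y ^ i) • χ y) μ) (hχm : AEStronglyMeasurable χ μ)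
    {t : ℝ} (ht : 0 ≤ t) : Integrable (fun y => expRem i (ρ y * t) • χ y) μ := by
  refine (hχ0.norm.const_mul (t ^ i)).mono' ?_ ?_
  · exact (((continuous_expRem i).measurable.comp (hρ.mul_const t)).aestronglyMeasurable).smul hχm
  · filter_upwards [hρ0] with y hy
    rw [norm_smul, norm_smul, norm_pow, Real.norm_of_nonneg hy.le, ← mul_assoc]
    gcongr
    refine (abs_expRem_le' i (by positivity)).trans (le_of_eq ?_)
    rw [mul_pow, mul_comm]

/-- If the moments of order less than `i` vanish, the Laplace transform of `χ` can be computed with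
the Taylor remainder of the exponential function. -/
lemma integral_expRem_smul {i : ℕ} (hχ : ∀ k < i, Integrable (fun y => (ρ y ^ k) • χ y) μ)
    (hmom : ∀ k < i, ∫ y, (ρ y ^ k) • χ y ∂μ = 0) {t : ℝ}
    (hint : Integrable (fun y => Real.exp (-(ρ y * t)) • χ y) μ) :
    Integrable (fun y => expRem i (ρ y * t) • χ y) μ ∧
    ∫ y, expRem i (ρ y * t) • χ y ∂μ = ∫ y, Real.exp (-(ρ y * t)) • χ y ∂μ := by
  induction i with
  | zero =>
    simp only [expRem_zero]
    exact ⟨hint, trivial⟩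
  | succ i ih =>
    obtain ⟨ih1, ih2⟩ := ih (fun k hk => hχ k (by omega)) (fun k hk => hmom k (by omega))
    have e : ∀ y, expRem (i + 1) (ρ y * t) • χ y
        = expRem i (ρ y * t) • χ y - ((-t) ^ i / (i.factorial : ℝ)) • (ρ y ^ i • χ y) := by
      intro y
      rw [expRem_succ, sub_smul, smul_smul]
      congr 2
      rw [← mul_neg, mul_pow]
      ring
    have h1 : Integrable (fun y => ((-t) ^ i / (i.factorial : ℝ)) • (ρ y ^ i • χ y)) μ :=
      (hχ i (by omega)).smul ((-t) ^ i / (i.factorial : ℝ))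
    simp only [e]
    refine ⟨ih1.sub h1, ?_⟩
    rw [integral_sub ih1 h1, integral_smul, hmom i (by omega), smul_zero, sub_zero, ih2]

lemma tendsto_expRem_moment {i : ℕ} (hρ : Measurable ρ) (hρ0 : ∀ᵐ y ∂μ, 0 < ρ y)
    (hχm : AEStronglyMeasurable χ μ) (hχ : Integrable (fun y => (ρ y ^ i) • χ y) μ) :
    Tendsto (fun t : ℝ => ∫ y, ((t ^ i)⁻¹ * expRem i (ρ y * t)) • χ y ∂μ) (𝓝[>] 0)
      (𝓝 (∫ y, ((-1) ^ i / (i.factorial : ℝ)) • (ρ y ^ i • χ y) ∂μ)) := by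
  refine tendsto_integral_filter_of_dominated_convergence (fun y => ‖(ρ y ^ i) • χ y‖) ?_ ?_
    hχ.norm ?_
  · refine Eventually.of_forall fun t => ?_
    exact (((((continuous_expRem i).measurable.comp
      (hρ.mul_const t)).const_mul _)).aestronglyMeasurable).smul hχm
  · filter_upwards [self_mem_nhdsWithin] with t ht
    have ht : (0 : ℝ) < t := ht
    filter_upwards [hρ0] with y hy
    rw [norm_smul, norm_smul, norm_pow, norm_mul, norm_inv, norm_pow, Real.norm_of_nonneg hy.le,
      Real.norm_of_nonneg ht.le]
    gcongr
    rw [inv_mul_le_iff₀ (by positivity)]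
    refine (abs_expRem_le' i (by positivity)).trans (le_of_eq ?_)
    rw [mul_pow, mul_comm]
  · filter_upwards [hρ0] with y hy
    rw [smul_smul]
    refine Tendsto.smul_const ?_ _
    have h1 : Tendsto (fun t : ℝ => (t ^ i)⁻¹ * expRem (i + 1) (ρ y * t)) (𝓝[>] 0) (𝓝 0) := by
      have h2 : Tendsto (fun t : ℝ => ρ y ^ (i + 1) * t) (𝓝[>] 0) (𝓝 0) := by
        have : Tendsto (fun t : ℝ => ρ y ^ (i + 1) * t) (𝓝 0) (𝓝 (ρ y ^ (i + 1) * 0)) :=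
          (continuous_const.mul continuous_id).tendsto 0
        rw [mul_zero] at this
        exact this.mono_left nhdsWithin_le_nhds
      refine squeeze_zero_norm' ?_ h2
      filter_upwards [self_mem_nhdsWithin] with t ht
      have ht : (0 : ℝ) < t := ht
      rw [norm_mul, norm_inv, norm_pow, Real.norm_of_nonneg ht.le,
        inv_mul_le_iff₀ (by positivity)]
      refine (abs_expRem_le' (i + 1) (by positivity)).trans (le_of_eq ?_)
      rw [mul_pow, pow_succ t]
      ring
    have h3 := h1.add_const ((-1) ^ i / (i.factorial : ℝ) * ρ y ^ i)
    rw [zero_add] at h3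
    refine h3.congr' ?_
    filter_upwards [self_mem_nhdsWithin] with t ht
    have ht : (0 : ℝ) < t := ht
    rw [expRem_succ, neg_pow, mul_pow]
    field_simp
    ring

lemma tendsto_gaussian_zero {i : ℕ} (hij : i ≤ j) (hs : 0 < s) (hσ : Measurable σ)
    (hσ0 : ∀ᵐ z ∂ν, 0 < σ z) (hB : Integrable B ν) :
    Tendsto (fun t : ℝ => ((t ^ i)⁻¹ * t ^ (-s)) •
      ∫ z, (σ z ^ (s + j) * Real.exp (-(σ z / t))) • B z ∂ν) (𝓝[>] 0) (𝓝 0) := by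
  have hp : 0 < s + j := by positivity
  have h0 : (0 : ℂ) = ∫ z, (0 : ℝ) • B z ∂ν := by simp
  simp only [← integral_smul]
  rw [h0]
  have hev : ∀ᶠ t : ℝ in 𝓝[>] 0, 0 < t ∧ t < 1 :=
    Ioo_mem_nhdsGT one_pos
  have hle : ∀ t : ℝ, 0 < t → t < 1 → ∀ x : ℝ, 0 < x →
      ((t ^ i)⁻¹ * t ^ (-s)) * (x ^ (s + j) * Real.exp (-(x / t)))
        ≤ (x / t) ^ (s + j) * Real.exp (-(x / t)) := by
    intro t ht ht1 x hx
    rw [Real.div_rpow hx.le ht.le, ← mul_assoc]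
    gcongr
    rw [div_eq_mul_inv, mul_comm]
    gcongr
    rw [← Real.rpow_natCast, ← Real.rpow_neg ht.le, ← Real.rpow_neg ht.le, ← Real.rpow_add ht]
    refine Real.rpow_le_rpow_of_exponent_ge ht ht1.le ?_
    have : (i : ℝ) ≤ j := by exact_mod_cast hij
    linarith
  refine tendsto_integral_filter_of_dominated_convergence
    (fun z => (s + j) ^ (s + j) * ‖B z‖) ?_ ?_ (hB.norm.const_mul _) ?_
  · refine Eventually.of_forall fun t => ?_
    refine AEStronglyMeasurable.const_smul ?_ _
    have hm : Measurable fun z => σ z ^ (s + j) * Real.exp (-(σ z / t)) :=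
      (hσ.pow_const _).mul ((hσ.div_const t).neg.exp)
    exact hm.aestronglyMeasurable.smul hB.aestronglyMeasurable
  · filter_upwards [hev] with t ht
    filter_upwards [hσ0] with z hz
    rw [smul_smul, norm_smul]
    gcongr
    have := ht.1
    rw [Real.norm_of_nonneg (by positivity)]
    exact (hle t ht.1 ht.2 _ hz).trans (rpow_mul_exp_neg_le hp (by positivity))
  · filter_upwards [hσ0] with z hz
    simp only [smul_smul]
    refine Tendsto.smul_const ?_ _
    have h1 : Tendsto (fun t : ℝ => σ z / t) (𝓝[>] 0) atTop := by
      simp only [div_eq_mul_inv]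
      exact tendsto_inv_nhdsGT_zero.const_mul_atTop hz
    have h2 := (tendsto_rpow_mul_exp_neg_mul_atTop_nhds_zero (s + j) 1 one_pos).comp h1
    refine squeeze_zero' ?_ ?_ h2
    · filter_upwards [hev] with t ht
      have := ht.1
      positivity
    · filter_upwards [hev] with t ht
      have := hle t ht.1 ht.2 _ hz
      simpa using this

/-- The moments of `χ` up to order `j` vanish. -/
lemma moments_eq_zero (hs : 0 < s) (hρ : Measurable ρ) (hρ0 : ∀ᵐ y ∂μ, 0 < ρ y)
    (hσ : Measurable σ) (hσ0 : ∀ᵐ z ∂ν, 0 < σ z)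
    (hχ : ∀ k ≤ j, Integrable (fun y => (ρ y ^ k) • χ y) μ) (hB : Integrable B ν)
    (hG : ∀ t : ℝ, 0 < t → ∫ y, Real.exp (-(ρ y * t)) • χ y ∂μ
      = t ^ (-s) • ∫ z, (σ z ^ (s + j) * Real.exp (-(σ z / t))) • B z ∂ν) :
    ∀ i ≤ j, ∫ y, (ρ y ^ i) • χ y ∂μ = 0 := by
  have hχm : AEStronglyMeasurable χ μ := by
    have := (hχ 0 (Nat.zero_le _)).aestronglyMeasurable
    simpa using this
  intro i
  induction i using Nat.strong_induction_on with
  | _ i ih =>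
    intro hij
    have hT := tendsto_expRem_moment hρ hρ0 hχm (hχ i hij)
    have hT0 := tendsto_gaussian_zero (ν := ν) hij hs hσ hσ0 hB
    have heq : ∀ᶠ t : ℝ in 𝓝[>] 0, ((t ^ i)⁻¹ * t ^ (-s)) •
        ∫ z, (σ z ^ (s + j) * Real.exp (-(σ z / t))) • B z ∂ν
        = ∫ y, ((t ^ i)⁻¹ * expRem i (ρ y * t)) • χ y ∂μ := by
      filter_upwards [self_mem_nhdsWithin] with t ht
      have ht : (0 : ℝ) < t := ht
      have hint : Integrable (fun y => Real.exp (-(ρ y * t)) • χ y) μ := by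
        have := integrable_expRem_smul (i := 0) hρ hρ0 (hχ 0 (Nat.zero_le _)) hχm ht.le
        simpa only [expRem_zero] using this
      have h1 := (integral_expRem_smul (fun k hk => hχ k (hk.le.trans hij))
        (fun k hk => ih k hk (hk.le.trans hij)) hint).2
      have e : ∀ y, ((t ^ i)⁻¹ * expRem i (ρ y * t)) • χ y
          = (t ^ i)⁻¹ • (expRem i (ρ y * t) • χ y) := fun y => mul_smul _ _ _
      simp only [e]
      rw [integral_smul, h1, hG t ht, mul_smul]
    have hlim := tendsto_nhds_unique (hT0.congr' heq) hT
    rw [integral_smul] at hlim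
    have hc : ((-1 : ℝ) ^ i / (i.factorial : ℝ)) ≠ 0 :=
      div_ne_zero (pow_ne_zero _ (by norm_num)) (by positivity)
    exact (smul_eq_zero.1 hlim.symm).resolve_left hc

variable [SFinite μ] [SFinite ν]

theorem log_moment (hs : 0 < s) (hρ : Measurable ρ) (hρ0 : ∀ᵐ y ∂μ, 0 < ρ y)
    (hσ : Measurable σ) (hσ0 : ∀ᵐ z ∂ν, 0 < σ z)
    (hχ : ∀ k ≤ j, Integrable (fun y => (ρ y ^ k) • χ y) μ)
    (hlog : Integrable (fun y => (ρ y ^ j * Real.log (ρ y)) • χ y) μ) (hB : Integrable B ν)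
    (hG : ∀ t : ℝ, 0 < t → ∫ y, Real.exp (-(ρ y * t)) • χ y ∂μ
      = t ^ (-s) • ∫ z, (σ z ^ (s + j) * Real.exp (-(σ z / t))) • B z ∂ν) :
    -((-1) ^ j / (j.factorial : ℝ)) • ∫ y, (ρ y ^ j * Real.log (ρ y)) • χ y ∂μ
      = Real.Gamma (s + j) • ∫ z, B z ∂ν := by
  have hmom := moments_eq_zero hs hρ hρ0 hσ hσ0 hχ hB hG
  have hχm : AEStronglyMeasurable χ μ := by
    have := (hχ 0 (Nat.zero_le _)).aestronglyMeasurable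
    simpa using this
  have hp : 0 < s + j := by positivity
  set τ : Measure ℝ := volume.restrict (Set.Ioi 0)
  -- the double integral on the side of `χ`
  have hF1m : AEStronglyMeasurable (fun q : Y × ℝ =>
      ((q.2 ^ (j + 1))⁻¹ * frullani j q.2 (ρ q.1)) • χ q.1) (μ.prod τ) := by
    have hm : Measurable fun q : Y × ℝ => (q.2 ^ (j + 1))⁻¹ * frullani j q.2 (ρ q.1) :=
      (measurable_snd.pow_const _).inv.mul
        ((measurable_frullani j).comp (measurable_snd.prodMk (hρ.comp measurable_fst)))
    exact hm.aestronglyMeasurable.smul hχm.comp_fst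
  have hF1 : Integrable (fun q : Y × ℝ =>
      ((q.2 ^ (j + 1))⁻¹ * frullani j q.2 (ρ q.1)) • χ q.1) (μ.prod τ) := by
    rw [integrable_prod_iff hF1m]
    constructor
    · filter_upwards [hρ0] with y hy
      exact (frullani_integral j hy).1.smul_const _
    · refine (((hχ j le_rfl).norm.const_mul (frullaniBound j)).add hlog.norm).mono'
        hF1m.norm.integral_prod_right' ?_
      filter_upwards [hρ0] with y hy
      simp only [norm_smul, Real.norm_eq_abs]
      rw [integral_mul_const, abs_mul, abs_of_nonneg (integral_nonneg fun _ => abs_nonneg _),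
        abs_of_nonneg (norm_nonneg _)]
      have := (frullani_integral j hy).2.2
      calc _ ≤ (ρ y ^ j * (frullaniBound j + |Real.log (ρ y)|)) * ‖χ y‖ := by gcongr
        _ = _ := by
          simp only [Pi.add_apply]
          rw [abs_of_pos (pow_pos hy j), abs_mul, abs_of_pos (pow_pos hy j)]
          ring
  have hside1 : ∫ t, (∫ y, ((t ^ (j + 1))⁻¹ * frullani j t (ρ y)) • χ y ∂μ) ∂τ
      = -((-1) ^ j / (j.factorial : ℝ)) • ∫ y, (ρ y ^ j * Real.log (ρ y)) • χ y ∂μ := by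
    rw [← integral_integral_swap hF1]
    have : ∀ᵐ y ∂μ, ∫ t, ((t ^ (j + 1))⁻¹ * frullani j t (ρ y)) • χ y ∂τ
        = frullaniConst j • (ρ y ^ j • χ y)
          + -((-1) ^ j / (j.factorial : ℝ)) • ((ρ y ^ j * Real.log (ρ y)) • χ y) := by
      filter_upwards [hρ0] with y hy
      rw [integral_smul_const, (frullani_integral j hy).2.1]
      simp only [smul_smul, ← add_smul]
      congr 1
      ring
    have h1 : Integrable (fun y => frullaniConst j • (ρ y ^ j • χ y)) μ :=
      (hχ j le_rfl).smul (frullaniConst j)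
    have h2 : Integrable (fun y => -((-1) ^ j / (j.factorial : ℝ)) •
      ((ρ y ^ j * Real.log (ρ y)) • χ y)) μ :=
      hlog.smul (-((-1) ^ j / (j.factorial : ℝ)))
    rw [integral_congr_ae this, integral_add h1 h2, integral_smul,
      integral_smul, hmom j le_rfl, smul_zero, zero_add]
  -- for fixed `t` the inner integral is the Laplace transform
  have hinner : ∀ t : ℝ, 0 < t → ∫ y, ((t ^ (j + 1))⁻¹ * frullani j t (ρ y)) • χ y ∂μ
      = ∫ z, ((t ^ (j + 1))⁻¹ * t ^ (-s) * (σ z ^ (s + j) * Real.exp (-(σ z / t)))) • B z ∂ν := by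
    intro t ht
    have hint : Integrable (fun y => Real.exp (-(ρ y * t)) • χ y) μ := by
      have := integrable_expRem_smul (i := 0) hρ hρ0 (hχ 0 (Nat.zero_le _)) hχm ht.le
      simpa only [expRem_zero] using this
    obtain ⟨h1, h2⟩ := integral_expRem_smul (fun k hk => hχ k (le_of_lt hk))
      (fun k hk => hmom k (le_of_lt hk)) hint
    have e : ∀ y, ((t ^ (j + 1))⁻¹ * frullani j t (ρ y)) • χ y
        = (t ^ (j + 1))⁻¹ • (expRem j (ρ y * t) • χ y
          - (if t < 1 then (-t) ^ j / (j.factorial : ℝ) else 0) • (ρ y ^ j • χ y)) := by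
      intro y
      rw [mul_smul, frullani, sub_smul]
      congr 2
      split_ifs
      · rw [smul_smul]
        congr 1
        rw [← mul_neg, mul_pow]
        ring
      · simp
    have h3 : Integrable (fun y => (if t < 1 then (-t) ^ j / (j.factorial : ℝ) else 0) •
      (ρ y ^ j • χ y)) μ :=
      (hχ j le_rfl).smul (if t < 1 then (-t) ^ j / (j.factorial : ℝ) else 0)
    simp only [e]
    rw [integral_smul, integral_sub h1 h3, integral_smul, hmom j le_rfl,
      smul_zero, sub_zero, h2, hG t ht, smul_smul, ← integral_smul]
    simp only [smul_smul]
  -- the double integral on the side of `B`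
  have hpow : ∀ t : ℝ, 0 < t → (t ^ (j + 1))⁻¹ * t ^ (-s) = t ^ (-(s + j) - 1) := by
    intro t ht
    rw [← Real.rpow_natCast, ← Real.rpow_neg ht.le, ← Real.rpow_add ht]
    congr 1
    push_cast
    ring
  have hstrip : GammaStrip 0 (s + j) := ⟨by simpa using hp, Or.inl rfl⟩
  have hF2m : AEStronglyMeasurable (fun q : Z × ℝ => ((q.2 ^ (j + 1))⁻¹ * q.2 ^ (-s) *
      (σ q.1 ^ (s + j) * Real.exp (-(σ q.1 / q.2)))) • B q.1) (ν.prod τ) := by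
    have hσ1 : Measurable fun q : Z × ℝ => σ q.1 := hσ.comp measurable_fst
    have hm : Measurable fun q : Z × ℝ => (q.2 ^ (j + 1))⁻¹ * q.2 ^ (-s) *
        (σ q.1 ^ (s + j) * Real.exp (-(σ q.1 / q.2))) :=
      ((measurable_snd.pow_const _).inv.mul (measurable_snd.pow_const _)).mul
        ((hσ1.pow_const _).mul ((hσ1.div measurable_snd).neg.exp))
    exact hm.aestronglyMeasurable.smul hB.aestronglyMeasurable.comp_fst
  have hslice : ∀ z, 0 < σ z → Set.EqOn (fun t : ℝ => (t ^ (j + 1))⁻¹ * t ^ (-s) *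
      (σ z ^ (s + j) * Real.exp (-(σ z / t))))
      (fun t : ℝ => σ z ^ (s + j) * (t ^ (-(s + j) - 1) * expRem 0 (σ z / t))) (Set.Ioi 0) := by
    intro z hz t ht
    simp only
    rw [hpow t ht, expRem_zero]
    ring
  have hval : ∀ z, 0 < σ z → ∫ t, (t ^ (j + 1))⁻¹ * t ^ (-s) *
      (σ z ^ (s + j) * Real.exp (-(σ z / t))) ∂τ = Real.Gamma (s + j) := by
    intro z hz
    rw [setIntegral_congr_fun measurableSet_Ioi (hslice z hz), integral_const_mul,
      integral_expRem_div hstrip hz, ← mul_assoc, ← Real.rpow_add hz, add_neg_cancel,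
      Real.rpow_zero, one_mul]
  have hintz : ∀ z, 0 < σ z → Integrable (fun t : ℝ => (t ^ (j + 1))⁻¹ * t ^ (-s) *
      (σ z ^ (s + j) * Real.exp (-(σ z / t)))) τ := by
    intro z hz
    have : IntegrableOn (fun t : ℝ => σ z ^ (s + j) * (t ^ (-(s + j) - 1) * expRem 0 (σ z / t)))
      (Set.Ioi 0) := (integrableOn_expRem_div hstrip hz).const_mul _
    exact this.congr_fun (hslice z hz).symm measurableSet_Ioi
  have hF2 : Integrable (fun q : Z × ℝ => ((q.2 ^ (j + 1))⁻¹ * q.2 ^ (-s) *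
      (σ q.1 ^ (s + j) * Real.exp (-(σ q.1 / q.2)))) • B q.1) (ν.prod τ) := by
    rw [integrable_prod_iff hF2m]
    constructor
    · filter_upwards [hσ0] with z hz
      exact (hintz z hz).smul_const _
    · refine (hB.norm.const_mul (Real.Gamma (s + j))).congr ?_
      filter_upwards [hσ0] with z hz
      simp only [norm_smul]
      rw [integral_mul_const, ← hval z hz]
      congr 1
      refine setIntegral_congr_fun measurableSet_Ioi fun t ht => ?_
      have ht : (0 : ℝ) < t := ht
      exact (Real.norm_of_nonneg (by positivity)).symm
  rw [← hside1, setIntegral_congr_fun measurableSet_Ioi (fun t ht => hinner t ht),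
    ← integral_integral_swap hF2, ← integral_smul]
  refine integral_congr_ae ?_
  filter_upwards [hσ0] with z hz
  rw [integral_smul_const, hval z hz]

end LogMoment

/-! ### Finite parts and Laplace transforms -/

lemma coeff_eq_zero_of_norm_le : ∀ (N : ℕ) (c : ℕ → ℂ) (C : ℝ),
    (∀ τ : ℝ, 0 < τ → ‖∑ k ∈ Finset.range N, c k * (τ : ℂ) ^ k‖ ≤ C * τ ^ N) →
    ∀ k < N, c k = 0
  | 0, _, _, _ => by simp
  | N + 1, c, C, h => by
    have hsum : ∀ τ : ℝ, ∑ k ∈ Finset.range (N + 1), c k * (τ : ℂ) ^ k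
        = τ * ∑ k ∈ Finset.range N, c (k + 1) * (τ : ℂ) ^ k + c 0 := by
      intro τ
      rw [Finset.sum_range_succ', Finset.mul_sum]
      simp only [pow_zero, mul_one]
      congr 1
      refine Finset.sum_congr rfl fun k _ => ?_
      ring
    have h0 : c 0 = 0 := by
      have hc : Continuous fun τ : ℝ => ‖∑ k ∈ Finset.range (N + 1), c k * (τ : ℂ) ^ k‖ := by
        fun_prop
      have hc' : Continuous fun τ : ℝ => C * τ ^ (N + 1) := by fun_prop
      have h1 := (hc.tendsto 0).mono_left (nhdsWithin_le_nhds (s := Set.Ioi 0))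
      have h2 := (hc'.tendsto 0).mono_left (nhdsWithin_le_nhds (s := Set.Ioi 0))
      have h3 := le_of_tendsto_of_tendsto h1 h2
        (eventually_nhdsWithin_of_forall fun τ hτ => h τ hτ)
      rw [hsum] at h3
      simpa using h3
    have h1 := coeff_eq_zero_of_norm_le N (fun k => c (k + 1)) C (fun τ hτ => by
      have := h τ hτ
      rw [hsum, h0, add_zero, norm_mul, Complex.norm_real, Real.norm_of_nonneg hτ.le,
        pow_succ'] at this
      have h2 : τ * ‖∑ k ∈ Finset.range N, c (k + 1) * (τ : ℂ) ^ k‖ ≤ τ * (C * τ ^ N) := by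
        linarith
      exact le_of_mul_le_mul_left h2 hτ)
    intro k hk
    rcases k with _ | k
    · exact h0
    · exact h1 k (by omega)

/-- The constant in the Gaussian moment of order `p`. -/
def gaussMoment (p : ℕ) : ℝ :=
  Real.pi ^ (-((p : ℝ) + 1) / 2) * (1 / 2) * Real.Gamma (((p : ℝ) + 1) / 2)

lemma gaussMoment_pos (p : ℕ) : 0 < gaussMoment p := by
  unfold gaussMoment
  have := Real.Gamma_pos_of_pos (s := ((p : ℝ) + 1) / 2) (by positivity)
  have := Real.pi_pos
  positivity

lemma gaussMoment_integrable (p : ℕ) {t : ℝ} (ht : 0 < t) :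
    IntegrableOn (fun r : ℝ => r ^ p * Real.exp (-(Real.pi * r ^ 2 * t))) (Set.Ioi 0) := by
  have h := integrableOn_rpow_mul_exp_neg_mul_sq (b := Real.pi * t) (by positivity)
    (s := p) (by have : (0 : ℝ) ≤ p := Nat.cast_nonneg p
                 linarith)
  refine h.congr_fun (fun r _ => ?_) measurableSet_Ioi
  simp only [Real.rpow_natCast]
  congr 2
  ring

lemma gaussMoment_integral (p : ℕ) {τ : ℝ} (hτ : 0 < τ) :
    ∫ r in Set.Ioi (0 : ℝ), r ^ p * Real.exp (-(Real.pi * r ^ 2 * (τ ^ 2)⁻¹))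
      = gaussMoment p * τ ^ (p + 1) := by
  have h := integral_rpow_mul_exp_neg_mul_rpow (p := 2) (q := p) (b := Real.pi * (τ ^ 2)⁻¹)
    (by norm_num) (by have : (0 : ℝ) ≤ p := Nat.cast_nonneg p
                      linarith) (by positivity)
  have e : ∀ r : ℝ, r ^ p * Real.exp (-(Real.pi * r ^ 2 * (τ ^ 2)⁻¹))
      = r ^ (p : ℝ) * Real.exp (-(Real.pi * (τ ^ 2)⁻¹) * r ^ (2 : ℝ)) := by
    intro r
    rw [Real.rpow_natCast, Real.rpow_two]
    congr 2
    ring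
  simp only [e]
  rw [h, Real.mul_rpow Real.pi_pos.le (by positivity), ← Real.rpow_natCast τ 2,
    ← Real.rpow_neg hτ.le, ← Real.rpow_mul hτ.le, ← Real.rpow_natCast τ (p + 1), gaussMoment]
  have : (-((2 : ℕ) : ℝ) * (-((p : ℝ) + 1) / 2)) = ((p + 1 : ℕ) : ℝ) := by push_cast; ring
  rw [this]
  ring

/-- The Taylor remainder of order `N` at `0`. -/
def taylorRem (N : ℕ) (h : ℝ → ℂ) (r : ℝ) : ℂ :=
  h r - ∑ k ∈ Finset.range N, iteratedDeriv k h 0 / (k.factorial : ℂ) * (r : ℂ) ^ k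

lemma continuous_taylorRem {N : ℕ} {h : ℝ → ℂ} (hh : BddSmooth h) :
    Continuous (taylorRem N h) := by
  have := hh.smooth.continuous
  unfold taylorRem
  fun_prop

lemma norm_taylorRem_le {N : ℕ} {h : ℝ → ℂ} (hh : BddSmooth h) :
    ∃ C, 0 ≤ C ∧ ∀ r : ℝ, 0 < r → ‖taylorRem N h r‖ ≤ C * r ^ N := by
  obtain ⟨C, hC⟩ := hh.bdd N
  have hC0 : 0 ≤ C := (norm_nonneg _).trans (hC 0)
  refine ⟨C, hC0, fun r hr => ?_⟩
  rcases N with _ | N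
  · have := hC r
    rw [norm_iteratedFDeriv_zero] at this
    simpa [taylorRem] using this
  · rw [taylorRem, taylor_remainder_scaled hh.smooth N hr, norm_mul, norm_pow, Complex.norm_real,
      Real.norm_of_nonneg hr.le, mul_comm]
    gcongr
    refine (norm_setIntegral_le_of_norm_le_const (C := C) (by simp) fun t ht => ?_).trans
      (by simp)
    rw [norm_mul, Complex.norm_real, ← norm_iteratedFDeriv_eq_norm_iteratedDeriv]
    have h1 : ‖(1 - t) ^ N / (N.factorial : ℝ)‖ ≤ 1 := by
      have : 0 ≤ 1 - t := by linarith [ht.2]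
      rw [Real.norm_of_nonneg (by positivity), div_le_one (by positivity)]
      refine (pow_le_one₀ this (by linarith [ht.1])).trans ?_
      exact_mod_cast Nat.succ_le_of_lt N.factorial_pos
    calc _ ≤ 1 * C := by gcongr; exact hC _
      _ = C := one_mul C

lemma norm_taylorRem_le' {N : ℕ} {h : ℝ → ℂ} (hh : BddSmooth h)
    (h0 : iteratedDeriv (N + 1) h 0 = 0) :
    ∃ C, 0 ≤ C ∧ ∀ r : ℝ, 1 ≤ r → ‖taylorRem (N + 2) h r‖ ≤ C * r ^ N := by
  obtain ⟨C, hC⟩ := hh.bdd 0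
  have hC0 : 0 ≤ C := (norm_nonneg _).trans (hC 0)
  refine ⟨C + ∑ k ∈ Finset.range (N + 1), ‖iteratedDeriv k h 0 / (k.factorial : ℂ)‖,
    by positivity, fun r hr => ?_⟩
  rw [taylorRem, Finset.sum_range_succ, h0, zero_div, zero_mul, add_zero, add_mul, Finset.sum_mul]
  refine (norm_sub_le _ _).trans (add_le_add ?_ ((norm_sum_le _ _).trans
    (Finset.sum_le_sum fun k hk => ?_)))
  · have := hC r
    rw [norm_iteratedFDeriv_zero] at this
    exact this.trans (le_mul_of_one_le_right hC0 (one_le_pow₀ hr))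
  · rw [norm_mul, norm_pow, Complex.norm_real, Real.norm_of_nonneg (by linarith)]
    gcongr
    exact Nat.lt_succ_iff.1 (Finset.mem_range.1 hk)

lemma integrableOn_taylorRem {N : ℕ} {h : ℝ → ℂ} (hh : BddSmooth h)
    (h0 : iteratedDeriv (N + 1) h 0 = 0) :
    IntegrableOn (fun r : ℝ => ((r : ℂ) ^ (N + 2))⁻¹ * taylorRem (N + 2) h r) (Set.Ioi 0) := by
  have hm : Measurable fun r : ℝ => ((r : ℂ) ^ (N + 2))⁻¹ * taylorRem (N + 2) h r :=
    (Continuous.measurable (by fun_prop)).inv.mul (continuous_taylorRem hh).measurable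
  rw [← Set.Ioc_union_Ioi_eq_Ioi zero_le_one, integrableOn_union]
  constructor
  · obtain ⟨C, -, hC⟩ := norm_taylorRem_le (N := N + 2) hh
    refine Measure.integrableOn_of_bounded (M := C) (by simp) hm.aestronglyMeasurable ?_
    filter_upwards [ae_restrict_mem measurableSet_Ioc] with r hr
    rw [norm_mul, norm_inv, norm_pow, Complex.norm_real, Real.norm_of_nonneg hr.1.le,
      inv_mul_le_iff₀ (pow_pos hr.1 _), mul_comm]
    exact hC r hr.1
  · obtain ⟨C, -, hC⟩ := norm_taylorRem_le' hh h0
    have hi := (integrableOn_Ioi_rpow_of_lt (a := -2) (by norm_num) one_pos).const_mul C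
    refine hi.mono' hm.aestronglyMeasurable ?_
    filter_upwards [ae_restrict_mem measurableSet_Ioi] with r hr
    have hr1 : (1 : ℝ) < r := hr
    have hr0 : (0 : ℝ) < r := by linarith
    rw [norm_mul, norm_inv, norm_pow, Complex.norm_real, Real.norm_of_nonneg hr0.le,
      inv_mul_le_iff₀ (pow_pos hr0 _)]
    refine (hC r hr1.le).trans (le_of_eq ?_)
    rw [Real.rpow_neg hr0.le, Real.rpow_two]
    field_simp
    ring

/-- If the logarithmic term is absent, the finite part of `r^{-N}` is the integral of the Taylor
remainder. -/
lemma finitePart_eq_integral_taylorRem {N : ℕ} {h : ℝ → ℂ} (hh : BddSmooth h)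
    (h0 : iteratedDeriv (N + 1) h 0 = 0) :
    finitePart (-((N + 2 : ℕ) : ℂ)) h
      = ∫ r in Set.Ioi (0 : ℝ), ((r : ℂ) ^ (N + 2))⁻¹ * taylorRem (N + 2) h r := by
  have hint := integrableOn_taylorRem hh h0
  have hint' := hint
  rw [← Set.Ioc_union_Ioi_eq_Ioi zero_le_one, integrableOn_union] at hint'
  rw [finitePart_neg_nat, ← Set.Ioc_union_Ioi_eq_Ioi zero_le_one,
    setIntegral_union (by simp) measurableSet_Ioi hint'.1 hint'.2, add_assoc]
  congr 1
  have hk : ∀ k ∈ Finset.range (N + 1), IntegrableOn (fun r : ℝ =>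
      iteratedDeriv k h 0 / (k.factorial : ℂ) * (r : ℂ) ^ ((k : ℂ) - (N + 2))) (Set.Ioi 1) ∧
      ∫ r in Set.Ioi (1 : ℝ), iteratedDeriv k h 0 / (k.factorial : ℂ) *
        (r : ℂ) ^ ((k : ℂ) - (N + 2)) = -(if (-((N + 2 : ℕ) : ℂ)) + k + 1 = 0 then 0
          else iteratedDeriv k h 0 / (k.factorial : ℂ) / (-((N + 2 : ℕ) : ℂ) + k + 1)) := by
    intro k hk
    have hkN : (k : ℝ) ≤ N := by
      exact_mod_cast Nat.lt_succ_iff.1 (Finset.mem_range.1 hk)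
    have hre : ((k : ℂ) - (N + 2)).re < -1 := by
      simp
      linarith
    refine ⟨(integrableOn_Ioi_cpow_of_lt hre one_pos).const_mul _, ?_⟩
    rw [integral_const_mul, integral_Ioi_cpow_of_lt hre one_pos]
    have hne : (-((N + 2 : ℕ) : ℂ)) + k + 1 ≠ 0 := by
      intro h
      have := congrArg Complex.re h
      simp at this
      linarith
    have e : (k : ℂ) - (N + 2) + 1 = -((N + 2 : ℕ) : ℂ) + k + 1 := by push_cast; ring
    rw [if_neg hne, e]
    simp
    ring
  have hsum : IntegrableOn (fun r : ℝ => ∑ k ∈ Finset.range (N + 1),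
      iteratedDeriv k h 0 / (k.factorial : ℂ) * (r : ℂ) ^ ((k : ℂ) - (N + 2))) (Set.Ioi 1) :=
    integrable_finsetSum _ fun k hk' => (hk k hk').1
  have heq : Set.EqOn (fun r : ℝ => ((r : ℂ) ^ (N + 2))⁻¹ * h r)
      (fun r : ℝ => ((r : ℂ) ^ (N + 2))⁻¹ * taylorRem (N + 2) h r + ∑ k ∈ Finset.range (N + 1),
      iteratedDeriv k h 0 / (k.factorial : ℂ) * (r : ℂ) ^ ((k : ℂ) - (N + 2))) (Set.Ioi 1) := by
    intro r hr
    have hr0 : (r : ℂ) ≠ 0 := by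
      have : (1 : ℝ) < r := hr
      exact_mod_cast (by linarith : (0 : ℝ) < r).ne'
    simp only
    rw [taylorRem, Finset.sum_range_succ, h0, zero_div, zero_mul, add_zero, mul_sub,
      Finset.mul_sum, ← sub_eq_zero]
    have : ∀ k ∈ Finset.range (N + 1), iteratedDeriv k h 0 / (k.factorial : ℂ) *
        (r : ℂ) ^ ((k : ℂ) - (N + 2)) = ((r : ℂ) ^ (N + 2))⁻¹ *
          (iteratedDeriv k h 0 / (k.factorial : ℂ) * (r : ℂ) ^ k) := by
      intro k _
      have e : (k : ℂ) - (N + 2) = (k : ℂ) - ((N + 2 : ℕ) : ℂ) := by push_cast; ring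
      rw [e, Complex.cpow_sub _ _ hr0, Complex.cpow_natCast, Complex.cpow_natCast]
      ring
    rw [Finset.sum_congr rfl this]
    ring
  rw [setIntegral_congr_fun measurableSet_Ioi heq, integral_add hint'.2 hsum,
    integral_finsetSum _ (fun k hk' => (hk k hk').1), Finset.sum_range_succ _ (N + 1),
    Finset.sum_congr rfl (fun k hk' => (hk k hk').2), h0]
  simp

section FinitePart

variable {Z : Type*} [MeasurableSpace Z] {ν : Measure Z} {σ : Z → ℝ} {A : Z → ℂ} {h : ℝ → ℂ}

lemma integrable_exp_smul (hσ : Measurable σ) (hσ0 : ∀ᵐ z ∂ν, 0 < σ z) (hA : Integrable A ν)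
    {x : ℝ} (hx : 0 ≤ x) : Integrable (fun z => Real.exp (-(σ z * x)) • A z) ν := by
  have hm : Measurable fun z => Real.exp (-(σ z * x)) := (hσ.mul_const x).neg.exp
  refine hA.norm.mono' (hm.aestronglyMeasurable.smul hA.aestronglyMeasurable) ?_
  filter_upwards [hσ0] with z hz
  rw [norm_smul, Real.norm_of_nonneg (Real.exp_pos _).le]
  refine mul_le_of_le_one_left (norm_nonneg _) ?_
  rw [Real.exp_le_one_iff]
  have := mul_nonneg hz.le hx
  linarith

/-- The Laplace transform of `A` with the Taylor remainder of the exponential function. -/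
lemma integral_expRem_eq {n : ℕ} (hσ : Measurable σ) (hσ0 : ∀ᵐ z ∂ν, 0 < σ z)
    (hA : ∀ k ≤ n, Integrable (fun z => σ z ^ k • A z) ν) {x : ℝ} (hx : 0 ≤ x) :
    Integrable (fun z => expRem n (σ z * x) • A z) ν ∧
    ∫ z, expRem n (σ z * x) • A z ∂ν = ∫ z, Real.exp (-(σ z * x)) • A z ∂ν
      - ∑ l ∈ Finset.range n, ((-x) ^ l / (l.factorial : ℝ)) • ∫ z, σ z ^ l • A z ∂ν := by
  have hA0 : Integrable A ν := by simpa using hA 0 (Nat.zero_le _)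
  have hl : ∀ l ∈ Finset.range n,
      Integrable (fun z => ((-x) ^ l / (l.factorial : ℝ)) • (σ z ^ l • A z)) ν := fun l hl =>
    (hA l (Finset.mem_range.1 hl).le).smul ((-x) ^ l / (l.factorial : ℝ))
  have e : ∀ z, expRem n (σ z * x) • A z = Real.exp (-(σ z * x)) • A z
      - ∑ l ∈ Finset.range n, ((-x) ^ l / (l.factorial : ℝ)) • (σ z ^ l • A z) := by
    intro z
    rw [expRem, sub_smul, Finset.sum_smul]
    congr 1
    refine Finset.sum_congr rfl fun l _ => ?_
    rw [smul_smul]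
    congr 1
    rw [← mul_neg, mul_pow]
    ring
  have hE := integrable_exp_smul hσ hσ0 hA0 hx
  simp only [e]
  refine ⟨hE.sub (integrable_finsetSum _ hl), ?_⟩
  rw [integral_sub hE (integrable_finsetSum _ hl), integral_finsetSum _ hl]
  congr 1
  exact Finset.sum_congr rfl fun l _ => integral_smul _ _

lemma norm_integral_expRem_le {n : ℕ} (hσ0 : ∀ᵐ z ∂ν, 0 < σ z)
    (hA : Integrable (fun z => σ z ^ n • A z) ν) {x : ℝ} (hx : 0 ≤ x) :
    ‖∫ z, expRem n (σ z * x) • A z ∂ν‖ ≤ (∫ z, ‖σ z ^ n • A z‖ ∂ν) * x ^ n := by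
  rw [← integral_mul_const]
  refine norm_integral_le_of_norm_le (hA.norm.mul_const _) ?_
  filter_upwards [hσ0] with z hz
  rw [norm_smul, norm_smul, norm_pow, Real.norm_of_nonneg hz.le]
  calc _ ≤ (σ z * x) ^ n * ‖A z‖ := by
        gcongr
        exact abs_expRem_le' n (by positivity)
    _ = _ := by rw [mul_pow]; ring

/-- The Gaussian integrals of `h` and of its Taylor polynomial. -/
lemma integral_gauss_taylorRem (hh : BddSmooth h) (d N : ℕ) {τ : ℝ} (hτ : 0 < τ) :
    IntegrableOn (fun r : ℝ => (r ^ d * Real.exp (-(Real.pi * r ^ 2 * (τ ^ 2)⁻¹))) •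
      taylorRem N h r) (Set.Ioi 0) ∧
    ∫ r in Set.Ioi (0 : ℝ), (r ^ d * Real.exp (-(Real.pi * r ^ 2 * (τ ^ 2)⁻¹))) • taylorRem N h r
      = (∫ r in Set.Ioi (0 : ℝ), (r ^ d * Real.exp (-(Real.pi * r ^ 2 * (τ ^ 2)⁻¹))) • h r)
        - ∑ k ∈ Finset.range N, iteratedDeriv k h 0 / (k.factorial : ℂ) *
            ((gaussMoment (d + k) * τ ^ (d + k + 1) : ℝ) : ℂ) := by
  have ht : 0 < (τ ^ 2)⁻¹ := by positivity
  have hI : IntegrableOn (fun r : ℝ => (r ^ d * Real.exp (-(Real.pi * r ^ 2 * (τ ^ 2)⁻¹))) • h r)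
      (Set.Ioi 0) := by
    obtain ⟨C, hC⟩ := hh.bdd 0
    have := hh.smooth.continuous
    refine ((gaussMoment_integrable d ht).mul_const C).mono'
      (Continuous.aestronglyMeasurable (by fun_prop)) ?_
    filter_upwards [ae_restrict_mem measurableSet_Ioi] with r hr
    have hr : (0 : ℝ) < r := hr
    have h2 := hC r
    rw [norm_iteratedFDeriv_zero] at h2
    rw [norm_smul, Real.norm_of_nonneg (by positivity)]
    gcongr
  have hk : ∀ k ∈ Finset.range N, IntegrableOn (fun r : ℝ =>
      iteratedDeriv k h 0 / (k.factorial : ℂ) *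
      ((r ^ (d + k) * Real.exp (-(Real.pi * r ^ 2 * (τ ^ 2)⁻¹)) : ℝ) : ℂ)) (Set.Ioi 0) :=
    fun k _ => (gaussMoment_integrable (d + k) ht).ofReal.const_mul _
  have e : ∀ r : ℝ, (r ^ d * Real.exp (-(Real.pi * r ^ 2 * (τ ^ 2)⁻¹))) • taylorRem N h r
      = (r ^ d * Real.exp (-(Real.pi * r ^ 2 * (τ ^ 2)⁻¹))) • h r
      - ∑ k ∈ Finset.range N, iteratedDeriv k h 0 / (k.factorial : ℂ) *
      ((r ^ (d + k) * Real.exp (-(Real.pi * r ^ 2 * (τ ^ 2)⁻¹)) : ℝ) : ℂ) := by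
    intro r
    rw [taylorRem, smul_sub, Finset.smul_sum]
    congr 1
    refine Finset.sum_congr rfl fun k _ => ?_
    rw [Complex.real_smul, pow_add]
    push_cast
    ring
  simp only [e]
  refine ⟨hI.sub (integrable_finsetSum _ hk), ?_⟩
  rw [integral_sub hI (integrable_finsetSum _ hk), integral_finsetSum _ hk]
  congr 1
  refine Finset.sum_congr rfl fun k _ => ?_
  rw [integral_const_mul, ← gaussMoment_integral _ hτ]
  congr 1
  exact integral_ofReal

lemma norm_integral_gauss_taylorRem_le (hh : BddSmooth h) (d N : ℕ) :
    ∃ C, ∀ τ : ℝ, 0 < τ → ‖∫ r in Set.Ioi (0 : ℝ),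
      (r ^ d * Real.exp (-(Real.pi * r ^ 2 * (τ ^ 2)⁻¹))) • taylorRem N h r‖
        ≤ C * τ ^ (d + N + 1) := by
  obtain ⟨C, -, hC⟩ := norm_taylorRem_le (N := N) hh
  refine ⟨C * gaussMoment (d + N), fun τ hτ => ?_⟩
  rw [mul_assoc, ← gaussMoment_integral _ hτ, ← integral_const_mul]
  refine norm_integral_le_of_norm_le
    ((gaussMoment_integrable (d + N) (by positivity)).const_mul C) ?_
  filter_upwards [ae_restrict_mem measurableSet_Ioi] with r hr
  have hr : (0 : ℝ) < r := hr
  rw [norm_smul, Real.norm_of_nonneg (by positivity)]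
  calc _ ≤ (r ^ d * Real.exp (-(Real.pi * r ^ 2 * (τ ^ 2)⁻¹))) * (C * r ^ N) := by
        gcongr
        exact hC r hr
    _ = _ := by rw [pow_add]; ring

lemma sum_range_parity (n ε : ℕ) (f : ℕ → ℂ) :
    ∑ k ∈ Finset.range (2 * n + ε), (if ε ≤ k ∧ Even (k - ε) then f ((k - ε) / 2) else 0)
      = ∑ l ∈ Finset.range n, f l := by
  induction n with
  | zero =>
    simp only [mul_zero, zero_add, Finset.range_zero, Finset.sum_empty]
    refine Finset.sum_eq_zero fun k hk => if_neg fun hc => ?_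
    have := Finset.mem_range.1 hk
    omega
  | succ n ih =>
    have : 2 * (n + 1) + ε = (2 * n + ε) + 1 + 1 := by ring
    rw [this, Finset.sum_range_succ, Finset.sum_range_succ, ih, Finset.sum_range_succ]
    rw [if_pos ⟨by omega, ⟨n, by omega⟩⟩, if_neg (by
      rintro ⟨-, c, hc⟩
      omega), add_zero]
    congr 2
    omega

/-- Matching the asymptotic expansions of both sides of an identity between a Gaussian transform
and a Laplace transform. -/
lemma taylor_match (hh : BddSmooth h) {n ε d : ℕ} (hn : 0 < n)
    (hσ : Measurable σ) (hσ0 : ∀ᵐ z ∂ν, 0 < σ z)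
    (hA : ∀ k ≤ n, Integrable (fun z => σ z ^ k • A z) ν)
    (hG : ∀ τ : ℝ, 0 < τ →
      ∫ r in Set.Ioi (0 : ℝ), (r ^ d * Real.exp (-(Real.pi * r ^ 2 * (τ ^ 2)⁻¹))) • h r
      = ((τ ^ (d + 1 + ε) : ℝ) : ℂ) * ∫ z, Real.exp (-(σ z * τ ^ 2)) • A z ∂ν) :
    iteratedDeriv (2 * n + ε - 1) h 0 = 0 ∧ ∀ τ : ℝ, 0 < τ →
      ∫ r in Set.Ioi (0 : ℝ), (r ^ d * Real.exp (-(Real.pi * r ^ 2 * (τ ^ 2)⁻¹))) •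
        taylorRem (2 * n + ε) h r
      = ((τ ^ (d + 1 + ε) : ℝ) : ℂ) * ∫ z, expRem n (σ z * τ ^ 2) • A z ∂ν := by
  set a : ℕ → ℂ := fun l => (((-1) ^ l / (l.factorial : ℝ) : ℝ) : ℂ) * ∫ z, σ z ^ l • A z ∂ν
  set b : ℕ → ℂ := fun k => iteratedDeriv k h 0 / (k.factorial : ℂ) *
    ((gaussMoment (d + k) : ℝ) : ℂ)
  set c : ℕ → ℂ := fun k => b k - (if ε ≤ k ∧ Even (k - ε) then a ((k - ε) / 2) else 0)
  have hdiff : ∀ τ : ℝ, 0 < τ → ((τ ^ (d + 1 + ε) : ℝ) : ℂ) * ∫ z, expRem n (σ z * τ ^ 2) • A z ∂ν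
      - ∫ r in Set.Ioi (0 : ℝ), (r ^ d * Real.exp (-(Real.pi * r ^ 2 * (τ ^ 2)⁻¹))) •
        taylorRem (2 * n + ε) h r
      = (τ : ℂ) ^ (d + 1) * ∑ k ∈ Finset.range (2 * n + ε), c k * (τ : ℂ) ^ k := by
    intro τ hτ
    have hpar : ∀ k, (if ε ≤ k ∧ Even (k - ε) then a ((k - ε) / 2) else 0) * (τ : ℂ) ^ k
        = if ε ≤ k ∧ Even (k - ε) then (fun l => a l * (τ : ℂ) ^ (2 * l + ε)) ((k - ε) / 2)
          else 0 := by
      intro k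
      split_ifs with hk
      · obtain ⟨h1, u, hu⟩ := hk
        simp only
        congr 2
        omega
      · simp
    rw [(integral_expRem_eq hσ hσ0 hA (sq_nonneg τ)).2, (integral_gauss_taylorRem hh d _ hτ).2,
      hG τ hτ]
    simp only [c, sub_mul, Finset.sum_sub_distrib, hpar]
    rw [sum_range_parity n ε (fun l => a l * (τ : ℂ) ^ (2 * l + ε)), mul_sub, mul_sub,
      Finset.mul_sum, Finset.mul_sum, Finset.mul_sum]
    have e1 : ∀ l, ((τ ^ (d + 1 + ε) : ℝ) : ℂ) * (((-(τ ^ 2)) ^ l / (l.factorial : ℝ)) •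
        ∫ z, σ z ^ l • A z ∂ν) = (τ : ℂ) ^ (d + 1) * (a l * (τ : ℂ) ^ (2 * l + ε)) := by
      intro l
      simp only [a, Complex.real_smul]
      rw [neg_pow]
      push_cast
      ring
    have e2 : ∀ k, iteratedDeriv k h 0 / (k.factorial : ℂ) *
        ((gaussMoment (d + k) * τ ^ (d + k + 1) : ℝ) : ℂ)
        = (τ : ℂ) ^ (d + 1) * (b k * (τ : ℂ) ^ k) := by
      intro k
      simp only [b]
      push_cast
      ring
    simp only [e1, e2]
    ring
  obtain ⟨C, hC⟩ := norm_integral_gauss_taylorRem_le hh d (2 * n + ε)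
  have hc := coeff_eq_zero_of_norm_le (2 * n + ε) c ((∫ z, ‖σ z ^ n • A z‖ ∂ν) + C)
    fun τ hτ => by
      have h1 := norm_sub_le (((τ ^ (d + 1 + ε) : ℝ) : ℂ) * ∫ z, expRem n (σ z * τ ^ 2) • A z ∂ν)
        (∫ r in Set.Ioi (0 : ℝ), (r ^ d * Real.exp (-(Real.pi * r ^ 2 * (τ ^ 2)⁻¹))) •
          taylorRem (2 * n + ε) h r)
      rw [hdiff τ hτ, norm_mul, norm_pow, norm_mul, Complex.norm_real, Complex.norm_real,
        Real.norm_of_nonneg hτ.le, Real.norm_of_nonneg (by positivity)] at h1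
      have h2 := norm_integral_expRem_le hσ0 (hA n le_rfl) (sq_nonneg τ)
      have h3 := hC τ hτ
      have h4 : τ ^ (d + 1) * ‖∑ k ∈ Finset.range (2 * n + ε), c k * (τ : ℂ) ^ k‖
          ≤ τ ^ (d + 1) * (((∫ z, ‖σ z ^ n • A z‖ ∂ν) + C) * τ ^ (2 * n + ε)) := by
        refine h1.trans ?_
        calc _ ≤ τ ^ (d + 1 + ε) * ((∫ z, ‖σ z ^ n • A z‖ ∂ν) * (τ ^ 2) ^ n)
              + C * τ ^ (d + (2 * n + ε) + 1) := by gcongr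
          _ = _ := by ring
      exact le_of_mul_le_mul_left h4 (by positivity)
  constructor
  · have h1 := hc (2 * n + ε - 1) (by omega)
    have h2 : ¬ (ε ≤ 2 * n + ε - 1 ∧ Even (2 * n + ε - 1 - ε)) := by
      rintro ⟨-, u, hu⟩
      omega
    simp only [c, if_neg h2, sub_zero, b] at h1
    have h3 : ((gaussMoment (d + (2 * n + ε - 1)) : ℝ) : ℂ) ≠ 0 :=
      Complex.ofReal_ne_zero.2 (gaussMoment_pos _).ne'
    have h4 : (((2 * n + ε - 1).factorial : ℕ) : ℂ) ≠ 0 :=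
      Nat.cast_ne_zero.2 (Nat.factorial_ne_zero _)
    rcases mul_eq_zero.1 h1 with h5 | h5
    · exact (div_eq_zero_iff.1 h5).resolve_right h4
    · exact absurd h5 h3
  · intro τ hτ
    have h1 := hdiff τ hτ
    rw [Finset.sum_eq_zero fun k hk => by rw [hc k (Finset.mem_range.1 hk), zero_mul],
      mul_zero] at h1
    exact (sub_eq_zero.1 h1).symm

variable [SFinite ν]

/-- The Mellin transform of an identity between a Gaussian transform and a Laplace transform
evaluates a finite part. -/
theorem finitePart_of_gauss (hh : BddSmooth h) {n ε d : ℕ} (hn : 0 < n)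
    (hσ : Measurable σ) (hσ0 : ∀ᵐ z ∂ν, 0 < σ z)
    (hA : ∀ k ≤ n, Integrable (fun z => σ z ^ k • A z) ν) {s α b : ℝ}
    (hs : s = ((d : ℝ) + 1 + ε) / 2) (hα : α = (n : ℝ) - 1 / 2) (hb : b = s + α)
    (hG : ∀ t : ℝ, 0 < t →
      ∫ r in Set.Ioi (0 : ℝ), (r ^ d * Real.exp (-(Real.pi * r ^ 2 * t))) • h r
      = t ^ (-s) • ∫ z, Real.exp (-(σ z / t)) • A z ∂ν) :
    (Real.Gamma b * Real.pi ^ (-b)) • finitePart (-((2 * n + ε : ℕ) : ℂ)) h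
      = Real.Gamma (-α) • ∫ z, (σ z ^ α) • A z ∂ν := by
  have hn1 : (1 : ℝ) ≤ n := by exact_mod_cast hn
  have hα0 : 0 < α := by linarith
  have hs0 : 0 < s := by rw [hs]; positivity
  have hb0 : 0 < b := by linarith
  have hroot : ∀ t : ℝ, 0 < t → ∃ τ : ℝ, 0 < τ ∧ t = (τ ^ 2)⁻¹ ∧ t ^ (-s) = τ ^ (d + 1 + ε)
      ∧ t⁻¹ = τ ^ 2 := by
    intro t ht
    have h1 : t = ((t ^ (-(1 / 2) : ℝ)) ^ 2)⁻¹ := by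
      rw [← Real.rpow_natCast, ← Real.rpow_mul ht.le, ← Real.rpow_neg ht.le]
      norm_num
    refine ⟨t ^ (-(1 / 2) : ℝ), Real.rpow_pos_of_pos ht _, h1, ?_, ?_⟩
    · rw [← Real.rpow_natCast, ← Real.rpow_mul ht.le, hs]
      congr 1
      push_cast
      ring
    · conv_lhs => rw [h1]
      rw [inv_inv]
  have hsq : ∀ τ : ℝ, 0 < τ → ((τ ^ 2)⁻¹) ^ (-s) = τ ^ (d + 1 + ε) := by
    intro τ hτ
    rw [← Real.rpow_natCast τ 2, ← Real.rpow_neg hτ.le, ← Real.rpow_mul hτ.le,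
      ← Real.rpow_natCast, hs]
    congr 1
    push_cast
    ring
  obtain ⟨h0, hrem⟩ := taylor_match (σ := σ) (A := A) hh (ε := ε) (d := d) hn hσ hσ0 hA
    (fun τ hτ => by
      rw [hG _ (by positivity), hsq τ hτ, Complex.real_smul]
      simp only [div_inv_eq_mul])
  obtain ⟨N, hN⟩ : ∃ N, 2 * n + ε = N + 2 := ⟨2 * n + ε - 2, by omega⟩
  have h0' : iteratedDeriv (N + 1) h 0 = 0 := by
    rw [← h0]
    congr 1
    omega
  rw [hN] at hrem ⊢
  have hbN : (N : ℝ) + 2 = 2 * n + ε := by exact_mod_cast hN.symm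
  have hint := integrableOn_taylorRem hh h0'
  rw [finitePart_eq_integral_taylorRem hh h0']
  have hrem' : ∀ t : ℝ, 0 < t → ∫ r in Set.Ioi (0 : ℝ),
      (r ^ d * Real.exp (-(Real.pi * r ^ 2 * t))) • taylorRem (N + 2) h r
      = t ^ (-s) • ∫ z, expRem n (σ z / t) • A z ∂ν := by
    intro t ht
    obtain ⟨τ, hτ, e1, e2, e3⟩ := hroot t ht
    rw [e2, Complex.real_smul]
    simp only [div_eq_mul_inv, e3]
    rw [e1]
    exact hrem τ hτ
  set τ : Measure ℝ := volume.restrict (Set.Ioi 0)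
  have hpos : ∀ᵐ t ∂τ, (0 : ℝ) < t := ae_restrict_mem measurableSet_Ioi
  -- the side of `h`
  have hval1 : ∀ r : ℝ, 0 < r → ∫ t, t ^ (b - 1) * (r ^ d * Real.exp (-(Real.pi * r ^ 2 * t))) ∂τ
      = Real.Gamma b * Real.pi ^ (-b) * (r ^ (N + 2))⁻¹ := by
    intro r hr
    have e : ∀ t : ℝ, t ^ (b - 1) * (r ^ d * Real.exp (-(Real.pi * r ^ 2 * t)))
        = r ^ d * (t ^ (b - 1) * Real.exp (-(Real.pi * r ^ 2 * t))) := fun t => by ring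
    simp only [e]
    rw [integral_const_mul, Real.integral_rpow_mul_exp_neg_mul_Ioi hb0 (by positivity),
      one_div, Real.inv_rpow (by positivity), ← Real.rpow_neg (by positivity),
      Real.mul_rpow Real.pi_pos.le (by positivity), ← Real.rpow_natCast r 2, ← Real.rpow_mul hr.le,
      ← Real.rpow_natCast r d, ← Real.rpow_natCast r (N + 2), ← Real.rpow_neg hr.le]
    have : -((N + 2 : ℕ) : ℝ) = d + (2 : ℕ) * -b := by
      push_cast
      rw [hbN, hb, hs, hα]
      ring
    rw [this, Real.rpow_add hr]
    ring
  have hint1 : ∀ r : ℝ, 0 < r →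
      Integrable (fun t => t ^ (b - 1) * (r ^ d * Real.exp (-(Real.pi * r ^ 2 * t)))) τ := by
    intro r hr
    by_contra hc
    have h1 := hval1 r hr
    rw [integral_undef hc] at h1
    have := Real.Gamma_pos_of_pos hb0
    have := Real.pi_pos
    have h2 : 0 < Real.Gamma b * Real.pi ^ (-b) * (r ^ (N + 2))⁻¹ := by positivity
    exact h2.ne h1
  have hF1m : AEStronglyMeasurable (fun q : ℝ × ℝ => (q.2 ^ (b - 1) *
      (q.1 ^ d * Real.exp (-(Real.pi * q.1 ^ 2 * q.2)))) • taylorRem (N + 2) h q.1) (τ.prod τ) := by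
    have hm : Measurable fun q : ℝ × ℝ =>
        q.2 ^ (b - 1) * (q.1 ^ d * Real.exp (-(Real.pi * q.1 ^ 2 * q.2))) :=
      (measurable_snd.pow_const _).mul (Continuous.measurable (by fun_prop))
    exact hm.aestronglyMeasurable.smul
      ((continuous_taylorRem hh).comp continuous_fst).aestronglyMeasurable
  have hF1 : Integrable (fun q : ℝ × ℝ => (q.2 ^ (b - 1) *
      (q.1 ^ d * Real.exp (-(Real.pi * q.1 ^ 2 * q.2)))) • taylorRem (N + 2) h q.1) (τ.prod τ) := by
    rw [integrable_prod_iff hF1m]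
    constructor
    · filter_upwards [hpos] with r hr
      exact (hint1 r hr).smul_const _
    · refine (hint.norm.const_mul (Real.Gamma b * Real.pi ^ (-b))).congr ?_
      filter_upwards [hpos] with r hr
      simp only [norm_smul]
      have : ∀ᵐ t ∂τ, ‖t ^ (b - 1) * (r ^ d * Real.exp (-(Real.pi * r ^ 2 * t)))‖
          * ‖taylorRem (N + 2) h r‖
          = t ^ (b - 1) * (r ^ d * Real.exp (-(Real.pi * r ^ 2 * t)))
            * ‖taylorRem (N + 2) h r‖ := by
        filter_upwards [hpos] with t ht
        rw [Real.norm_of_nonneg (by positivity)]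
      rw [integral_congr_ae this, integral_mul_const, hval1 r hr, norm_mul, norm_inv, norm_pow,
        Complex.norm_real, Real.norm_of_nonneg hr.le]
      ring
  -- the side of `A`
  have hstrip : GammaStrip n (-α) := ⟨by rw [hα]; linarith, Or.inr (by rw [hα]; linarith)⟩
  have hexp : ∀ t : ℝ, 0 < t → t ^ (b - 1) * t ^ (-s) = t ^ (-(-α) - 1) := by
    intro t ht
    rw [← Real.rpow_add ht, hb]
    congr 1
    ring
  have hslice : ∀ z, Set.EqOn (fun t : ℝ => t ^ (b - 1) * t ^ (-s) * expRem n (σ z / t))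
      (fun t : ℝ => t ^ (-(-α) - 1) * expRem n (σ z / t)) (Set.Ioi 0) := by
    intro z t ht
    simp only
    rw [hexp t ht]
  have hval2 : ∀ z, 0 < σ z → ∫ t, t ^ (b - 1) * t ^ (-s) * expRem n (σ z / t) ∂τ
      = σ z ^ α * Real.Gamma (-α) := by
    intro z hz
    rw [setIntegral_congr_fun measurableSet_Ioi (hslice z), integral_expRem_div hstrip hz, neg_neg]
  have hint2 : ∀ z, 0 < σ z →
      Integrable (fun t => t ^ (b - 1) * t ^ (-s) * expRem n (σ z / t)) τ := by
    intro z hz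
    exact (integrableOn_expRem_div hstrip hz).congr_fun (hslice z).symm measurableSet_Ioi
  have hA0 : Integrable A ν := by simpa using hA 0 (Nat.zero_le _)
  have hAα : Integrable (fun z => σ z ^ α • A z) ν := by
    refine (hA0.norm.add (hA n le_rfl).norm).mono'
      ((hσ.pow_const α).aestronglyMeasurable.smul hA0.aestronglyMeasurable) ?_
    filter_upwards [hσ0] with z hz
    simp only [Pi.add_apply]
    rw [norm_smul, norm_smul, norm_pow, Real.norm_of_nonneg hz.le,
      Real.norm_of_nonneg (Real.rpow_nonneg hz.le _)]
    have : σ z ^ α ≤ 1 + σ z ^ n := by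
      rcases le_total (σ z) 1 with h1 | h1
      · have := Real.rpow_le_one hz.le h1 hα0.le
        have : 0 ≤ σ z ^ n := by positivity
        linarith
      · rw [← Real.rpow_natCast]
        have := Real.rpow_le_rpow_of_exponent_le h1 (by linarith : α ≤ n)
        linarith
    calc _ ≤ (1 + σ z ^ n) * ‖A z‖ := by gcongr
      _ = _ := by ring
  have hF2m : AEStronglyMeasurable (fun q : Z × ℝ => (q.2 ^ (b - 1) * q.2 ^ (-s) *
      expRem n (σ q.1 / q.2)) • A q.1) (ν.prod τ) := by
    have hσ1 : Measurable fun q : Z × ℝ => σ q.1 := hσ.comp measurable_fst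
    have hm : Measurable fun q : Z × ℝ => q.2 ^ (b - 1) * q.2 ^ (-s) * expRem n (σ q.1 / q.2) :=
      ((measurable_snd.pow_const _).mul (measurable_snd.pow_const _)).mul
        ((continuous_expRem n).measurable.comp (hσ1.div measurable_snd))
    exact hm.aestronglyMeasurable.smul hA0.aestronglyMeasurable.comp_fst
  set K : ℝ := ∫ v in Set.Ioi (0 : ℝ), v ^ (-α - 1) * |expRem n v|
  have hF2 : Integrable (fun q : Z × ℝ => (q.2 ^ (b - 1) * q.2 ^ (-s) *
      expRem n (σ q.1 / q.2)) • A q.1) (ν.prod τ) := by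
    rw [integrable_prod_iff hF2m]
    constructor
    · filter_upwards [hσ0] with z hz
      exact (hint2 z hz).smul_const _
    · refine (hAα.norm.const_mul K).congr ?_
      filter_upwards [hσ0] with z hz
      simp only [norm_smul]
      have : ∫ t, ‖t ^ (b - 1) * t ^ (-s) * expRem n (σ z / t)‖ ∂τ = σ z ^ α * K := by
        have h1 := integral_abs_expRem_div (n := n) (β := -α) hz
        rw [neg_neg] at h1
        rw [← h1]
        refine setIntegral_congr_fun measurableSet_Ioi fun t ht => ?_
        simp only [Real.norm_eq_abs]
        rw [hexp t ht, neg_neg, abs_mul, abs_of_nonneg (Real.rpow_nonneg (le_of_lt ht) _)]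
      rw [integral_mul_const, this, Real.norm_of_nonneg (Real.rpow_nonneg hz.le _)]
      ring
  calc _ = ∫ r, (∫ t, (t ^ (b - 1) * (r ^ d * Real.exp (-(Real.pi * r ^ 2 * t)))) •
          taylorRem (N + 2) h r ∂τ) ∂τ := by
        rw [← integral_smul]
        refine integral_congr_ae ?_
        filter_upwards [hpos] with r hr
        rw [integral_smul_const, hval1 r hr, Complex.real_smul, Complex.real_smul]
        push_cast
        ring
    _ = ∫ t, (∫ r, (t ^ (b - 1) * (r ^ d * Real.exp (-(Real.pi * r ^ 2 * t)))) •
          taylorRem (N + 2) h r ∂τ) ∂τ := integral_integral_swap hF1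
    _ = ∫ t, (∫ z, (t ^ (b - 1) * t ^ (-s) * expRem n (σ z / t)) • A z ∂ν) ∂τ := by
        refine integral_congr_ae ?_
        filter_upwards [hpos] with t ht
        simp only [mul_smul]
        rw [integral_smul, integral_smul, integral_smul, ← hrem' t ht]
        simp only [mul_smul]
    _ = ∫ z, (∫ t, (t ^ (b - 1) * t ^ (-s) * expRem n (σ z / t)) • A z ∂τ) ∂ν :=
        (integral_integral_swap hF2).symm
    _ = _ := by
        rw [← integral_smul]
        refine integral_congr_ae ?_
        filter_upwards [hσ0] with z hz
        rw [integral_smul_const, hval2 z hz, mul_comm, mul_smul]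

end FinitePart

/-! ### Polar coordinates -/

section Polar

variable {m : ℕ}

lemma polar_coordinates (hm : 0 < m) {f : E m → ℂ} (hf : Integrable f) :
    IntegrableOn (fun r : ℝ => r ^ (m - 1) • ∫ w, f (r • (w : E m)) ∂(surf m)) (Set.Ioi 0) ∧
    ∫ x, f x = ∫ r in Set.Ioi (0 : ℝ), r ^ (m - 1) • ∫ w, f (r • (w : E m)) ∂(surf m) := by
  have : Nonempty (Fin m) := ⟨⟨0, hm⟩⟩
  have hdim : Module.finrank ℝ (E m) = m := by simp
  have hmp := (volume : Measure (E m)).measurePreserving_homeomorphUnitSphereProd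
  rw [hdim] at hmp
  have hemb := (homeomorphUnitSphereProd (E m)).measurableEmbedding
  set G : Sph m × Set.Ioi (0 : ℝ) → ℂ := fun p => f ((p.2 : ℝ) • (p.1 : E m))
  have hG : ∀ x : ({0}ᶜ : Set (E m)), G (homeomorphUnitSphereProd (E m) x) = f x := by
    rintro ⟨x, hx⟩
    have hx0 : x ≠ 0 := hx
    simp only [G, homeomorphUnitSphereProd_apply_snd_coe, homeomorphUnitSphereProd_apply_fst_coe]
    rw [smul_smul, mul_inv_cancel₀ (norm_ne_zero_iff.2 hx0), one_smul]
  have hGi : Integrable G ((surf m).prod (Measure.volumeIoiPow (m - 1))) := by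
    have h := hmp.integrable_comp_emb hemb (g := G)
    refine h.1 ?_
    have h1 : G ∘ (homeomorphUnitSphereProd (E m)) = f ∘ Subtype.val := funext hG
    rw [h1, ← integrableOn_iff_comap_subtypeVal (by measurability)]
    exact hf.integrableOn
  have hres : ∫ x, f x = ∫ r, ∫ w, G (w, r) ∂(surf m) ∂(Measure.volumeIoiPow (m - 1)) := by
    calc ∫ x, f x = ∫ x : ({(0)}ᶜ : Set (E m)), f x.1 ∂(Measure.comap Subtype.val volume) := by
          rw [integral_subtype_comap (measurableSet_singleton _).compl fun x => f x,
            restrict_compl_singleton]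
      _ = ∫ p, G p ∂((surf m).prod (Measure.volumeIoiPow (m - 1))) := by
          exact (integral_congr_ae (Eventually.of_forall fun x => (hG x).symm)).trans
            (hmp.integral_comp hemb G)
      _ = _ := integral_prod_symm _ hGi
  have hmeas : Measurable fun r : Set.Ioi (0 : ℝ) => ((r : ℝ) ^ (m - 1)).toNNReal :=
    (measurable_subtype_coe.pow_const _).real_toNNReal
  constructor
  · have h1 := hGi.integral_prod_right
    simp only [Measure.volumeIoiPow, ENNReal.ofReal] at h1
    rw [integrable_withDensity_iff_integrable_smul hmeas] at h1
    rw [integrableOn_iff_comap_subtypeVal measurableSet_Ioi]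
    refine h1.congr (Eventually.of_forall fun r => ?_)
    simp only [Function.comp, NNReal.smul_def]
    rw [Real.coe_toNNReal _ (pow_nonneg (le_of_lt r.2) _)]
  · rw [hres]
    simp only [Measure.volumeIoiPow, ENNReal.ofReal]
    rw [integral_withDensity_eq_integral_smul hmeas,
      ← integral_subtype_comap measurableSet_Ioi
        fun r : ℝ => r ^ (m - 1) • ∫ w, f (r • (w : E m)) ∂(surf m)]
    refine integral_congr_ae (Eventually.of_forall fun r => ?_)
    simp only [NNReal.smul_def]
    rw [Real.coe_toNNReal _ (pow_nonneg (le_of_lt r.2) _)]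

end Polar

/-! ### Gaussian integrals of Fourier transforms -/

section Fourier

open scoped FourierTransform

variable {m : ℕ}

/-- The polynomials `1` and `x_i`. -/
def coord : Option (Fin m) → E m → ℝ
  | none, _ => 1
  | some i, x => x i

/-- The degree of the polynomials `1` and `x_i`. -/
def coordDeg : Option (Fin m) → ℕ
  | none => 0
  | some _ => 1

/-- The polynomial `1` or `i ξ_i`. -/
def coordI (o : Option (Fin m)) (ξ : E m) : ℂ := Complex.I ^ coordDeg o * coord o ξ

lemma continuous_coord (o : Option (Fin m)) : Continuous (coord o) := by
  cases o with
  | none => exact continuous_const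
  | some i => exact (EuclideanSpace.proj i : E m →L[ℝ] ℝ).continuous

lemma abs_coord_le (o : Option (Fin m)) (x : E m) : |coord o x| ≤ ‖x‖ ^ coordDeg o := by
  cases o with
  | none => simp [coord, coordDeg]
  | some i => simpa [coord, coordDeg] using PiLp.norm_apply_le x i

lemma coord_smul (o : Option (Fin m)) (r : ℝ) (x : E m) :
    coord o (r • x) = r ^ coordDeg o * coord o x := by
  cases o <;> simp [coord, coordDeg]

/-- The Gaussian as a complex function. -/
def gauss (t : ℝ) (x : E m) : ℂ := ((Real.exp (-(Real.pi * ‖x‖ ^ 2 * t)) : ℝ) : ℂ)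

lemma continuous_gauss (t : ℝ) : Continuous (gauss t : E m → ℂ) := by
  unfold gauss; fun_prop

lemma gauss_eq (t : ℝ) :
    (gauss t : E m → ℂ) = fun x : E m => Complex.exp (-((Real.pi * t : ℝ) : ℂ) * ‖x‖ ^ 2) := by
  ext x
  rw [gauss, Complex.ofReal_exp]
  congr 1
  push_cast
  ring

lemma norm_gauss (t : ℝ) (x : E m) : ‖gauss t x‖ = Real.exp (-(Real.pi * ‖x‖ ^ 2 * t)) := by
  rw [gauss, Complex.norm_real, Real.norm_of_nonneg (Real.exp_pos _).le]

lemma integrable_pow_mul_gauss (hm : 0 < m) (k : ℕ) {t : ℝ} (ht : 0 < t) :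
    Integrable fun x : E m => ‖x‖ ^ k * ‖gauss t x‖ := by
  have : Nonempty (Fin m) := ⟨⟨0, hm⟩⟩
  simp only [norm_gauss]
  refine (integrable_fun_norm_addHaar (volume : Measure (E m))
    (f := fun r => r ^ k * Real.exp (-(Real.pi * r ^ 2 * t)))).2 ?_
  refine (gaussMoment_integrable (Module.finrank ℝ (E m) - 1 + k) ht).congr_fun
    (fun r _ => ?_) measurableSet_Ioi
  simp only [smul_eq_mul]
  rw [pow_add]
  ring

lemma integrable_coord_mul_gauss (hm : 0 < m) (o : Option (Fin m)) {t : ℝ} (ht : 0 < t) :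
    Integrable fun x : E m => (coord o x : ℂ) * gauss t x := by
  refine (integrable_pow_mul_gauss hm (coordDeg o) ht).mono'
    (((Complex.continuous_ofReal.comp (continuous_coord o)).mul
      (continuous_gauss t)).aestronglyMeasurable) (Eventually.of_forall fun x => ?_)
  rw [norm_mul, Complex.norm_real, Real.norm_eq_abs]
  gcongr
  exact abs_coord_le o x

lemma fourier_gauss {t : ℝ} (ht : 0 < t) (ξ : E m) :
    𝓕 (gauss t : E m → ℂ) ξ = ((t ^ (-((m : ℝ) / 2)) : ℝ) : ℂ) * gauss t⁻¹ ξ := by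
  rw [gauss_eq, fourier_gaussian_innerProductSpace (by rw [Complex.ofReal_re]; positivity)]
  have hpi : (Real.pi : ℂ) ≠ 0 := Complex.ofReal_ne_zero.2 Real.pi_ne_zero
  have htc : (t : ℂ) ≠ 0 := Complex.ofReal_ne_zero.2 ht.ne'
  congr 1
  · have h1 : (Real.pi : ℂ) / ((Real.pi * t : ℝ) : ℂ) = ((t⁻¹ : ℝ) : ℂ) := by
      push_cast
      field_simp
    have h2 : ((Module.finrank ℝ (E m) : ℂ) / 2) = (((m : ℝ) / 2 : ℝ) : ℂ) := by simp
    rw [h1, h2, ← Complex.ofReal_cpow (by positivity), Real.inv_rpow ht.le, Real.rpow_neg ht.le]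
  · rw [gauss, Complex.ofReal_exp]
    congr 1
    push_cast
    field_simp

/-- The Fourier transform of the product of a Gaussian with `1` or a coordinate. -/
lemma fourier_coord_mul_gauss (hm : 0 < m) (o : Option (Fin m)) {t : ℝ} (ht : 0 < t) (ξ : E m) :
    𝓕 (fun x : E m => (coord o x : ℂ) * gauss t x) ξ
      = (-1) ^ coordDeg o * ((t ^ (-((m : ℝ) / 2 + coordDeg o)) : ℝ) : ℂ) * coordI o ξ
        * gauss t⁻¹ ξ := by
  cases o with
  | none => simpa [coord, coordDeg, coordI] using fourier_gauss ht ξ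
  | some i =>
    have hg : Integrable (gauss t : E m → ℂ) := by
      simpa [coord] using integrable_coord_mul_gauss hm none ht
    have hg1 : Integrable fun x : E m => ‖x‖ * ‖gauss t x‖ := by
      simpa using integrable_pow_mul_gauss hm 1 ht
    have h1 := Real.hasFDerivAt_fourier hg hg1 ξ
    have hF : 𝓕 (gauss t : E m → ℂ)
        = fun ξ => ((t ^ (-((m : ℝ) / 2)) : ℝ) : ℂ) * gauss t⁻¹ ξ := funext (fourier_gauss ht)
    have hd : HasFDerivAt (fun ξ : E m => -(Real.pi * ‖ξ‖ ^ 2 * t⁻¹))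
        (-((t⁻¹ * Real.pi) • (2 • innerSL ℝ ξ))) ξ := by
      have := ((hasStrictFDerivAt_norm_sq ξ).hasFDerivAt.const_mul (t⁻¹ * Real.pi)).neg
      refine this.congr_of_eventuallyEq (Eventually.of_forall fun y => ?_)
      simp only [Pi.neg_apply]
      ring
    have h2 := (Complex.ofRealCLM.hasFDerivAt.comp ξ hd.exp).const_mul
      ((t ^ (-((m : ℝ) / 2)) : ℝ) : ℂ)
    rw [hF] at h1
    have h3 := congrArg (fun L => L (EuclideanSpace.single i (1 : ℝ))) (h1.unique h2)
    have hint : Integrable (VectorFourier.fourierSMulRight (innerSL ℝ) (gauss t : E m → ℂ)) := by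
      refine (hg1.const_mul (2 * Real.pi * ‖innerSL ℝ (E := E m)‖)).mono'
        hg.aestronglyMeasurable.fourierSMulRight (Eventually.of_forall fun x => ?_)
      refine (VectorFourier.norm_fourierSMulRight_le _ _ _).trans (le_of_eq ?_)
      ring
    rw [Real.fourier_continuousLinearMap_apply hint] at h3
    have hin : ∀ x : E m, (innerSL ℝ x) (EuclideanSpace.single i (1 : ℝ)) = x i := by
      intro x
      rw [innerSL_apply_apply, EuclideanSpace.inner_single_right]
      simp
    have h4 : (fun x : E m => VectorFourier.fourierSMulRight (innerSL ℝ) (gauss t : E m → ℂ) x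
        (EuclideanSpace.single i (1 : ℝ)))
        = (-(2 * Real.pi * Complex.I)) • fun x : E m => (coord (some i) x : ℂ) * gauss t x := by
      ext x
      simp only [VectorFourier.fourierSMulRight_apply, Pi.smul_apply, coord, hin]
      simp
    have h5 : 𝓕 ((-(2 * Real.pi * Complex.I)) • fun x : E m => (coord (some i) x : ℂ) * gauss t x)
        = (-(2 * Real.pi * Complex.I)) • 𝓕 (fun x : E m => (coord (some i) x : ℂ) * gauss t x) :=
      VectorFourier.fourierIntegral_const_smul _ _ _ _ _
    rw [h4, h5] at h3
    simp only [Pi.smul_apply, smul_eq_mul, smul_apply,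
      ContinuousLinearMap.comp_apply, neg_apply, hin,
      Complex.ofRealCLM_apply, nsmul_eq_mul] at h3
    have hpi : (Real.pi : ℂ) ≠ 0 := Complex.ofReal_ne_zero.2 Real.pi_ne_zero
    have htc : (t : ℂ) ≠ 0 := Complex.ofReal_ne_zero.2 ht.ne'
    have hI : Complex.I ^ 2 = -1 := Complex.I_sq
    have ht1 : t ^ (-((m : ℝ) / 2 + ((1 : ℕ) : ℝ))) = t ^ (-((m : ℝ) / 2)) * t⁻¹ := by
      rw [neg_add, Real.rpow_add ht, Nat.cast_one, Real.rpow_neg_one]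
    simp only [coordDeg, coordI, coord, ht1, pow_one]
    have hc : -(2 * (Real.pi : ℂ) * Complex.I) ≠ 0 := by simp [hpi]
    refine mul_left_cancel₀ hc ?_
    simp only [coord] at h3
    rw [h3, gauss]
    push_cast
    linear_combination (-(2 * (Real.pi : ℂ) * ((t ^ (-((m : ℝ) / 2)) : ℝ) : ℂ) * (t : ℂ)⁻¹ * ξ i *
      Complex.exp (-(Real.pi * ‖ξ‖ ^ 2 * (t : ℂ)⁻¹)))) * hI

/-- The integral of a Fourier transform against a Gaussian. -/
theorem integral_fourierInv_mul_gauss (hm : 0 < m) (o : Option (Fin m)) {A : E m → ℂ}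
    (hA : Integrable A) {t : ℝ} (ht : 0 < t) :
    ∫ x, 𝓕⁻ A x * ((coord o x : ℂ) * gauss t x)
      = ((t ^ (-((m : ℝ) / 2 + coordDeg o)) : ℝ) : ℂ) * ∫ ξ, coordI o ξ * A ξ * gauss t⁻¹ ξ := by
  have hc : ∀ x : E m, (coord o (-x) : ℂ) = (-1) ^ coordDeg o * coord o x := by
    intro x
    rw [← neg_one_smul ℝ x, coord_smul]
    push_cast
    rfl
  have hgn : ∀ x : E m, gauss t (-x) = gauss t x := fun x => by simp [gauss]
  have h1 : ∫ x, 𝓕⁻ A x * ((coord o x : ℂ) * gauss t x)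
      = (-1) ^ coordDeg o * ∫ x, 𝓕 A x * ((coord o x : ℂ) * gauss t x) := by
    rw [← integral_neg_eq_self, ← integral_const_mul]
    refine integral_congr_ae (Eventually.of_forall fun x => ?_)
    simp only
    rw [Real.fourierInv_eq_fourier_neg, neg_neg, hc, hgn]
    ring
  have h2 : ∫ x, 𝓕 A x * ((coord o x : ℂ) * gauss t x)
      = ∫ ξ, A ξ * 𝓕 (fun x : E m => (coord o x : ℂ) * gauss t x) ξ := by
    have h3 := VectorFourier.integral_fourierIntegral_smul_eq_flip (L := innerₗ (E m))
      (μ := volume) (ν := volume) (f := A) (g := fun x : E m => (coord o x : ℂ) * gauss t x)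
      Real.continuous_fourierChar continuous_inner hA (integrable_coord_mul_gauss hm o ht)
    rw [flip_innerₗ] at h3
    exact h3
  have hs : ((-1 : ℂ) ^ coordDeg o) * (-1) ^ coordDeg o = 1 := by
    rw [← mul_pow]
    simp
  rw [h1, h2, ← integral_const_mul, ← integral_const_mul]
  refine integral_congr_ae (Eventually.of_forall fun ξ => ?_)
  simp only
  rw [fourier_coord_mul_gauss hm o ht]
  linear_combination ((t ^ (-((m : ℝ) / 2 + coordDeg o)) : ℝ) : ℂ) * coordI o ξ * A ξ
    * gauss t⁻¹ ξ * hs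

end Fourier

section Kernel

open scoped FourierTransform InnerProductSpace

variable {m : ℕ}

/-- The weight `1` or `w_i` on the sphere. -/
def coordWeight (o : Option (Fin m)) (w : Metric.sphere (0 : E m) 1) : ℂ := coord o (w : E m)

lemma weight_coordWeight (o : Option (Fin m)) : Weight (coordWeight o) where
  meas := by
    have : Continuous (coordWeight o) :=
      Complex.continuous_ofReal.comp ((continuous_coord o).comp continuous_subtype_val)
    exact this.measurable
  norm_le w := by
    rw [coordWeight, Complex.norm_real, Real.norm_eq_abs]
    simpa using abs_coord_le o (w : E m)

/-- The quadratic function `π |x|²`. -/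
def piSq (x : E m) : ℝ := Real.pi * ‖x‖ ^ 2

lemma continuous_piSq : Continuous (piSq : E m → ℝ) := by unfold piSq; fun_prop

lemma ae_ne_zero (hm : 0 < m) : ∀ᵐ x : E m, x ≠ 0 := by
  have : Nonempty (Fin m) := ⟨⟨0, hm⟩⟩
  exact Measure.ae_ne volume 0

lemma piSq_pos {x : E m} (hx : x ≠ 0) : 0 < piSq x := by
  have := norm_pos_iff.2 hx
  have := Real.pi_pos
  unfold piSq
  positivity

lemma gauss_eq_exp (t : ℝ) (x : E m) : gauss t x = ((Real.exp (-(piSq x * t)) : ℝ) : ℂ) := rfl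

/-- The Fourier transform of the translate `φ(· + y)`. -/
def transHat (φ : 𝓢(E m, ℂ)) (y ξ : E m) : ℂ := Real.fourierChar ⟪ξ, y⟫_ℝ • 𝓕 φ ξ

lemma norm_transHat (φ : 𝓢(E m, ℂ)) (y ξ : E m) : ‖transHat φ y ξ‖ = ‖𝓕 φ ξ‖ :=
  Circle.norm_smul _ _

lemma continuous_transHat (φ : 𝓢(E m, ℂ)) (y : E m) : Continuous (transHat φ y) :=
  (Real.continuous_fourierChar.comp (by fun_prop : Continuous fun ξ : E m => ⟪ξ, y⟫_ℝ)).smul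
    (𝓕 φ).continuous

lemma integrable_pow_mul_transHat (φ : 𝓢(E m, ℂ)) (y : E m) (k : ℕ) :
    Integrable fun ξ => ‖ξ‖ ^ k * ‖transHat φ y ξ‖ := by
  simp only [norm_transHat]
  exact (𝓕 φ).integrable_pow_mul volume k

lemma integrable_transHat (φ : 𝓢(E m, ℂ)) (y : E m) : Integrable (transHat φ y) := by
  rw [← integrable_norm_iff (continuous_transHat φ y).aestronglyMeasurable]
  simpa using integrable_pow_mul_transHat φ y 0

lemma fourierInv_transHat (φ : 𝓢(E m, ℂ)) (x y : E m) :
    𝓕⁻ (transHat φ y) x = φ (x + y) := by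
  have h : φ (x + y) = 𝓕⁻ ((𝓕 φ : 𝓢(E m, ℂ)) : E m → ℂ) (x + y) := by
    rw [← SchwartzMap.fourierInv_coe, FourierTransform.fourierInv_fourier_eq]
  rw [h, Real.fourierInv_eq, Real.fourierInv_eq]
  refine integral_congr_ae (Eventually.of_forall fun ξ => ?_)
  simp only [transHat]
  rw [smul_smul, inner_add_right, AddChar.map_add_eq_mul]

lemma norm_coordI_le (o : Option (Fin m)) (ξ : E m) : ‖coordI o ξ‖ ≤ ‖ξ‖ ^ coordDeg o := by
  rw [coordI, norm_mul, norm_pow, Complex.norm_I, one_pow, one_mul, Complex.norm_real]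
  exact abs_coord_le o ξ

lemma continuous_coordI (o : Option (Fin m)) : Continuous (coordI o) :=
  continuous_const.mul (Complex.continuous_ofReal.comp (continuous_coord o))

lemma integrable_piSq_pow_coordI (o : Option (Fin m)) (φ : 𝓢(E m, ℂ)) (y : E m) (k : ℕ) :
    Integrable fun ξ => piSq ξ ^ k • (coordI o ξ * transHat φ y ξ) := by
  refine ((integrable_pow_mul_transHat φ y (2 * k + coordDeg o)).const_mul (Real.pi ^ k)).mono'
    (Continuous.aestronglyMeasurable ?_) (Eventually.of_forall fun ξ => ?_)
  · exact (continuous_piSq.pow k).smul ((continuous_coordI o).mul (continuous_transHat φ y))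
  · rw [norm_smul, norm_mul, piSq, norm_pow, Real.norm_of_nonneg
      (mul_nonneg Real.pi_pos.le (sq_nonneg _))]
    calc _ ≤ (Real.pi * ‖ξ‖ ^ 2) ^ k * (‖ξ‖ ^ coordDeg o * ‖transHat φ y ξ‖) := by
          gcongr
          exact norm_coordI_le o ξ
      _ = _ := by ring

/-- Gaussian integrals in polar coordinates. -/
lemma polar_gauss (hm : 0 < m) (o : Option (Fin m)) {g : E m → ℂ} (hg : BddSmooth g) {t : ℝ}
    (ht : 0 < t) :
    ∫ r in Set.Ioi (0 : ℝ), (r ^ (m - 1 + coordDeg o) * Real.exp (-(Real.pi * r ^ 2 * t))) •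
      sphInt (coordWeight o) g r = ∫ x, g x * ((coord o x : ℂ) * gauss t x) := by
  have hint : Integrable fun x => g x * ((coord o x : ℂ) * gauss t x) := by
    obtain ⟨C, hC⟩ := hg.bdd 0
    refine (integrable_coord_mul_gauss hm o ht).bdd_mul (c := C)
      hg.smooth.continuous.aestronglyMeasurable (Eventually.of_forall fun x => ?_)
    simpa using hC x
  rw [(polar_coordinates hm hint).2]
  refine setIntegral_congr_fun measurableSet_Ioi fun r hr => ?_
  simp only [sphInt, coordWeight]
  rw [← integral_smul, ← integral_smul]
  refine integral_congr_ae (Eventually.of_forall fun w => ?_)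
  simp only [Complex.real_smul, coord_smul, gauss, norm_smul, norm_sphere, mul_one,
    Real.norm_eq_abs, sq_abs]
  push_cast
  rw [pow_add]
  ring

/-- The constant in the Fourier representation of the finite part of `|x|^{-m-μ}`. -/
def fpConst (α b : ℝ) : ℝ := Real.Gamma (-α) * Real.pi ^ b / Real.Gamma b

/-- The multiplier `(π |ξ|²)^α` or `i ξ_i (π |ξ|²)^α` applied to the Fourier transform. -/
def powHat (α : ℝ) (o : Option (Fin m)) (φ : 𝓢(E m, ℂ)) (ξ : E m) : ℂ :=
  piSq ξ ^ α • (coordI o ξ * 𝓕 φ ξ)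

lemma integrable_powHat {α : ℝ} (hα : 0 < α) (o : Option (Fin m)) (φ : 𝓢(E m, ℂ)) :
    Integrable (powHat α o φ) := by
  obtain ⟨n, hn⟩ := exists_nat_gt α
  have h0 := (integrable_piSq_pow_coordI o φ 0 0).norm
  have h1 := (integrable_piSq_pow_coordI o φ 0 n).norm
  have hc : Continuous (powHat α o φ) :=
    (continuous_piSq.rpow_const fun _ => Or.inr hα.le).smul
      ((continuous_coordI o).mul (𝓕 φ).continuous)
  refine (h0.add h1).mono' hc.aestronglyMeasurable (Eventually.of_forall fun ξ => ?_)
  have hp : 0 ≤ piSq ξ := mul_nonneg Real.pi_pos.le (sq_nonneg _)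
  simp only [Pi.add_apply, powHat]
  rw [norm_smul, norm_smul, norm_smul, norm_mul, norm_mul, norm_transHat, norm_pow,
    Real.norm_of_nonneg hp, norm_pow, Real.norm_of_nonneg hp,
    Real.norm_of_nonneg (Real.rpow_nonneg hp _), ← add_mul, pow_zero]
  gcongr
  rcases le_total (piSq ξ) 1 with h | h
  · have := Real.rpow_le_one hp h hα.le
    have : 0 ≤ piSq ξ ^ n := by positivity
    linarith
  · rw [← Real.rpow_natCast]
    have := Real.rpow_le_rpow_of_exponent_le h hn.le
    linarith

/-- The finite part functionals are Fourier multipliers. -/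
theorem fpKer_eq_fourierInv (hm : Odd m) (j : ℕ) (o : Option (Fin m)) {α b : ℝ}
    (hα : α = (m : ℝ) / 2 + j) (hb : b = (m : ℝ) + j + coordDeg o) (φ : 𝓢(E m, ℂ)) (y : E m) :
    fpKer (m + 2 * j + 1 + coordDeg o) (coordWeight o) (fun x => φ (x + y))
      = (fpConst α b : ℂ) * 𝓕⁻ (powHat α o φ) y := by
  have hm0 : 0 < m := hm.pos
  obtain ⟨p, hp⟩ := hm
  have hmp : (m : ℝ) = 2 * p + 1 := by exact_mod_cast hp
  have hN : m + 2 * j + 1 + coordDeg o = 2 * (p + 1 + j) + coordDeg o := by omega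
  have hb0 : 0 < b := by rw [hb, hmp]; positivity
  have hG := (Real.Gamma_pos_of_pos hb0).ne'
  have key := finitePart_of_gauss (h := sphInt (coordWeight o) (fun x => φ (x + y)))
    (ν := (volume : Measure (E m))) (σ := piSq) (A := fun ξ => coordI o ξ * transHat φ y ξ)
    (n := p + 1 + j) (ε := coordDeg o) (d := m - 1 + coordDeg o) (s := (m : ℝ) / 2 + coordDeg o)
    (α := α) (b := b)
    (bddSmooth_sphInt (weight_coordWeight o) (bddSmooth_translate φ y)) (by omega)
    continuous_piSq.measurable ((ae_ne_zero hm0).mono fun x hx => piSq_pos hx)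
    (fun k _ => integrable_piSq_pow_coordI o φ y k)
    (by push_cast [Nat.cast_sub (Nat.succ_le_of_lt hm0)]; ring)
    (by rw [hα, hmp]; push_cast; ring) (by rw [hb, hα]; ring)
    (fun t ht => by
      rw [polar_gauss hm0 o (bddSmooth_translate φ y) ht]
      simp only [← fourierInv_transHat]
      rw [integral_fourierInv_mul_gauss hm0 o (integrable_transHat φ y) ht, Complex.real_smul]
      congr 1
      refine integral_congr_ae (Eventually.of_forall fun ξ => ?_)
      simp only [gauss_eq_exp, Complex.real_smul, div_eq_mul_inv]
      ring)
  rw [hN, fpKer]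
  have hint : ∫ ξ, piSq ξ ^ α • (coordI o ξ * transHat φ y ξ) = 𝓕⁻ (powHat α o φ) y := by
    rw [Real.fourierInv_eq]
    refine integral_congr_ae (Eventually.of_forall fun ξ => ?_)
    simp only [powHat, transHat, Circle.smul_def, Complex.real_smul, smul_eq_mul]
    ring
  rw [hint, Complex.real_smul, Complex.real_smul] at key
  have hpi : Real.pi ^ (-b) * Real.pi ^ b = 1 := by
    rw [← Real.rpow_add Real.pi_pos, neg_add_cancel, Real.rpow_zero]
  have h1 : (((Real.Gamma b * Real.pi ^ (-b) : ℝ)) : ℂ) * (fpConst α b : ℂ)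
      = (Real.Gamma (-α) : ℂ) := by
    rw [← Complex.ofReal_mul, fpConst]
    congr 1
    field_simp
    linear_combination Real.Gamma (-α) * hpi
  have h2 : ((Real.Gamma b * Real.pi ^ (-b) : ℝ) : ℂ) ≠ 0 := by
    have := Real.rpow_pos_of_pos Real.pi_pos (-b)
    have := Real.Gamma_pos_of_pos hb0
    exact Complex.ofReal_ne_zero.2 (by positivity)
  refine mul_left_cancel₀ h2 ?_
  rw [key, ← mul_assoc, h1]

end Kernel

section LogPairing

open scoped FourierTransform InnerProductSpace

variable {m : ℕ}

/-- The function `(p ln |y| + q) |y|^{2k}` times `1` or `y_i`. -/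
def logPow (p q : ℝ) (k : ℕ) (o : Option (Fin m)) (y : E m) : ℂ :=
  (((p * Real.log ‖y‖ + q) * ‖y‖ ^ (2 * k) * coord o y : ℝ) : ℂ)

lemma measurable_logPow (p q : ℝ) (k : ℕ) (o : Option (Fin m)) : Measurable (logPow p q k o) := by
  refine Complex.measurable_ofReal.comp (Measurable.mul (Measurable.mul ?_ ?_) ?_)
  · exact ((Real.measurable_log.comp measurable_norm).const_mul p).add_const q
  · exact measurable_norm.pow_const _
  · exact (continuous_coord o).measurable

lemma integrable_log_ball (hm : 0 < m) :
    Integrable ((Metric.ball (0 : E m) 1).indicator fun y => |Real.log ‖y‖|) := by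
  have : Nonempty (Fin m) := ⟨⟨0, hm⟩⟩
  rw [integrable_indicator_iff Metric.isOpen_ball.measurableSet,
    integrableOn_fun_norm_addHaar (volume : Measure (E m)) (f := fun r => |Real.log r|)]
  have h : IntegrableOn (fun r => |Real.log r|) (Set.Ioo 0 1) := by
    have := (intervalIntegral.intervalIntegrable_log' (a := 0) (b := 1)).1
    exact (this.mono_set Set.Ioo_subset_Ioc_self).norm
  refine h.mono' ?_ ?_
  · exact ((measurable_id.pow_const _).mul Real.measurable_log.norm).aestronglyMeasurable
  · filter_upwards [ae_restrict_mem measurableSet_Ioo] with r hr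
    rw [smul_eq_mul, norm_mul, norm_pow, Real.norm_of_nonneg hr.1.le, Real.norm_eq_abs, abs_abs]
    exact mul_le_of_le_one_left (abs_nonneg _) (pow_le_one₀ hr.1.le hr.2.le)

lemma moderate_logPow (hm : 0 < m) (p q : ℝ) {j k : ℕ} (hk : k ≤ j) (o : Option (Fin m)) :
    Moderate (2 * (j : ℝ) + coordDeg o + 1 / 2) (logPow p q k o) where
  meas := (measurable_logPow p q k o).aestronglyMeasurable
  bound := by
    refine ⟨_, 2 * |p| + |q|, (integrable_log_ball hm).const_mul |p|, by positivity, fun y => ?_⟩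
    have hy := norm_nonneg y
    have hx : (1 : ℝ) ≤ 1 + ‖y‖ := by linarith
    have hpos : (0 : ℝ) ≤ 1 + ‖y‖ := by linarith
    have hpow : ‖y‖ ^ (2 * k + coordDeg o) ≤ (1 + ‖y‖) ^ (2 * (j : ℝ) + coordDeg o) := by
      calc ‖y‖ ^ (2 * k + coordDeg o) ≤ (1 + ‖y‖) ^ (2 * k + coordDeg o) := by
            gcongr; linarith
        _ ≤ (1 + ‖y‖) ^ (2 * j + coordDeg o) := pow_le_pow_right₀ hx (by omega)
        _ = _ := by rw [← Real.rpow_natCast]; push_cast; rfl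
    have hsplit : (1 + ‖y‖) ^ (2 * (j : ℝ) + coordDeg o + 1 / 2)
        = (1 + ‖y‖) ^ (2 * (j : ℝ) + coordDeg o) * (1 + ‖y‖) ^ (1 / 2 : ℝ) :=
      Real.rpow_add (by linarith) _ _
    have h12 : 1 ≤ (1 + ‖y‖) ^ (1 / 2 : ℝ) := Real.one_le_rpow hx (by norm_num)
    have hF : ‖logPow p q k o y‖ ≤ |p * Real.log ‖y‖ + q| * ‖y‖ ^ (2 * k + coordDeg o) := by
      rw [logPow, Complex.norm_real, norm_mul, norm_mul, norm_pow, norm_norm, pow_add, mul_assoc]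
      simp only [Real.norm_eq_abs]
      gcongr
      exact abs_coord_le o y
    have hpq : |p * Real.log ‖y‖ + q| ≤ |p| * |Real.log ‖y‖| + |q| :=
      (abs_add_le _ _).trans (by rw [abs_mul])
    have hP : 0 ≤ (1 + ‖y‖) ^ (2 * (j : ℝ) + coordDeg o) := Real.rpow_nonneg hpos _
    have hA : 0 ≤ (1 + ‖y‖) ^ (2 * (j : ℝ) + coordDeg o + 1 / 2) := Real.rpow_nonneg hpos _
    rcases lt_or_ge ‖y‖ 1 with h1 | h1
    · have hmem : y ∈ Metric.ball (0 : E m) 1 := by simpa using h1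
      rw [Set.indicator_of_mem hmem]
      have h2 : ‖y‖ ^ (2 * k + coordDeg o) ≤ 1 := pow_le_one₀ hy h1.le
      have h3 : 1 ≤ (1 + ‖y‖) ^ (2 * (j : ℝ) + coordDeg o + 1 / 2) :=
        Real.one_le_rpow hx (by positivity)
      calc _ ≤ |p * Real.log ‖y‖ + q| * 1 := hF.trans (by gcongr)
        _ ≤ |p| * |Real.log ‖y‖| + |q| := by linarith
        _ ≤ |p| * |Real.log ‖y‖| + (2 * |p| + |q|) * 1 := by
            have := abs_nonneg p
            linarith
        _ ≤ _ := by gcongr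
    · have hmem : y ∉ Metric.ball (0 : E m) 1 := by simpa using h1
      rw [Set.indicator_of_notMem hmem, mul_zero, zero_add, hsplit]
      have hl0 : 0 ≤ Real.log ‖y‖ := Real.log_nonneg h1
      have hl : |Real.log ‖y‖| ≤ 2 * (1 + ‖y‖) ^ (1 / 2 : ℝ) := by
        rw [abs_of_nonneg hl0]
        have h2 := Real.log_le_rpow_div hy (show (0 : ℝ) < 1 / 2 by norm_num)
        have h3 : ‖y‖ ^ (1 / 2 : ℝ) ≤ (1 + ‖y‖) ^ (1 / 2 : ℝ) :=
          Real.rpow_le_rpow hy (by linarith) (by norm_num)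
        calc _ ≤ ‖y‖ ^ (1 / 2 : ℝ) / (1 / 2) := h2
          _ = 2 * ‖y‖ ^ (1 / 2 : ℝ) := by ring
          _ ≤ _ := by linarith
      calc _ ≤ (|p| * |Real.log ‖y‖| + |q|) * ‖y‖ ^ (2 * k + coordDeg o) := hF.trans (by gcongr)
        _ ≤ (|p| * (2 * (1 + ‖y‖) ^ (1 / 2 : ℝ)) + |q| * (1 + ‖y‖) ^ (1 / 2 : ℝ))
            * (1 + ‖y‖) ^ (2 * (j : ℝ) + coordDeg o) := by
            gcongr
            exact le_mul_of_one_le_right (abs_nonneg q) h12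
        _ = _ := by ring

/-- The functional on test functions which appears as the convolution. -/
def limitForm (o o' : Option (Fin m)) (φ : 𝓢(E m, ℂ)) : ℂ :=
  ∫ ξ, ((piSq ξ ^ coordDeg o)⁻¹ : ℝ) • (coordI o ξ * coordI o' ξ * 𝓕 φ ξ)

lemma integrable_limitForm {o o' : Option (Fin m)} (ho : coordDeg o' = coordDeg o)
    (φ : 𝓢(E m, ℂ)) :
    Integrable fun ξ => ((piSq ξ ^ coordDeg o)⁻¹ : ℝ) • (coordI o ξ * coordI o' ξ * 𝓕 φ ξ) := by
  refine (𝓕 φ).integrable.norm.mono' ?_ (Eventually.of_forall fun ξ => ?_)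
  · have h1 : Measurable fun ξ : E m => (piSq ξ ^ coordDeg o)⁻¹ :=
      (continuous_piSq.measurable.pow_const _).inv
    exact h1.aestronglyMeasurable.smul (((continuous_coordI o).mul (continuous_coordI o')).mul
      (𝓕 φ).continuous).aestronglyMeasurable
  · have hp : 0 ≤ piSq ξ := mul_nonneg Real.pi_pos.le (sq_nonneg _)
    rw [norm_smul, norm_mul, norm_mul, norm_inv, norm_pow, Real.norm_of_nonneg hp, ← mul_assoc]
    refine mul_le_of_le_one_left (norm_nonneg _) ?_
    have h1 : ‖coordI o ξ‖ * ‖coordI o' ξ‖ ≤ piSq ξ ^ coordDeg o := by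
      calc _ ≤ ‖ξ‖ ^ coordDeg o * ‖ξ‖ ^ coordDeg o := by
            gcongr
            · exact norm_coordI_le o ξ
            · rw [← ho]; exact norm_coordI_le o' ξ
        _ = (1 * ‖ξ‖ ^ 2) ^ coordDeg o := by ring
        _ ≤ _ := by
            unfold piSq
            gcongr
            linarith [Real.pi_gt_three]
    rcases (pow_nonneg hp (coordDeg o)).eq_or_lt with h0 | h0
    · rw [← h0]; simp
    · rw [inv_mul_le_iff₀ h0, mul_one]
      exact h1

/-- The pairing of `(p ln r + q) r^{2j}` with the translates of the kernel. -/
theorem integral_logPow_mul_fpKer (hm : Odd m) (j : ℕ) {o o' : Option (Fin m)}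
    (ho : coordDeg o' = coordDeg o) {α b : ℝ}
    (hα : α = (m : ℝ) / 2 + j) (hb : b = (m : ℝ) + j + coordDeg o) (p q : ℝ) (φ : 𝓢(E m, ℂ)) :
    ∫ y, logPow p q j o' y *
        fpKer (m + 2 * j + 1 + coordDeg o) (coordWeight o) (fun x => φ (x + y))
      = ((-(p * ((-1) ^ j * (j.factorial : ℝ)) / (2 * Real.pi ^ j) *
          Real.Gamma (α + coordDeg o) * fpConst α b) : ℝ) : ℂ) * limitForm o o' φ := by
  have hm0 : 0 < m := hm.pos
  have hα0 : 0 < α := by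
    rw [hα]
    have : (0 : ℝ) < m := by exact_mod_cast hm0
    positivity
  set ψ : E m → ℂ := fun y =>
    fpKer (m + 2 * j + 1 + coordDeg o) (coordWeight o) (fun x => φ (x + y)) with hψ
  have hψ' : ∀ y, ψ y = (fpConst α b : ℂ) * 𝓕⁻ (powHat α o φ) y :=
    fun y => fpKer_eq_fourierInv hm j o hα hb φ y
  have hconv : Convolvable (2 * (j : ℝ) + coordDeg o' + 1 / 2)
      (fpKer (m + 2 * j + 1 + coordDeg o) (coordWeight o)) :=
    fpKer_convolvable (by positivity) (by
      rw [ho]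
      push_cast
      have : (1 : ℝ) ≤ m := by exact_mod_cast hm0
      linarith) (weight_coordWeight o)
  have hint : ∀ (p q : ℝ) (k : ℕ), k ≤ j → Integrable fun y => logPow p q k o' y * ψ y :=
    fun p q k hk => hconv.integrable _ (moderate_logPow hm0 p q hk o') φ
  set χ : E m → ℂ := fun y => (coord o' y : ℂ) * ψ y with hχdef
  set B : E m → ℂ := fun ξ => (fpConst α b : ℂ) *
    (((piSq ξ ^ coordDeg o)⁻¹ : ℝ) • (coordI o ξ * coordI o' ξ * 𝓕 φ ξ)) with hBdef
  have hB : Integrable B := (integrable_limitForm ho φ).const_mul _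
  have hρ0 : ∀ᵐ y : E m, 0 < piSq y := (ae_ne_zero hm0).mono fun x hx => piSq_pos hx
  have hχ : ∀ k ≤ j, Integrable fun y => piSq y ^ k • χ y := by
    intro k hk
    refine ((hint 0 1 k hk).const_mul ((Real.pi ^ k : ℝ) : ℂ)).congr
      (Eventually.of_forall fun y => ?_)
    simp only [logPow, hχdef, piSq, Complex.real_smul]
    push_cast
    ring
  have hloge : ∀ᵐ y : E m, (piSq y ^ j * Real.log (piSq y)) • χ y
      = ((Real.pi ^ j : ℝ) : ℂ) * (logPow 2 (Real.log Real.pi) j o' y * ψ y) := by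
    filter_upwards [ae_ne_zero hm0] with y hy
    have hn : ‖y‖ ≠ 0 := norm_ne_zero_iff.2 hy
    have hl : Real.log (piSq y) = Real.log Real.pi + 2 * Real.log ‖y‖ := by
      rw [piSq, Real.log_mul Real.pi_ne_zero (pow_ne_zero _ hn), Real.log_pow]
      push_cast
      rfl
    rw [hl]
    simp only [logPow, hχdef, piSq, Complex.real_smul]
    push_cast
    ring
  have hlog : Integrable fun y => (piSq y ^ j * Real.log (piSq y)) • χ y :=
    ((hint 2 (Real.log Real.pi) j le_rfl).const_mul ((Real.pi ^ j : ℝ) : ℂ)).congr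
      (hloge.mono fun y hy => hy.symm)
  have hs : 0 < (m : ℝ) / 2 + coordDeg o := by
    have : (0 : ℝ) < m := by exact_mod_cast hm0
    positivity
  have hG : ∀ t : ℝ, 0 < t → ∫ y, Real.exp (-(piSq y * t)) • χ y
      = t ^ (-((m : ℝ) / 2 + coordDeg o)) •
        ∫ z, (piSq z ^ ((m : ℝ) / 2 + coordDeg o + j) * Real.exp (-(piSq z / t))) • B z := by
    intro t ht
    have h1 := integral_fourierInv_mul_gauss hm0 o' (integrable_powHat hα0 o φ) ht
    have h2 : ∫ y, Real.exp (-(piSq y * t)) • χ y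
        = (fpConst α b : ℂ) * ∫ y, 𝓕⁻ (powHat α o φ) y * ((coord o' y : ℂ) * gauss t y) := by
      rw [← integral_const_mul]
      refine integral_congr_ae (Eventually.of_forall fun y => ?_)
      simp only [hχdef, hψ', gauss_eq_exp, Complex.real_smul]
      ring
    rw [h2, h1, ho, Complex.real_smul, mul_left_comm]
    congr 1
    rw [← integral_const_mul]
    refine integral_congr_ae ?_
    filter_upwards [ae_ne_zero hm0] with ξ hξ
    have hp := piSq_pos hξ
    have hpow : piSq ξ ^ ((m : ℝ) / 2 + coordDeg o + j) * (piSq ξ ^ coordDeg o)⁻¹ = piSq ξ ^ α := by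
      rw [← Real.rpow_natCast (piSq ξ) (coordDeg o), ← Real.rpow_neg hp.le, ← Real.rpow_add hp, hα]
      congr 1
      ring
    simp only [powHat, hBdef, gauss_eq_exp, Complex.real_smul]
    rw [← hpow]
    push_cast
    rw [div_eq_mul_inv]
    ring
  have key := log_moment hs continuous_piSq.measurable hρ0 continuous_piSq.measurable hρ0
    hχ hlog hB hG
  have hmom := moments_eq_zero hs continuous_piSq.measurable hρ0 continuous_piSq.measurable hρ0
    hχ hB hG j le_rfl
  have hM : ∫ y, logPow 0 1 j o' y * ψ y = 0 := by
    have : ∀ y, piSq y ^ j • χ y = ((Real.pi ^ j : ℝ) : ℂ) * (logPow 0 1 j o' y * ψ y) := by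
      intro y
      simp only [logPow, hχdef, piSq, Complex.real_smul]
      push_cast
      ring
    simp only [this] at hmom
    rw [integral_const_mul] at hmom
    exact (mul_eq_zero.1 hmom).resolve_left
      (Complex.ofReal_ne_zero.2 (pow_ne_zero _ Real.pi_ne_zero))
  have hlin : ∀ p q : ℝ, ∫ y, logPow p q j o' y * ψ y
      = (p : ℂ) * ∫ y, logPow 1 0 j o' y * ψ y := by
    intro p q
    have : ∀ y, logPow p q j o' y * ψ y = (p : ℂ) * (logPow 1 0 j o' y * ψ y)
        + (q : ℂ) * (logPow 0 1 j o' y * ψ y) := by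
      intro y
      simp only [logPow]
      push_cast
      ring
    simp only [this]
    rw [integral_add ((hint 1 0 j le_rfl).const_mul _) ((hint 0 1 j le_rfl).const_mul _),
      integral_const_mul, integral_const_mul, hM, mul_zero, add_zero]
  rw [integral_congr_ae hloge, integral_const_mul, hlin 2] at key
  rw [hlin p q]
  have hBint : ∫ z, B z = (fpConst α b : ℂ) * limitForm o o' φ := integral_const_mul _ _
  have hαs : (m : ℝ) / 2 + coordDeg o + j = α + coordDeg o := by rw [hα]; ring
  rw [hBint, hαs, Complex.real_smul, Complex.real_smul] at key
  have hpi : (Real.pi : ℂ) ^ j ≠ 0 := pow_ne_zero _ (Complex.ofReal_ne_zero.2 Real.pi_ne_zero)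
  have hj : ((j.factorial : ℕ) : ℂ) ≠ 0 := Nat.cast_ne_zero.2 j.factorial_ne_zero
  have hsgn : ((-1 : ℂ) ^ j) * (-1) ^ j = 1 := by
    rw [← mul_pow]
    simp
  push_cast at key ⊢
  field_simp at key ⊢
  linear_combination (-(p : ℂ) * (-1) ^ j) * key
    - 2 * (p : ℂ) * (Real.pi : ℂ) ^ j * (∫ y, logPow 1 0 j o' y * ψ y) * hsgn

end LogPairing

/-! ### Convolutions of Clifford algebra valued distributions -/

section Assembly

variable {m : ℕ} {a : ℝ} {F : E m → ℂ}

lemma Moderate.norm_mul_le {L : ℕ} {C : ℝ} {φ : 𝓢(E m, ℂ)}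
    (hC : ∀ x, ‖φ x‖ ≤ C * ((1 + ‖x‖) ^ L)⁻¹) (y : E m) :
    ‖F y * φ y‖ ≤ ‖F y‖ * ((1 + ‖y‖) ^ L)⁻¹ * C := by
  rw [norm_mul, mul_assoc, mul_comm _ C]
  gcongr
  exact hC y

lemma schwartz_norm_le (L : ℕ) (φ : 𝓢(E m, ℂ)) (x : E m) :
    ‖φ x‖ ≤ (2 ^ L * (Finset.Iic (L, 0)).sup (schwartzSeminormFamily ℂ (E m) ℂ) φ)
      * ((1 + ‖x‖) ^ L)⁻¹ := by
  have h := SchwartzMap.one_add_le_sup_seminorm_apply (𝕜 := ℂ) (m := (L, 0)) (k := L) (n := 0)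
    le_rfl le_rfl φ x
  rw [norm_iteratedFDeriv_zero] at h
  rw [← div_eq_mul_inv, le_div_iff₀ (by positivity), mul_comm]
  exact h

lemma Moderate.integrable_mul (hF : Moderate a F) (φ : 𝓢(E m, ℂ)) :
    Integrable fun y => F y * φ y := by
  obtain ⟨L, hL⟩ := exists_nat_gt_growth a m
  refine ((integrable_moderate_mul hF hL).mul_const _).mono'
    (hF.meas.mul φ.continuous.aestronglyMeasurable)
    (Eventually.of_forall fun y => Moderate.norm_mul_le (schwartz_norm_le L φ) y)

lemma Moderate.exists_clm (hF : Moderate a F) :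
    ∃ S : 𝓢(E m, ℂ) →L[ℂ] ℂ, ∀ φ : 𝓢(E m, ℂ), S φ = ∫ y, F y * φ y := by
  refine ⟨SchwartzMap.mkCLMtoNormedSpace (σ := RingHom.id ℂ) (fun φ => ∫ y, F y * φ y)
    (fun f g => ?_) (fun r f => ?_) ?_, fun φ => rfl⟩
  · rw [← integral_add (hF.integrable_mul f) (hF.integrable_mul g)]
    congr 1
    ext y
    simp [mul_add]
  · rw [RingHom.id_apply, smul_eq_mul, ← integral_const_mul]
    congr 1
    ext y
    simp
    ring
  · obtain ⟨L, hL⟩ := exists_nat_gt_growth a m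
    refine ⟨Finset.Iic (L, 0), (∫ y, ‖F y‖ * ((1 + ‖y‖) ^ L)⁻¹) * 2 ^ L, ?_, fun φ => ?_⟩
    · refine mul_nonneg (integral_nonneg fun p => ?_) (by positivity)
      exact mul_nonneg (norm_nonneg _) (by positivity)
    · rw [mul_assoc, ← integral_mul_const]
      exact norm_integral_le_of_norm_le ((integrable_moderate_mul hF hL).mul_const _)
        (Eventually.of_forall fun y => Moderate.norm_mul_le (schwartz_norm_le L φ) y)

instance : ContinuousAdd (Cl m) := IsModuleTopology.toContinuousAdd ℂ (Cl m)

instance : ContinuousSMul ℂ (Cl m) := IsModuleTopology.toContinuousSMul ℂ (Cl m)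

instance : IsTopologicalAddGroup (Cl m) := IsModuleTopology.topologicalAddGroup ℂ (Cl m)

/-- The `Cl m`-valued map `φ ↦ ∑ S_i(φ) b_i`. -/
def sumSMul {V : Type*} [NormedAddCommGroup V] [NormedSpace ℝ V] {ι : Type*} [Fintype ι]
    (S : ι → 𝓢(V, ℂ) →L[ℂ] ℂ) (b : ι → Cl m) : 𝓢'(V, Cl m) :=
  ContinuousLinearMap.toPointwiseConvergenceCLM _ _ _ _
    (∑ i, (ContinuousLinearMap.toSpanSingleton ℂ (b i)).comp (S i))

lemma sumSMul_apply {V : Type*} [NormedAddCommGroup V] [NormedSpace ℝ V] {ι : Type*} [Fintype ι]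
    (S : ι → 𝓢(V, ℂ) →L[ℂ] ℂ) (b : ι → Cl m) (φ : 𝓢(V, ℂ)) :
    sumSMul S b φ = ∑ i, S i φ • b i := by
  change (∑ i, (ContinuousLinearMap.toSpanSingleton ℂ (b i)).comp (S i)) φ = _
  rw [sum_apply]
  rfl

lemma isTempered_of_sum {ι : Type*} [Fintype ι] {S : Functional m} {κ : ι → 𝓢(E m, ℂ) → ℂ}
    {b : ι → Cl m} (hκ : ∀ i, ∃ S : 𝓢(E m, ℂ) →L[ℂ] ℂ, ∀ φ, S φ = κ i φ)
    (hS : ∀ φ : 𝓢(E m, ℂ), S φ = ∑ i, κ i φ • b i) : IsTempered S := by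
  choose S' hS' using hκ
  refine ⟨sumSMul S' b, fun φ => ?_⟩
  rw [hS, sumSMul_apply]
  simp only [hS']

lemma isTempered_delta : IsTempered (delta m) := by
  refine isTempered_of_sum (ι := Unit) (κ := fun _ φ => φ 0) (b := fun _ => 1) (fun _ => ?_)
    (fun φ => ?_)
  · refine ⟨SchwartzMap.mkCLMtoNormedSpace (σ := RingHom.id ℂ) (fun φ => φ 0)
      (fun f g => rfl) (fun r f => rfl) ⟨{(0, 0)}, 1, zero_le_one, fun φ => ?_⟩, fun φ => rfl⟩
    simpa using SchwartzMap.norm_le_seminorm ℂ φ 0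
  · simp [delta, Algebra.algebraMap_eq_smul_one]

/-- The convolution of a sum of convolvable kernels with a sum of moderate functions. -/
theorem isConvolution_of_sum {ι : Type*} [Fintype ι] {κ : ι → (E m → ℂ) → ℂ} {f : ι → E m → ℂ}
    {b : ι → Cl m} {S S' R : Functional m} (hκ : ∀ i, Convolvable a (κ i))
    (hf : ∀ i, Moderate a (f i)) (hS : ∀ φ : 𝓢(E m, ℂ), S φ = ∑ i, κ i φ • b i)
    (hS' : ∀ φ : 𝓢(E m, ℂ), S' φ = ∑ i, (∫ y, f i y * φ y) • b i) (hR : IsTempered R)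
    (hR' : ∀ φ : 𝓢(E m, ℂ),
      R φ = ∑ p : ι × ι, (∫ y, f p.2 y * κ p.1 (fun x => φ (x + y))) • (b p.1 * b p.2)) :
    IsConvolution S S' R := by
  choose W hW1 hW2 using fun p : ι × ι => (hκ p.1).conv (f p.2) (hf p.2)
  refine ⟨isTempered_of_sum (fun i => (hκ i).tempered) hS,
    isTempered_of_sum (fun i => (hf i).exists_clm) hS', hR,
    sumSMul W (fun p => b p.1 * b p.2), fun φ ψ => ?_, fun η hη φ => ?_⟩
  · rw [sumSMul_apply, hS, hS', Finset.sum_mul_sum, ← Finset.univ_product_univ,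
      Finset.sum_product]
    simp only [hW1, smul_mul_smul_comm]
  · simp only [sumSMul_apply]
    rw [hR']
    exact tendsto_finsetSum _ fun p _ => (hW2 p η hη φ).smul_const _

end Assembly

section Final

open scoped FourierTransform

variable {m : ℕ}

lemma sphereArea_ne_zero (hm : 0 < m) : (sphereArea m : ℂ) ≠ 0 := by
  have hm' : (0 : ℝ) < m := by exact_mod_cast hm
  have := Real.Gamma_pos_of_pos (s := (m : ℝ) / 2) (by positivity)
  have := Real.pi_pos
  refine Complex.ofReal_ne_zero.2 (ne_of_gt ?_)
  unfold sphereArea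
  positivity

lemma finitePart_const_mul (μ c : ℂ) {h : ℝ → ℂ} (hh : ContDiff ℝ ∞ h) :
    finitePart μ (fun r => c * h r) = c * finitePart μ h := by
  have hd : ∀ k : ℕ, iteratedDeriv k (fun r => c * h r) 0 = c * iteratedDeriv k h 0 := fun k =>
    iteratedDeriv_const_mul c ((hh.of_le (by exact_mod_cast le_top)).contDiffAt)
  simp only [finitePart, hd, mul_add]
  congr 1
  · congr 1
    · rw [← integral_const_mul]
      congr 1
      ext r
      have hs : ∀ N : ℕ, ∑ k ∈ Finset.range N,
          c * iteratedDeriv k h 0 / (k.factorial : ℂ) * (r : ℂ) ^ k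
          = c * ∑ k ∈ Finset.range N, iteratedDeriv k h 0 / (k.factorial : ℂ) * (r : ℂ) ^ k := by
        intro N
        rw [Finset.mul_sum]
        exact Finset.sum_congr rfl fun k _ => by ring
      rw [hs]
      ring
    · rw [← integral_const_mul]
      congr 1
      ext r
      ring
  · rw [Finset.mul_sum]
    refine Finset.sum_congr rfl fun k _ => ?_
    split_ifs <;> ring

lemma finitePart_natCast {n : ℕ} {h : ℝ → ℂ}
    (hi : IntegrableOn (fun r : ℝ => (r : ℂ) ^ n * h r) (Set.Ioi 0)) (c : ℂ) :
    finitePart (n : ℂ) (fun r => c * h r) = c * ∫ r in Set.Ioi (0 : ℝ), (r : ℂ) ^ n * h r := by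
  have hf : ⌊-((n : ℂ)).re⌋₊ = 0 := by
    rw [Nat.floor_eq_zero]
    simp
    have : (0 : ℝ) ≤ n := Nat.cast_nonneg n
    linarith
  have hi' := hi
  rw [← Set.Ioc_union_Ioi_eq_Ioi zero_le_one, integrableOn_union] at hi'
  simp only [finitePart, hf, Finset.range_zero, Finset.sum_empty, sub_zero, add_zero,
    Complex.cpow_natCast]
  rw [← Set.Ioc_union_Ioi_eq_Ioi zero_le_one, setIntegral_union (by simp) measurableSet_Ioi
    hi'.1 hi'.2, mul_add, ← integral_const_mul, ← integral_const_mul]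
  congr 1 <;> (congr 1; ext r; ring)

lemma mean0_eq (φ : E m → ℂ) :
    mean0 φ = fun r => (1 / (sphereArea m : ℂ)) * sphInt (coordWeight none) φ r := by
  ext r
  simp [mean0, sphInt, coordWeight, coord]

lemma mean1_eq (i : Fin m) (φ : E m → ℂ) :
    mean1 i φ = fun r => (1 / (sphereArea m : ℂ)) * sphInt (coordWeight (some i)) φ r := rfl

lemma sphereArea_mul_finitePart_neg (hm : 0 < m) (N : ℕ) (o : Option (Fin m)) (φ : 𝓢(E m, ℂ)) :
    (sphereArea m : ℂ) * finitePart (-(N : ℂ))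
      (fun r => (1 / (sphereArea m : ℂ)) * sphInt (coordWeight o) φ r)
      = fpKer N (coordWeight o) φ := by
  have hφ : BddSmooth (φ : E m → ℂ) := by simpa using bddSmooth_translate φ 0
  rw [finitePart_const_mul _ _ (bddSmooth_sphInt (weight_coordWeight o) hφ).smooth, ← mul_assoc,
    mul_one_div_cancel (sphereArea_ne_zero hm), one_mul, fpKer]

lemma sphereArea_mul_finitePart_log (hm : 0 < m) (p q : ℝ) (j : ℕ) (o : Option (Fin m))
    (φ : 𝓢(E m, ℂ)) :
    (sphereArea m : ℂ) * finitePart ((2 * j + coordDeg o + (m - 1) : ℕ) : ℂ)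
      (fun r => (1 / (sphereArea m : ℂ)) * sphInt (coordWeight o)
        (fun x => ((p * Real.log ‖x‖ + q : ℝ) : ℂ) * φ x) r)
      = ∫ y, logPow p q j o y * φ y := by
  have h1 := polar_coordinates hm ((moderate_logPow hm p q (le_refl j) o).integrable_mul φ)
  have heq : Set.EqOn (fun r : ℝ => r ^ (m - 1) •
      ∫ w, logPow p q j o (r • (w : E m)) * φ (r • (w : E m)) ∂(surf m))
      (fun r : ℝ => (r : ℂ) ^ (2 * j + coordDeg o + (m - 1)) * sphInt (coordWeight o)
        (fun x => ((p * Real.log ‖x‖ + q : ℝ) : ℂ) * φ x) r) (Set.Ioi 0) := by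
    intro r hr
    have hr : (0 : ℝ) < r := hr
    simp only [sphInt]
    rw [← integral_smul, ← integral_const_mul]
    refine integral_congr_ae (Eventually.of_forall fun w => ?_)
    simp only [logPow, norm_smul, norm_sphere, mul_one, Real.norm_of_nonneg hr.le, coord_smul,
      coordWeight, Complex.real_smul]
    push_cast
    ring
  rw [finitePart_natCast (h1.1.congr_fun heq measurableSet_Ioi), ← mul_assoc,
    mul_one_div_cancel (sphereArea_ne_zero hm), one_mul, h1.2,
    setIntegral_congr_fun measurableSet_Ioi heq]

/-- The constant of the kernel. -/
def kernelConst (m j ε : ℕ) : ℝ :=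
  2 ^ (m + 2 * j + ε) * Real.Gamma ((m : ℝ) + j + ε) * Real.pi ^ j *
    (Real.pi ^ (-((m : ℝ) / 2 + j)) / Real.Gamma (-((m : ℝ) / 2 + j)))

/-- The constant of the normalized distribution. -/
def starConst (m j ε : ℕ) : ℝ :=
  Real.pi ^ ((m : ℝ) / 2 + j + ε) / Real.Gamma ((m : ℝ) / 2 + j + ε)

lemma ofReal_const {x : ℝ} {z : ℂ} (hz : z = (x : ℂ)) :
    (Real.pi : ℂ) ^ z / Complex.Gamma z = ((Real.pi ^ x / Real.Gamma x : ℝ) : ℂ) := by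
  rw [hz, ← Complex.ofReal_cpow Real.pi_pos.le, Complex.Gamma_ofReal]
  push_cast
  rfl

lemma TStar_eq {l : ℂ} (h : ¬ ∃ k : ℕ, l = -m - 2 * k) (φ : E m → ℂ) :
    TStar m l φ = ((Real.pi : ℂ) ^ ((l + m) / 2) / Complex.Gamma ((l + m) / 2)) • T m l φ := by
  rw [TStar, dif_neg h]
  rfl

lemma UStar_eq {l : ℂ} (h : ¬ ∃ k : ℕ, l = -m - 2 * k - 1) (φ : E m → ℂ) :
    UStar m l φ =
      ((Real.pi : ℂ) ^ ((l + m + 1) / 2) / Complex.Gamma ((l + m + 1) / 2)) • U m l φ := by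
  rw [UStar, dif_neg h]
  rfl

lemma exp_odd (hm : Odd m) (j : ℕ) :
    Complex.exp (Complex.I * Real.pi * ((m : ℂ) + 2 * j)) = -1 := by
  obtain ⟨p, rfl⟩ := hm
  have : Complex.I * Real.pi * (((2 * p + 1 : ℕ) : ℂ) + 2 * j)
      = Real.pi * Complex.I + (p + j : ℕ) * (2 * Real.pi * Complex.I) := by
    push_cast
    ring
  rw [this, Complex.exp_add, Complex.exp_nat_mul_two_pi_mul_I, mul_one, Complex.exp_pi_mul_I]

lemma exp_even (hm : Odd m) (j : ℕ) :
    Complex.exp (Complex.I * Real.pi * ((m : ℂ) + 2 * j + 1)) = 1 := by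
  have h : Complex.I * Real.pi * ((m : ℂ) + 2 * j + 1)
      = Complex.I * Real.pi * ((m : ℂ) + 2 * j) + Real.pi * Complex.I := by ring
  rw [h, Complex.exp_add, exp_odd hm, Complex.exp_pi_mul_I]
  norm_num

lemma scalar_const {ε : ℕ} {z g w : ℂ} (j : ℕ) (hz : z = ((m + 2 * j + ε : ℕ) : ℂ))
    (hg : g = (((m : ℝ) + j + ε : ℝ) : ℂ)) (hw : w = -(j : ℂ)) :
    (2 : ℂ) ^ z * Complex.Gamma g / (Real.pi : ℂ) ^ w
      = ((2 ^ (m + 2 * j + ε) * Real.Gamma ((m : ℝ) + j + ε) * Real.pi ^ j : ℝ) : ℂ) := by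
  rw [hz, hg, hw, Complex.cpow_natCast, Complex.Gamma_ofReal, Complex.cpow_neg,
    Complex.cpow_natCast, div_inv_eq_mul]
  push_cast
  rfl

lemma kernelH_even (hm : Odd m) (j : ℕ) (φ : 𝓢(E m, ℂ)) :
    kernelH m ((m : ℂ) + 2 * j) φ
      = ((kernelConst m j 0 : ℂ) * fpKer (m + 2 * j + 1) (coordWeight none) φ) • (1 : Cl m) := by
  have hne : ¬ ∃ k : ℕ, -(m : ℂ) - ((m : ℂ) + 2 * j) = -m - 2 * k := by
    rintro ⟨k, hk⟩
    have h1 : ((m + 2 * j : ℕ) : ℂ) = ((2 * k : ℕ) : ℂ) := by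
      push_cast
      linear_combination -hk
    have h2 : m + 2 * j = 2 * k := by exact_mod_cast h1
    obtain ⟨p, hp⟩ := hm
    omega
  have hfp : -(m : ℂ) - ((m : ℂ) + 2 * j) + m - 1 = -((m + 2 * j + 1 : ℕ) : ℂ) := by
    push_cast
    ring
  rw [kernelH, exp_odd hm]
  simp only [Pi.sub_apply, Pi.smul_apply]
  rw [TStar_eq hne, scalar_const (m := m) (ε := 0) j (by push_cast; ring) (by push_cast; ring)
    (by ring), ofReal_const (x := -((m : ℝ) / 2 + j)) (by push_cast; ring), T, mean0_eq, hfp,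
    sphereArea_mul_finitePart_neg hm.pos, Algebra.algebraMap_eq_smul_one, kernelConst]
  norm_num
  simp only [smul_smul]
  congr 1
  ring

lemma kernelH_odd (hm : Odd m) (j : ℕ) (φ : 𝓢(E m, ℂ)) :
    kernelH m ((m : ℂ) + 2 * j + 1) φ
      = ∑ i : Fin m, (-(kernelConst m j 1 : ℂ) *
        fpKer (m + 2 * j + 1 + 1) (coordWeight (some i)) φ) • e m i := by
  have hne : ¬ ∃ k : ℕ, -(m : ℂ) - ((m : ℂ) + 2 * j + 1) = -m - 2 * k - 1 := by
    rintro ⟨k, hk⟩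
    have h1 : ((m + 2 * j : ℕ) : ℂ) = ((2 * k : ℕ) : ℂ) := by
      push_cast
      linear_combination -hk
    have h2 : m + 2 * j = 2 * k := by exact_mod_cast h1
    obtain ⟨p, hp⟩ := hm
    omega
  have hfp : -(m : ℂ) - ((m : ℂ) + 2 * j + 1) + m - 1 = -((m + 2 * j + 1 + 1 : ℕ) : ℂ) := by
    push_cast
    ring
  rw [kernelH, exp_even hm]
  simp only [Pi.sub_apply, Pi.smul_apply]
  rw [UStar_eq hne, scalar_const (m := m) (ε := 1)
    (g := ((m : ℂ) + ((m : ℂ) + 2 * j + 1) + 1) / 2) (w := ((m : ℂ) - ((m : ℂ) + 2 * j + 1) + 1) / 2)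
    j (by push_cast; ring) (by push_cast; ring) (by ring), ofReal_const (x := -((m : ℝ) / 2 + j)) (by push_cast; ring), U, hfp]
  simp only [mean1_eq, sphereArea_mul_finitePart_neg hm.pos, kernelConst]
  norm_num
  simp only [Finset.smul_sum, smul_smul]
  refine Finset.sum_congr rfl fun i _ => ?_
  congr 1
  ring

lemma logMul_TStar (hm : 0 < m) (p q : ℝ) (j : ℕ) (φ : 𝓢(E m, ℂ)) :
    logMul p q (TStar m (2 * (j : ℂ))) φ
      = (∫ y, ((starConst m j 0 : ℂ) * logPow p q j none y) * φ y) • (1 : Cl m) := by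
  have hne : ¬ ∃ k : ℕ, 2 * (j : ℂ) = -m - 2 * k := by
    rintro ⟨k, hk⟩
    have h1 : ((2 * j + m + 2 * k : ℕ) : ℂ) = 0 := by
      push_cast
      linear_combination hk
    have h2 : 2 * j + m + 2 * k = 0 := by exact_mod_cast h1
    omega
  have hfp : 2 * (j : ℂ) + m - 1 = ((2 * j + coordDeg (none : Option (Fin m)) + (m - 1) : ℕ) : ℂ) := by
    push_cast [Nat.cast_sub (Nat.succ_le_of_lt hm), coordDeg]
    ring
  simp only [mul_assoc]
  rw [integral_const_mul, logMul, TStar_eq hne, T, mean0_eq, hfp,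
    sphereArea_mul_finitePart_log hm,
    ofReal_const (x := (m : ℝ) / 2 + j + (0 : ℕ)) (by push_cast; ring),
    Algebra.algebraMap_eq_smul_one, smul_smul, starConst]

lemma logMul_UStar (hm : 0 < m) (p q : ℝ) (j : ℕ) (φ : 𝓢(E m, ℂ)) :
    logMul p q (UStar m (2 * (j : ℂ) + 1)) φ
      = ∑ i : Fin m, (∫ y, ((starConst m j 1 : ℂ) * logPow p q j (some i) y) * φ y) • e m i := by
  have hne : ¬ ∃ k : ℕ, 2 * (j : ℂ) + 1 = -m - 2 * k - 1 := by
    rintro ⟨k, hk⟩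
    have h1 : ((2 * j + m + 2 * k + 2 : ℕ) : ℂ) = 0 := by
      push_cast
      linear_combination hk
    have h2 : 2 * j + m + 2 * k + 2 = 0 := by exact_mod_cast h1
    omega
  have hfp : ∀ i : Fin m, 2 * (j : ℂ) + 1 + m - 1
      = ((2 * j + coordDeg (some i) + (m - 1) : ℕ) : ℂ) := by
    intro i
    push_cast [Nat.cast_sub (Nat.succ_le_of_lt hm), coordDeg]
    ring
  simp only [mul_assoc, integral_const_mul]
  rw [logMul, UStar_eq hne, U,
    ofReal_const (x := (m : ℝ) / 2 + j + (1 : ℕ)) (by push_cast; ring), Finset.smul_sum]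
  refine Finset.sum_congr rfl fun i _ => ?_
  rw [mean1_eq, hfp i, sphereArea_mul_finitePart_log hm, smul_smul, starConst]

lemma pq_even (m j : ℕ) : (pq m (2 * j)).1
    = -((-1) ^ j / (2 ^ (m - 1) * Real.pi ^ m * (4 * Real.pi) ^ j * j.factorial)) := by
  have := Real.pi_pos
  induction j with
  | zero => simp [pq]
  | succ j ih =>
    have h1 : (pq m (2 * (j + 1))).1
        = 1 / ((2 * j + 1 : ℕ) + 1 : ℝ) * (-(1 / (2 * Real.pi)) * (pq m (2 * j)).1) := by
      show (pq m (2 * j + 1 + 1)).1 = _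
      rw [pq, if_neg (by simp), pq, if_pos (by simp)]
    rw [h1, ih, Nat.factorial_succ]
    push_cast
    field_simp
    ring

lemma pq_odd (m j : ℕ) : (pq m (2 * j + 1)).1 = -(1 / (2 * Real.pi)) * (pq m (2 * j)).1 := by
  rw [pq, if_pos (by simp)]

lemma Gamma_neg_ne_zero (hm : Odd m) (j : ℕ) : Real.Gamma (-((m : ℝ) / 2 + j)) ≠ 0 := by
  refine Real.Gamma_ne_zero fun k hk => ?_
  have h1 : ((m + 2 * j : ℕ) : ℝ) = ((2 * k : ℕ) : ℝ) := by
    push_cast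
    linarith
  have h2 : m + 2 * j = 2 * k := by exact_mod_cast h1
  obtain ⟨p, hp⟩ := hm
  omega

lemma const_mul (hm : Odd m) (j ε : ℕ) (p : ℝ) :
    kernelConst m j ε * starConst m j ε *
      -(p * ((-1) ^ j * (j.factorial : ℝ)) / (2 * Real.pi ^ j) *
        Real.Gamma ((m : ℝ) / 2 + j + ε) * fpConst ((m : ℝ) / 2 + j) ((m : ℝ) + j + ε))
    = -(2 ^ (m + 2 * j + ε) * Real.pi ^ (m + j + 2 * ε) * ((-1) ^ j * j.factorial) * p / 2) := by
  have hpi := Real.pi_pos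
  have hm0 : (0 : ℝ) < m := by exact_mod_cast hm.pos
  have h1 := (Real.Gamma_pos_of_pos (s := (m : ℝ) / 2 + j + ε) (by positivity)).ne'
  have h2 := (Real.Gamma_pos_of_pos (s := (m : ℝ) + j + ε) (by positivity)).ne'
  have h3 := Gamma_neg_ne_zero hm j
  have h4 : Real.pi ^ (-((m : ℝ) / 2 + j)) * Real.pi ^ ((m : ℝ) / 2 + j + ε)
      * Real.pi ^ ((m : ℝ) + j + ε) = Real.pi ^ (m + j + 2 * ε) := by
    rw [← Real.rpow_add hpi, ← Real.rpow_add hpi, ← Real.rpow_natCast]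
    congr 1
    push_cast
    ring
  rw [kernelConst, starConst, fpConst, ← h4]
  generalize Real.Gamma (-((m : ℝ) / 2 + j)) = g at h3 ⊢
  field_simp

lemma const_even (hm : Odd m) (j : ℕ) :
    kernelConst m j 0 * starConst m j 0 *
      -((pq m (2 * j)).1 * ((-1) ^ j * (j.factorial : ℝ)) / (2 * Real.pi ^ j) *
        Real.Gamma ((m : ℝ) / 2 + j + (0 : ℕ)) *
        fpConst ((m : ℝ) / 2 + j) ((m : ℝ) + j + (0 : ℕ))) = 1 := by
  have hpi := Real.pi_pos
  have hs : ((-1 : ℝ) ^ j) * (-1) ^ j = 1 := by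
    rw [← mul_pow]
    simp
  obtain ⟨n, rfl⟩ : ∃ n, m = n + 1 := ⟨m - 1, (Nat.succ_pred_eq_of_pos hm.pos).symm⟩
  rw [const_mul hm, pq_even, Nat.add_sub_cancel]
  have h4 : (4 : ℝ) ^ j = 2 ^ (2 * j) := by
    rw [pow_mul]
    norm_num
  rw [mul_pow, h4]
  field_simp
  linear_combination Real.pi ^ (n + 1 + j) * 2 ^ (n + 1 + 2 * j) * hs

lemma const_odd (hm : Odd m) (j : ℕ) :
    -kernelConst m j 1 * starConst m j 1 *
      -((pq m (2 * j + 1)).1 * ((-1) ^ j * (j.factorial : ℝ)) / (2 * Real.pi ^ j) *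
        Real.Gamma ((m : ℝ) / 2 + j + (1 : ℕ)) *
        fpConst ((m : ℝ) / 2 + j) ((m : ℝ) + j + (1 : ℕ))) = Real.pi := by
  have hpi := Real.pi_ne_zero
  have h1 := const_even hm j
  have h2 := const_mul hm j 1 (pq m (2 * j + 1)).1
  rw [const_mul hm] at h1
  rw [neg_mul, neg_mul, h2, pq_odd]
  field_simp at h1 ⊢
  linear_combination 2 * Real.pi ^ 2 * h1

lemma integral_fourier (φ : 𝓢(E m, ℂ)) : ∫ ξ, 𝓕 φ ξ = φ 0 := by
  have h := fourierInv_transHat φ 0 0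
  rw [add_zero, Real.fourierInv_eq] at h
  rw [← h]
  refine integral_congr_ae (Eventually.of_forall fun ξ => ?_)
  simp [transHat]

lemma limitForm_none (φ : 𝓢(E m, ℂ)) : limitForm none none φ = φ 0 := by
  rw [← integral_fourier, limitForm]
  refine integral_congr_ae (Eventually.of_forall fun ξ => ?_)
  simp [coordDeg, coordI, coord]

lemma limitForm_swap (i k : Fin m) (φ : 𝓢(E m, ℂ)) :
    limitForm (some i) (some k) φ = limitForm (some k) (some i) φ := by
  simp only [limitForm, coordDeg, mul_comm (coordI (some i) _)]

lemma sum_limitForm_diag (hm : 0 < m) (φ : 𝓢(E m, ℂ)) :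
    ∑ i : Fin m, limitForm (some i) (some i) φ = -((Real.pi : ℂ)⁻¹ * φ 0) := by
  simp only [limitForm]
  rw [← integral_finsetSum _ fun i _ => integrable_limitForm rfl φ, ← integral_fourier,
    ← neg_mul, ← integral_const_mul]
  refine integral_congr_ae ?_
  filter_upwards [ae_ne_zero hm] with ξ hξ
  have hn : (‖ξ‖ : ℂ) ≠ 0 := Complex.ofReal_ne_zero.2 (norm_ne_zero_iff.2 hξ)
  have hpi : (Real.pi : ℂ) ≠ 0 := Complex.ofReal_ne_zero.2 Real.pi_ne_zero
  have hsum : ∑ i : Fin m, ((ξ i : ℝ) : ℂ) ^ 2 = (‖ξ‖ : ℂ) ^ 2 := by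
    have := EuclideanSpace.real_norm_sq_eq ξ
    rw [← Complex.ofReal_pow, this]
    push_cast
    rfl
  have e : ∀ i : Fin m, ((piSq ξ ^ coordDeg (some i))⁻¹ : ℝ) •
      (coordI (some i) ξ * coordI (some i) ξ * 𝓕 φ ξ)
      = ((ξ i : ℝ) : ℂ) ^ 2 * (-(Real.pi * (‖ξ‖ : ℂ) ^ 2)⁻¹ * 𝓕 φ ξ) := by
    intro i
    simp only [coordDeg, coordI, coord, piSq, Complex.real_smul, pow_one]
    push_cast
    linear_combination ((Real.pi * (‖ξ‖ : ℂ) ^ 2)⁻¹ * ((ξ i : ℝ) : ℂ) ^ 2 * 𝓕 φ ξ) * Complex.I_sq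
  simp only [e]
  rw [← Finset.sum_mul, hsum]
  field_simp

lemma e_mul_add_swap (i k : Fin m) :
    e m i * e m k + e m k * e m i = (if i = k then (-2 : ℂ) else 0) • (1 : Cl m) := by
  rw [e, e, CliffordAlgebra.ι_mul_ι_add_swap, Algebra.algebraMap_eq_smul_one]
  congr 1
  have h : ∀ v w : Fin m → ℂ, QuadraticMap.polar (negSq m) v w = ∑ l, -2 * (v l * w l) := by
    intro v w
    simp only [QuadraticMap.polar, negSq, QuadraticMap.weightedSumSquares_apply, Pi.add_apply]
    rw [← Finset.sum_sub_distrib, ← Finset.sum_sub_distrib]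
    refine Finset.sum_congr rfl fun l _ => ?_
    simp only [smul_eq_mul]
    ring
  rw [h, ← Finset.mul_sum]
  simp [Pi.single_apply, Finset.sum_ite_eq, eq_comm]

/-- The limit form of the coordinates contracted with the generators. -/
lemma sum_limitForm (hm : 0 < m) (φ : 𝓢(E m, ℂ)) :
    ∑ p : Fin m × Fin m, limitForm (some p.1) (some p.2) φ • (e m p.1 * e m p.2)
      = ((Real.pi : ℂ)⁻¹ * φ 0) • (1 : Cl m) := by
  set X := ∑ p : Fin m × Fin m, limitForm (some p.1) (some p.2) φ • (e m p.1 * e m p.2)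
  have hswap : X = ∑ p : Fin m × Fin m,
      limitForm (some p.1) (some p.2) φ • (e m p.2 * e m p.1) := by
    rw [← (Equiv.prodComm (Fin m) (Fin m)).sum_comp]
    refine Finset.sum_congr rfl fun p _ => ?_
    simp only [Equiv.prodComm_apply, Prod.fst_swap, Prod.snd_swap]
    rw [limitForm_swap]
  have h2 : (2 : ℂ) • X = (2 : ℂ) • (((Real.pi : ℂ)⁻¹ * φ 0) • (1 : Cl m)) := by
    rw [two_smul]
    nth_rewrite 2 [hswap]
    rw [← Finset.sum_add_distrib]
    simp only [← smul_add, e_mul_add_swap, smul_smul]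
    rw [← Finset.sum_smul, ← Finset.univ_product_univ, Finset.sum_product]
    congr 1
    simp only [mul_ite, mul_zero, Finset.sum_ite_eq, Finset.mem_univ, if_true]
    rw [← Finset.sum_mul, sum_limitForm_diag hm]
    ring
  exact smul_right_injective _ (two_ne_zero : (2 : ℂ) ≠ 0) h2

lemma Moderate.const_mul {a : ℝ} {F : E m → ℂ} (hF : Moderate a F) (c : ℂ) :
    Moderate a fun y => c * F y where
  meas := hF.meas.const_mul c
  bound := by
    obtain ⟨s, C, hs, hC, hb⟩ := hF.bound
    refine ⟨_, ‖c‖ * C, hs.const_mul ‖c‖, by positivity, fun y => ?_⟩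
    rw [norm_mul, mul_assoc, ← mul_add]
    gcongr
    exact hb y

lemma convolvable_fpKer (hm : 0 < m) (j : ℕ) (o : Option (Fin m)) :
    Convolvable (2 * (j : ℝ) + coordDeg o + 1 / 2)
      (fpKer (m + 2 * j + 1 + coordDeg o) (coordWeight o)) :=
  fpKer_convolvable (by positivity) (by
    push_cast
    have : (1 : ℝ) ≤ m := by exact_mod_cast hm
    linarith) (weight_coordWeight o)

lemma integral_const_mul_const_mul {α : Type*} [MeasurableSpace α] {μ : Measure α} (c d : ℂ)
    (f g : α → ℂ) : ∫ y, c * f y * (d * g y) ∂μ = d * c * ∫ y, f y * g y ∂μ := by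
  rw [← integral_const_mul]
  congr 1
  ext y
  ring

theorem isFundamentalSolution_even (hm : Odd m) (j : ℕ) :
    IsFundamentalSolution ((m : ℂ) + 2 * (j : ℂ))
      (logMul (pq m (2 * j)).1 (pq m (2 * j)).2 (TStar m (2 * (j : ℂ)))) := by
  refine isConvolution_of_sum (ι := Unit) (b := fun _ => 1)
    (κ := fun _ φ => (kernelConst m j 0 : ℂ) * fpKer (m + 2 * j + 1) (coordWeight none) φ)
    (f := fun _ y => (starConst m j 0 : ℂ) *
      logPow (pq m (2 * j)).1 (pq m (2 * j)).2 j none y)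
    (fun _ => (convolvable_fpKer hm.pos j none).const_mul _)
    (fun _ => (moderate_logPow hm.pos _ _ le_rfl none).const_mul _)
    (fun φ => ?_) (fun φ => ?_) isTempered_delta (fun φ => ?_)
  · rw [kernelH_even hm]
    simp
  · rw [logMul_TStar hm.pos]
    simp
  · have h : ∫ y, logPow (pq m (2 * j)).1 (pq m (2 * j)).2 j none y *
        fpKer (m + 2 * j + 1) (coordWeight none) (fun x => φ (x + y)) = _ :=
      integral_logPow_mul_fpKer hm j (o := none) (o' := none) rfl rfl rfl _ _ φ
    have hc : (kernelConst m j 0 : ℂ) * (starConst m j 0 : ℂ) * ∫ y,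
        logPow (pq m (2 * j)).1 (pq m (2 * j)).2 j none y *
          fpKer (m + 2 * j + 1) (coordWeight none) (fun x => φ (x + y)) = φ 0 := by
      rw [h, limitForm_none, ← mul_assoc, ← Complex.ofReal_mul, ← Complex.ofReal_mul]
      exact (congrArg (fun x : ℝ => (x : ℂ) * φ 0) (const_even hm j)).trans (by simp)
    simp only [integral_const_mul_const_mul, hc]
    simp [delta, Algebra.algebraMap_eq_smul_one]

theorem isFundamentalSolution_odd (hm : Odd m) (j : ℕ) :
    IsFundamentalSolution ((m : ℂ) + 2 * (j : ℂ) + 1)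
      (logMul (pq m (2 * j + 1)).1 (pq m (2 * j + 1)).2 (UStar m (2 * (j : ℂ) + 1))) := by
  refine isConvolution_of_sum (ι := Fin m) (b := e m)
    (a := 2 * (j : ℝ) + (1 : ℕ) + 1 / 2)
    (κ := fun i φ => (((-kernelConst m j 1 : ℝ)) : ℂ) *
      fpKer (m + 2 * j + 1 + 1) (coordWeight (some i)) φ)
    (f := fun i y => (starConst m j 1 : ℂ) *
      logPow (pq m (2 * j + 1)).1 (pq m (2 * j + 1)).2 j (some i) y)
    (fun i => (convolvable_fpKer hm.pos j (some i)).const_mul _)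
    (fun i => (moderate_logPow hm.pos _ _ le_rfl (some i)).const_mul _)
    (fun φ => ?_) (fun φ => ?_) isTempered_delta (fun φ => ?_)
  · rw [kernelH_odd hm]
    push_cast
    rfl
  · rw [logMul_UStar hm.pos]
  · have h : ∀ i k : Fin m, ∫ y, logPow (pq m (2 * j + 1)).1 (pq m (2 * j + 1)).2 j (some k) y *
        fpKer (m + 2 * j + 1 + 1) (coordWeight (some i)) (fun x => φ (x + y)) = _ := fun i k =>
      integral_logPow_mul_fpKer hm j (o := some i) (o' := some k) rfl rfl rfl _ _ φ
    have hc : ∀ i k : Fin m, ((-kernelConst m j 1 : ℝ) : ℂ) * (starConst m j 1 : ℂ) * ∫ y,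
        logPow (pq m (2 * j + 1)).1 (pq m (2 * j + 1)).2 j (some k) y *
          fpKer (m + 2 * j + 1 + 1) (coordWeight (some i)) (fun x => φ (x + y))
        = Real.pi * limitForm (some i) (some k) φ := by
      intro i k
      rw [h, ← mul_assoc, ← Complex.ofReal_mul, ← Complex.ofReal_mul]
      exact congrArg (fun x : ℝ => (x : ℂ) * limitForm (some i) (some k) φ) (const_odd hm j)
    simp only [integral_const_mul_const_mul, hc, mul_smul]
    rw [← Finset.smul_sum, sum_limitForm hm.pos, smul_smul, mul_inv_cancel_left₀
      (Complex.ofReal_ne_zero.2 Real.pi_ne_zero), delta, Algebra.algebraMap_eq_smul_one]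

end Final

end CliffordDist

end

theorem proposition5p3 (m : ℕ) (hm : Odd m) (j : ℕ) :
    CliffordDist.IsFundamentalSolution ((m : ℂ) + 2 * (j : ℂ))
      (CliffordDist.logMul (CliffordDist.pq m (2 * j)).1 (CliffordDist.pq m (2 * j)).2
        (CliffordDist.TStar m (2 * (j : ℂ)))) ∧
    CliffordDist.IsFundamentalSolution ((m : ℂ) + 2 * (j : ℂ) + 1)
      (CliffordDist.logMul (CliffordDist.pq m (2 * j + 1)).1 (CliffordDist.pq m (2 * j + 1)).2
        (CliffordDist.UStar m (2 * (j : ℂ) + 1))) := 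
  ⟨CliffordDist.isFundamentalSolution_even hm j, CliffordDist.isFundamentalSolution_odd hm j⟩
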